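/- **Jacobi polynomials.** Let $R$ be a root system in a Euclidean space $V$ with Weyl group $W$, positive roots $R^+$, and let $\kappa$ be a real-valued $W$-invariant function on $R$. Let $\rho^{(\kappa)}=\frac12\sum_{\alpha\in R^+}\kappa(\alpha)\alpha$, let $P^+$ be the set of dominant weights, write $\mu\le\lambda$ if $\lambda-\mu$ is a sum of positive roots (repetitions and the empty sum allowed), and put $m_\mu(t)=\sum_{\nu\in W\mu}e^{\langle\nu,t\rangle}$ $(t\in V)$. A Jacobi polynomial of highest weight $\lambda\in P^+$ is a function $p_\lambda=m_\lambda+\sum_{\mu\in P^+,\,\mu<\lambda}\Gamma_\mu m_\mu$ $(\Gamma_\mu\in\mathbb R)$ such that $$\Bigl(\Delta+\sum_{\alpha\in R^+}\kappa(\alpha)\coth(\tfrac12\langle\alpha,t\rangle)\,\partial_\alpha\Bigr)p_\lambda=\langle\lambda,\lambda+2\rho^{(\kappa)}\rangle\,p_\lambda$$ at all $t$ that lie on no root hyperplane. Let $n\ge1$. For $BC_n$ take $V=\mathbb R^n$ and $R^+=\{e_i\}\cup\{2e_i\}\cup\{e_i\pm e_j\}_{i<j}$, with $\kappa=k_1,k_2,k_3$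 on $e_i$, $2e_i$, $e_i\pm e_j$ respectively, and write $p_{B,\lambda}^{(k_1,k_2,k_3)}$. For $A_{n-1}$ take $V=\{t\in\mathbb R^n: t_1+\dots+t_n=0\}$ and $R^+=\{e_i-e_j\}_{i<j}$, with $\kappa$ constant equal to $k$, and write $p_{A,\lambda}^{(k)}$. Let $\pi$ be the orthogonal projection of $\mathbb R^n$ onto this hyperplane. For integers $\lambda_1\ge\dots\ge\lambda_n\ge0$ the Jack polynomial is $$j_\lambda^{(k)}(t)=e^{(t_1+\dots+t_n)(\lambda_1+\dots+\lambda_n)/n}\;p_{A,\pi(\lambda)}^{(k)}(\pi(t)),\qquad t\in\mathbb R^n.$$ **Theorem.** Let $n\ge1$ and let $\lambda\in\mathbb Z^n$ with $\lambda_1\ge\dots\ge\lambda_n\ge0$. There is a constant $C\ne0$, depending only on $\lambda$, such that the following holds. Let $k_3\in\mathbb R$ be such that $k_3\ge0$ or, more generally, such that for $A_{n-1}$ with multiplicity $k_3$ the eigenvalue $\langle\mu,\mu+2\rho^{(k_3)}\rangle$ for $\mu=\pi(\lambda)$ differs from the eigenvalues for all dominant $\mu<\pi(\lambda)$. Then the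 Jacobi polynomial $p_{A,\pi(\lambda)}^{(k_3)}$ exists and is unique. Let moreover $-\infty\le a\le1$, and let $(k_1,k_2)\in\mathbb R^2$ tend to infinity (in norm), with $k_2\ne0$, in such a way that $k_1/k_2\to-a$. Then $p_{B,\lambda}^{(k_1,k_2,k_3)}$ eventually exists and is unique, and for all $\tau,t\in\mathbb R^n$ related by $$e^{\tau_i}=\frac{a-1}{a-2}+\sinh^2\!\Bigl(\frac{t_i}2\Bigr)\qquad(i=1,\dots,n),$$ where $\frac{a-1}{a-2}$ is read as $1$ for $a=-\infty$, one has $$\lim_{(k_1,k_2)\to\infty,\;k_1/k_2\to-a}\;p_{B,\lambda}^{(k_1,k_2,k_3)}(t)=C\,j_\lambda^{(k_3)}(\tau).$$ -/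

import Mathlib

open Filter Topology
open scoped InnerProductSpace Laplacian

noncomputable section

namespace JacobiJack

/-! ### Jacobi polynomials attached to a family of positive roots

Throughout, `root : ι → V` is the family of positive roots of a root system in the Euclidean
space `V`, and `κ : ι → ℝ` is the multiplicity function on the positive roots. -/

section General

variable {V : Type*} [NormedAddCommGroup V] [InnerProductSpace ℝ V] [FiniteDimensional ℝ V]
variable {ι : Type*} [Fintype ι]

/-- The Weyl group: generated by the reflections in the hyperplanes orthogonal to the roots. -/
def weylGroup (root : ι → V) : Subgroup (V ≃ₗᵢ[ℝ] V) :=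
  Subgroup.closure (Set.range fun i => (Submodule.span ℝ {root i})ᗮ.reflection)

/-- The Weyl group orbit `W.μ`. -/
def weylOrbit (root : ι → V) (μ : V) : Set V :=
  {ν | ∃ w ∈ weylGroup root, w μ = ν}

/-- The set `P⁺` of dominant weights: `2⟨μ,α⟩/⟨α,α⟩` is a nonnegative integer for every
positive root `α`. -/
def dominantWeights (root : ι → V) : Set V :=
  {μ | ∀ i, ∃ m : ℕ, 2 * ⟪μ, root i⟫_ℝ / ⟪root i, root i⟫_ℝ = m}

/-- The partial order `μ ≤ ν`: the difference `ν - μ` is a sum of positive roots. -/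
def weightLE (root : ι → V) (μ ν : V) : Prop :=
  ν - μ ∈ AddSubmonoid.closure (Set.range root)

/-- The dominant weights strictly below `lam`. -/
def lowerWeights (root : ι → V) (lam : V) : Set V :=
  {μ | μ ∈ dominantWeights root ∧ weightLE root μ lam ∧ μ ≠ lam}

/-- The orbit sum `m_μ = ∑_{ν ∈ W.μ} e^ν`, as a function on `V`. -/
def orbitSum (root : ι → V) (μ : V) : V → ℝ :=
  fun t => ∑ᶠ ν ∈ weylOrbit root μ, Real.exp ⟪ν, t⟫_ℝ

/-- `ρ^(κ) = ½ ∑_{α > 0} κ(α) α`. -/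
def rho (root : ι → V) (κ : ι → ℝ) : V :=
  (1 / 2 : ℝ) • ∑ i, κ i • root i

/-- The eigenvalue `⟨μ, μ + 2ρ^(κ)⟩`. -/
def eigenvalue (root : ι → V) (κ : ι → ℝ) (μ : V) : ℝ :=
  ⟪μ, μ + (2 : ℝ) • rho root κ⟫_ℝ

/-- Hyperbolic cotangent. -/
def coth (x : ℝ) : ℝ := Real.cosh x / Real.sinh x

/-- The operator `Laplacian + ∑_{α > 0} κ(α) coth(α/2) ∂_α`; the coefficients are finite at the
points `t` that lie on no root hyperplane. -/
def jacobiOperator (root : ι → V) (κ : ι → ℝ) (f : V → ℝ) (t : V) : ℝ :=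
  Δ f t + ∑ i, κ i * coth (⟪root i, t⟫_ℝ / 2) * fderiv ℝ f t (root i)

/-- `p` is a Jacobi polynomial with highest weight `lam`: it is `m_lam` plus a linear combination
of the `m_μ` with `μ` dominant and `μ < lam`, and it satisfies the differential equation off the
root hyperplanes. -/
structure IsJacobi (root : ι → V) (κ : ι → ℝ) (lam : V) (p : V → ℝ) : Prop where
  triangular : p - orbitSum root lam ∈ Submodule.span ℝ (orbitSum root '' lowerWeights root lam)
  eigen : ∀ t : V, (∀ i, ⟪root i, t⟫_ℝ ≠ 0) →
    jacobiOperator root κ p t = eigenvalue root κ lam * p t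

/-- The Jacobi polynomial `p_lam`. It is meaningful when `∃! p, IsJacobi root κ lam p`. -/
def jacobi (root : ι → V) (κ : ι → ℝ) (lam : V) : V → ℝ :=
  Classical.epsilon (IsJacobi root κ lam)

/-- The eigenvalue belonging to `lam` differs from those belonging to the dominant weights
strictly below `lam`. -/
def Nondegenerate (root : ι → V) (κ : ι → ℝ) (lam : V) : Prop :=
  ∀ μ ∈ lowerWeights root lam, eigenvalue root κ μ ≠ eigenvalue root κ lam

end General

/-! ### The root systems `BC_n` and `A_{n-1}` -/

/-- Pairs `i < j`. -/
abbrev Pairs (n : ℕ) : Type := {p : Fin n × Fin n // p.1 < p.2}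

/-- Standard basis vector. -/
abbrev stdVec {n : ℕ} (i : Fin n) : EuclideanSpace ℝ (Fin n) := EuclideanSpace.single i 1

/-- Index set of the positive roots of `BC_n`: in this order the roots `e_i`, `2e_i`,
`e_i - e_j` (`i < j`), `e_i + e_j` (`i < j`). -/
abbrev BCIndex (n : ℕ) : Type := (Fin n ⊕ Fin n) ⊕ (Pairs n ⊕ Pairs n)

/-- The positive roots of `BC_n`. -/
def bcRoot (n : ℕ) : BCIndex n → EuclideanSpace ℝ (Fin n) :=
  Sum.elim
    (Sum.elim (fun i => stdVec i) (fun i => (2 : ℝ) • stdVec i))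
    (Sum.elim (fun p => stdVec p.1.1 - stdVec p.1.2) (fun p => stdVec p.1.1 + stdVec p.1.2))

/-- Multiplicities: `k₁` on `e_i`, `k₂` on `2e_i`, `k₃` on `e_i ± e_j`. -/
def bcMult (n : ℕ) (k₁ k₂ k₃ : ℝ) : BCIndex n → ℝ :=
  Sum.elim (Sum.elim (fun _ => k₁) (fun _ => k₂)) (fun _ => k₃)

/-- The hyperplane `t_1 + ⋯ + t_n = 0`. -/
def sumZero (n : ℕ) : Submodule ℝ (EuclideanSpace ℝ (Fin n)) where
  carrier := {t | ∑ i, t i = 0}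
  add_mem' := by
    intro s t hs ht
    simp only [Set.mem_ofPred_eq] at hs ht ⊢
    simp [Finset.sum_add_distrib, hs, ht]
  zero_mem' := by simp
  smul_mem' := by
    intro c t ht
    simp only [Set.mem_ofPred_eq] at ht ⊢
    simp [← Finset.mul_sum, ht]

/-- The positive roots `e_i - e_j` (`i < j`) of `A_{n-1}`, in the hyperplane. -/
def aRoot (n : ℕ) (p : Pairs n) : sumZero n :=
  ⟨stdVec p.1.1 - stdVec p.1.2, by
    change ∑ i, (stdVec p.1.1 - stdVec p.1.2 : EuclideanSpace ℝ (Fin n)) i = 0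
    simp [Finset.sum_sub_distrib]⟩

/-- The constant multiplicity `k` for `A_{n-1}`. -/
def aMult (n : ℕ) (k : ℝ) : Pairs n → ℝ := fun _ => k

/-- The orthogonal projection `π` of `ℝⁿ` onto the hyperplane. -/
def proj (n : ℕ) (t : EuclideanSpace ℝ (Fin n)) : sumZero n :=
  (sumZero n).orthogonalProjectionOnto t

/-- A tuple of natural numbers as a vector of `ℝⁿ`. -/
def toVec {n : ℕ} (lam : Fin n → ℕ) : EuclideanSpace ℝ (Fin n) :=
  WithLp.toLp 2 fun i => (lam i : ℝ)

/-- The Jack polynomial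
`j_lam^(k)(t) = e^{(t_1+⋯+t_n)(lam_1+⋯+lam_n)/n} p_{A,π(lam)}^(k)(π(t))`. -/
def jack (n : ℕ) (k : ℝ) (lam : Fin n → ℕ) (t : EuclideanSpace ℝ (Fin n)) : ℝ :=
  Real.exp ((∑ i, t i) * (∑ i, (lam i : ℝ)) / n) *
    jacobi (aRoot n) (aMult n k) (proj n (toVec lam)) (proj n t)

/-! ### The limit -/

/-- `(a - 1)/(a - 2)`, with its limit value `1` at `a = -∞`. -/
def shift (a : EReal) : ℝ :=
  if a = ⊥ then 1 else (a.toReal - 1) / (a.toReal - 2)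

/-- The filter on the `(k₁, k₂)`-plane describing `(k₁, k₂) → ∞`, `k₁ / k₂ → -a` (where the
quotient is defined, that is, `k₂ ≠ 0`). -/
def limitFilter (a : EReal) : Filter (ℝ × ℝ) :=
  Bornology.cobounded (ℝ × ℝ) ⊓ 𝓟 {k | k.2 ≠ 0} ⊓
    comap (fun k : ℝ × ℝ => ((k.1 / k.2 : ℝ) : EReal)) (𝓝 (-a))

end JacobiJack

end

/-! In the variables x_i = sinh²(t_i/2) the orbit sums of BC_n become symmetric polynomials, and the
BC_n operator becomes T + K E + L + (k₁ + k₂) G with K = k₁ + 2k₂ (`jacobiOperator_bcFun`). Here E =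
∑ x_i ∂_i, G = ∑ ∂_i, T preserves the degree, L lowers it by one, and T, L contain only k₃. In the
variables e^{t_i} the A_{n-1} operator acts on symmetric polynomials of fixed degree as the same T
minus a constant (`jacobiOperator_aFun`).

Let d = |λ|. In the component of degree d of the BC_n eigenvalue equation the terms with k₁ and k₂
cancel, so this component is an eigenvector of T. By uniqueness in type A it is a fixed multiple C J
of the Jack polynomial J, for all k₁, k₂ at which the equation holds
(`homogeneousComponent_eq_smul`).

The lower degrees are found by dividing the equation by K. As K → ∞ and (k₁ + k₂)/K → s it tends to
(E + sG − d) f = 0. Since E + sG is Euler's operator centred at (−s, …, −s), the polynomial C J(x +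
s) solves the limit equation and has the right leading component. The deviation u from it has degree
below d, where E + sG − d is injective; so u satisfies an equation u = o(1)(u + const) in a
finite-dimensional space and tends to 0 (`exists_deviation`, `tendsto_jacobi_bc`).

Existence and uniqueness for both root systems rest on triangularity
(`IsTriangular.existsUnique_eigen`). A linear functional `weight` on exponents replaces the
dominance order: at an exponent of maximal weight only the diagonal part of the operator is visible.
The BC_n eigenvalue is that of T plus K times the degree, so for large K the eigenvalues separate by
degree, and within one degree by the hypothesis for type A (`eventually_nondegenerate_bc`). The
condition a ≤ 1 keeps k₁/k₂ away from −2, hence K comparable to the norm of (k₁, k₂). -/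

noncomputable section

namespace JacobiJack

/-! ### Exponents of monomials and the dominance order -/

section Exponents

open Finset

variable {n : ℕ}

/-- A linear functional on exponents that is strictly increased by moving mass to smaller
indices. -/
def weight (ν : Fin n →₀ ℕ) : ℕ := ∑ i, (n - i.val) * ν i

/-- The exponents all of whose rearrangements are weakly dominated by `lam`. -/
def dominated (lam : Fin n → ℕ) : Set (Fin n →₀ ℕ) :=
  {ν | ∀ S : Finset (Fin n), ∑ i ∈ S, ν i ≤ ∑ i with i.val < #S, lam i}

/-- `μ` arises from `ν` by changing the entries `i`, `j` only, without increasing their sum or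
their maximum. -/
structure Move (i j : Fin n) (ν μ : Fin n →₀ ℕ) : Prop where
  off : ∀ l, l ≠ i → l ≠ j → μ l = ν l
  add_le : μ i + μ j ≤ ν i + ν j
  left_le : μ i ≤ max (ν i) (ν j)
  right_le : μ j ≤ max (ν i) (ν j)

lemma sum_eq_pair_add {M : Type*} [AddCommMonoid M] {i j : Fin n} (hij : i ≠ j) (g : Fin n → M) :
    ∑ l, g l = g i + g j + ∑ l ∈ (univ.erase i).erase j, g l := by
  rw [add_assoc, add_sum_erase _ _ (by simp [hij.symm]), add_sum_erase _ _ (mem_univ i)]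

lemma Move.sum_off {i j : Fin n} {ν μ : Fin n →₀ ℕ} (h : Move i j ν μ) {M : Type*}
    [AddCommMonoid M] (g : Fin n → ℕ → M) :
    ∑ l ∈ (univ.erase i).erase j, g l (μ l) = ∑ l ∈ (univ.erase i).erase j, g l (ν l) := by
  refine sum_congr rfl fun l hl => ?_
  simp only [mem_erase, mem_univ, and_true] at hl
  rw [h.off l hl.2 hl.1]

lemma Move.degree_eq_of {i j : Fin n} {ν μ : Fin n →₀ ℕ} (h : Move i j ν μ) (hij : i ≠ j)
    {a : ℕ} (hs : μ i + μ j + a = ν i + ν j) : μ.degree + a = ν.degree := by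
  have := h.sum_off (fun _ x => x)
  simp only [Finsupp.degree_eq_sum, sum_eq_pair_add hij] at *
  omega

lemma mapDomain_swap_apply (ν : Fin n →₀ ℕ) (i j l : Fin n) :
    ν.mapDomain (Equiv.swap i j) l = ν (Equiv.swap i j l) := by
  rw [Finsupp.mapDomain_equiv_apply, Equiv.symm_swap]

/-- For i < j the coefficient of `weight` at i exceeds that at j, and both are positive. Whichever
of ν and its swap carries the larger entry at i is heavier than μ; hence the disjunction. -/
lemma Move.weight_lt {i j : Fin n} {ν μ : Fin n →₀ ℕ} (h : Move i j ν μ) (hij : i < j)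
    (hs : μ i < max (ν i) (ν j) ∨ μ i + μ j < ν i + ν j) :
    weight μ < weight ν ∨ weight μ < weight (ν.mapDomain (Equiv.swap i j)) := by
  have h1 := h.sum_off (fun l x => (n - l.val) * x)
  have h2 : ∑ l ∈ (univ.erase i).erase j, (n - l.val) * ν (Equiv.swap i j l) =
      ∑ l ∈ (univ.erase i).erase j, (n - l.val) * ν l := by
    refine sum_congr rfl fun l hl => ?_
    simp only [mem_erase, mem_univ, and_true] at hl
    rw [Equiv.swap_apply_of_ne_of_ne hl.2 hl.1]
  simp only [weight, sum_eq_pair_add hij.ne, h1, mapDomain_swap_apply, h2, Equiv.swap_apply_left,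
    Equiv.swap_apply_right]
  obtain ⟨a, ha⟩ : ∃ a, n - i.val = n - j.val + a + 1 :=
    ⟨j.val - i.val - 1, by have := j.2; have : i.val < j.val := hij; omega⟩
  obtain ⟨b, hb⟩ : ∃ b, n - j.val = b + 1 := ⟨n - j.val - 1, by have := j.2; omega⟩
  rw [ha, hb]
  -- The share of the pair is written as (a + 1) · (entry at i) + (b + 1) · (sum of both entries):
  -- neither quantity increases, and one of them drops.
  have key : ∀ M m : ℕ, M + m = ν i + ν j → μ i ≤ M → (μ i < M ∨ μ i + μ j < ν i + ν j) →
      (b + 1 + a + 1) * μ i + (b + 1) * μ j < (b + 1 + a + 1) * M + (b + 1) * m := by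
    intro M m hM h3 h4
    have h5 := h.add_le
    have e1 : (b + 1 + a + 1) * μ i + (b + 1) * μ j = (a + 1) * μ i + (b + 1) * (μ i + μ j) := by
      ring
    have e2 : (b + 1 + a + 1) * M + (b + 1) * m = (a + 1) * M + (b + 1) * (ν i + ν j) := by
      rw [← hM]; ring
    rw [e1, e2]
    rcases h4 with h4 | h4
    · exact add_lt_add_of_lt_of_le (Nat.mul_lt_mul_of_pos_left h4 (by omega))
        (Nat.mul_le_mul_left _ h5)
    · exact add_lt_add_of_le_of_lt (Nat.mul_le_mul_left _ h3)
        (Nat.mul_lt_mul_of_pos_left h4 (by omega))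
  have hl := h.left_le
  rcases le_total (ν j) (ν i) with hc | hc
  · rw [max_eq_left hc] at hs hl
    left
    have := key (ν i) (ν j) rfl hl hs
    omega
  · rw [max_eq_right hc] at hs hl
    right
    have := key (ν j) (ν i) (add_comm _ _) hl hs
    omega

lemma weight_lt_of_lt {μ ν : Fin n →₀ ℕ} (h : μ < ν) : weight μ < weight ν := by
  obtain ⟨hle, i, hi⟩ := Pi.lt_def.mp (show (⇑μ : Fin n → ℕ) < ν from h)
  refine sum_lt_sum (fun l _ => Nat.mul_le_mul_left _ (hle l)) ⟨i, mem_univ _, ?_⟩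
  exact Nat.mul_lt_mul_of_pos_left hi (by have := i.2; omega)

lemma weight_le_of_le {μ ν : Fin n →₀ ℕ} (h : μ ≤ ν) : weight μ ≤ weight ν :=
  sum_le_sum fun l _ => Nat.mul_le_mul_left _ (h l)

/-- An exponent whose weight is not increased by transpositions is antitone. -/
lemma antitone_of_weight_swap_le {μ : Fin n →₀ ℕ}
    (h : ∀ i j, weight (μ.mapDomain (Equiv.swap i j)) ≤ weight μ) : Antitone μ := by
  intro i j hij
  by_contra! hlt
  have hij' : i < j := lt_of_le_of_ne hij (by rintro rfl; exact lt_irrefl _ hlt)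
  have hm : Move i j (μ.mapDomain (Equiv.swap i j)) μ := by
    refine ⟨fun l h1 h2 => ?_, ?_, ?_, ?_⟩ <;>
    simp only [mapDomain_swap_apply, Equiv.swap_apply_left, Equiv.swap_apply_right]
    · rw [Equiv.swap_apply_of_ne_of_ne h1 h2]
    · omega
    · simp
    · simp
  rcases hm.weight_lt hij' (Or.inl (by simp [hlt])) with h1 | h1
  · exact absurd (h i j) (by omega)
  · rw [← Finsupp.mapDomain_comp] at h1
    simp [← Equiv.coe_trans] at h1

lemma dominated_of_le {lam : Fin n → ℕ} {μ ν : Fin n →₀ ℕ} (h : μ ≤ ν) (hν : ν ∈ dominated lam) :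
    μ ∈ dominated lam :=
  fun S => (sum_le_sum fun i _ => h i).trans (hν S)

lemma mapDomain_mem_dominated {lam : Fin n → ℕ} {ν : Fin n →₀ ℕ} (hν : ν ∈ dominated lam)
    (σ : Equiv.Perm (Fin n)) : ν.mapDomain σ ∈ dominated lam := by
  intro S
  have := hν (S.map σ.symm.toEmbedding)
  simpa [Finsupp.mapDomain_equiv_apply] using this

/-- If S contains both i and j, the bound on the sum of the two entries suffices. If it contains
only one, the entry there is at most the maximum of the old ones, so the sum over S is bounded by
that for ν or for its swap, and both are dominated. -/
lemma Move.mem_dominated {lam : Fin n → ℕ} {i j : Fin n} {ν μ : Fin n →₀ ℕ} (h : Move i j ν μ)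
    (hν : ν ∈ dominated lam) : μ ∈ dominated lam := by
  have hσ := mapDomain_mem_dominated hν (Equiv.swap i j)
  by_cases hij : i = j
  · subst hij
    refine dominated_of_le (fun l => ?_) hν
    by_cases hl : l = i
    · subst hl; simpa using h.left_le
    · exact (h.off l hl hl).le
  intro S
  have hoff : ∀ l, l ≠ i → l ≠ j → (ν.mapDomain (Equiv.swap i j)) l = ν l := fun l h1 h2 => by
    rw [mapDomain_swap_apply, Equiv.swap_apply_of_ne_of_ne h1 h2]
  by_cases hi : i ∈ S <;> by_cases hj : j ∈ S
  · refine le_trans ?_ (hν S)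
    have hj' : j ∈ S.erase i := by simp [hj, Ne.symm hij]
    rw [← add_sum_erase _ _ hi, ← add_sum_erase _ _ hj', ← add_sum_erase _ _ hi,
      ← add_sum_erase _ _ hj']
    have : ∑ l ∈ (S.erase i).erase j, μ l = ∑ l ∈ (S.erase i).erase j, ν l :=
      sum_congr rfl fun l hl => by
        simp only [mem_erase] at hl
        exact h.off l hl.2.1 hl.1
    have := h.add_le
    omega
  · have e1 : ∑ l ∈ S.erase i, μ l = ∑ l ∈ S.erase i, ν l := sum_congr rfl fun l hl => by
      simp only [mem_erase] at hl
      exact h.off l hl.1 (by rintro rfl; exact hj hl.2)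
    have e2 : ∑ l ∈ S.erase i, (ν.mapDomain (Equiv.swap i j)) l = ∑ l ∈ S.erase i, ν l :=
      sum_congr rfl fun l hl => by
        simp only [mem_erase] at hl
        exact hoff l hl.1 (by rintro rfl; exact hj hl.2)
    have h1 := hν S
    have h2 := hσ S
    rw [← add_sum_erase _ _ hi] at h1 h2 ⊢
    rw [e2, mapDomain_swap_apply, Equiv.swap_apply_left] at h2
    have := h.left_le
    omega
  · have e1 : ∑ l ∈ S.erase j, μ l = ∑ l ∈ S.erase j, ν l := sum_congr rfl fun l hl => by
      simp only [mem_erase] at hl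
      exact h.off l (by rintro rfl; exact hi hl.2) hl.1
    have e2 : ∑ l ∈ S.erase j, (ν.mapDomain (Equiv.swap i j)) l = ∑ l ∈ S.erase j, ν l :=
      sum_congr rfl fun l hl => by
        simp only [mem_erase] at hl
        exact hoff l (by rintro rfl; exact hi hl.2) hl.1
    have h1 := hν S
    have h2 := hσ S
    rw [← add_sum_erase _ _ hj] at h1 h2 ⊢
    rw [e2, mapDomain_swap_apply, Equiv.swap_apply_right] at h2
    have := h.right_le
    omega
  · refine le_trans (le_of_eq (sum_congr rfl fun l hl => h.off l ?_ ?_)) (hν S)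
    · rintro rfl; exact hi hl
    · rintro rfl; exact hj hl

lemma finite_dominated (lam : Fin n → ℕ) : (dominated lam).Finite := by
  refine (Set.finite_Iic (Finsupp.equivFunOnFinite.symm fun _ => ∑ i, lam i :
    Fin n →₀ ℕ)).subset fun ν hν i => ?_
  have := hν {i}
  simp only [sum_singleton] at this
  exact this.trans (sum_le_sum_of_subset (filter_subset _ _))

lemma sum_univ_le_of_mem_dominated {lam : Fin n → ℕ} {ν : Fin n →₀ ℕ} (hν : ν ∈ dominated lam) :
    ν.degree ≤ ∑ i, lam i := by
  have := hν univ
  rw [Finsupp.degree_eq_sum]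
  simpa using this

/-- Weights are sums of partial sums. -/
lemma weight_eq_sum_partial (ν : Fin n →₀ ℕ) : weight ν = ∑ k, ∑ i ∈ Iic k, ν i := by
  have : ∀ k, ∑ i ∈ Iic k, ν i = ∑ i, if i ≤ k then ν i else 0 := fun k => by
    rw [← sum_filter]; congr 1; ext; simp
  simp_rw [this]
  rw [sum_comm]
  refine sum_congr rfl fun i _ => ?_
  rw [← sum_filter, sum_const, smul_eq_mul]
  congr 1
  rw [← Fin.card_Ici]
  congr 1
  ext; simp

lemma filter_lt_card_Iic (k : Fin n) : (univ.filter fun i : Fin n => i.val < #(Iic k)) = Iic k := by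
  ext i
  simp only [mem_filter, mem_univ, true_and, Fin.card_Iic, mem_Iic, Fin.le_def]
  omega

/-- For an antitone tuple it suffices to compare the partial sums. -/
lemma sum_le_partial_of_antitone {μ : Fin n → ℕ} (hμ : Antitone μ) (S : Finset (Fin n)) :
    ∑ i ∈ S, μ i ≤ ∑ i with i.val < #S, μ i := by
  have hcard : #S ≤ n := by simpa using card_le_univ S
  have e1 : ∑ i ∈ S, μ i = ∑ k : Fin #S, μ (S.orderEmbOfFin rfl k) := by
    conv_lhs => rw [← S.image_orderEmbOfFin_univ rfl]
    rw [sum_image fun a _ b _ h => (S.orderEmbOfFin rfl).injective h]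
  have e2 : ∑ i with i.val < #S, μ i = ∑ k : Fin #S, μ (Fin.castLE hcard k) := by
    have : (univ.filter fun i : Fin n => i.val < #S) = univ.image (Fin.castLE hcard) := by
      ext i
      simp only [mem_filter, mem_univ, true_and, mem_image]
      exact ⟨fun h => ⟨⟨i, h⟩, rfl⟩, by rintro ⟨k, rfl⟩; exact k.2⟩
    rw [this, sum_image fun a _ b _ h => Fin.castLE_injective hcard h]
  rw [e1, e2]
  refine sum_le_sum fun k _ => hμ ?_
  -- In increasing order the m-th element of S (counted from 0) is at least m, so an antitone tuple
  -- is at least as large at m.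
  have key : ∀ m (hm : m < #S), m ≤ (S.orderEmbOfFin rfl ⟨m, hm⟩).val := by
    intro m
    induction m with
    | zero => intro; omega
    | succ m ih =>
      intro hm
      have h1 := ih (by omega)
      have : S.orderEmbOfFin rfl ⟨m, by omega⟩ < S.orderEmbOfFin rfl ⟨m + 1, hm⟩ :=
        (S.orderEmbOfFin rfl).strictMono (by simp)
      have : (S.orderEmbOfFin rfl ⟨m, by omega⟩).val < (S.orderEmbOfFin rfl ⟨m + 1, hm⟩).val := this
      omega
  exact key k.1 k.2

/-- On antitone exponents `dominated` is thus the weak dominance order, in which the totals may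
differ. This is the form that the cone of positive roots of BC_n produces. -/
lemma mem_dominated_iff_of_antitone {lam : Fin n → ℕ} {μ : Fin n →₀ ℕ} (hμ : Antitone μ) :
    μ ∈ dominated lam ↔ ∀ k : Fin n, ∑ i ∈ Iic k, μ i ≤ ∑ i ∈ Iic k, lam i := by
  constructor
  · intro h k
    have := h (Iic k)
    rwa [filter_lt_card_Iic] at this
  · intro h S
    refine (sum_le_partial_of_antitone hμ S).trans ?_
    rcases Nat.eq_zero_or_pos #S with h0 | h0
    · simp [h0]
    · have hcard : #S ≤ n := by simpa using card_le_univ S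
      have := h ⟨#S - 1, by omega⟩
      have e : (univ.filter fun i : Fin n => i.val < #S) = Iic ⟨#S - 1, by omega⟩ := by
        ext i
        simp only [mem_filter, mem_univ, true_and, mem_Iic, Fin.le_def]
        omega
      rwa [e]

lemma weight_le_of_mem_dominated {lam : Fin n → ℕ} {ν : Fin n →₀ ℕ} (hν : ν ∈ dominated lam) :
    weight ν ≤ weight (Finsupp.equivFunOnFinite.symm lam) := by
  rw [weight_eq_sum_partial, weight_eq_sum_partial]
  refine sum_le_sum fun k _ => ?_
  have := hν (Iic k)
  rwa [filter_lt_card_Iic] at this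

lemma self_mem_dominated {lam : Fin n → ℕ} (hlam : Antitone lam) :
    Finsupp.equivFunOnFinite.symm lam ∈ dominated lam :=
  (mem_dominated_iff_of_antitone (by simpa using hlam)).mpr fun k => by simp

end Exponents

/-! ### Differential-difference operators on symmetric polynomials -/

section Operators

open MvPolynomial Finset

variable {n : ℕ}

/-- The exponent `ν` with its entries at `i` and `j` replaced by `a` and `b`. -/
def pairExp (i j : Fin n) (ν : Fin n →₀ ℕ) (a b : ℕ) : Fin n →₀ ℕ := (ν.update i a).update j b

lemma pairExp_left {i j : Fin n} (hij : i ≠ j) (ν : Fin n →₀ ℕ) (a b : ℕ) :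
    pairExp i j ν a b i = a := by
  simp [pairExp, Function.update_of_ne hij]

lemma pairExp_right (i j : Fin n) (ν : Fin n →₀ ℕ) (a b : ℕ) : pairExp i j ν a b j = b := by
  simp [pairExp]

lemma pairExp_off {i j l : Fin n} (hi : l ≠ i) (hj : l ≠ j) (ν : Fin n →₀ ℕ) (a b : ℕ) :
    pairExp i j ν a b l = ν l := by
  simp [pairExp, Function.update_of_ne hi, Function.update_of_ne hj]

lemma eq_pairExp {i j : Fin n} (hij : i ≠ j) {ν μ : Fin n →₀ ℕ} {a b : ℕ} (hi : μ i = a)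
    (hj : μ j = b) (hoff : ∀ l, l ≠ i → l ≠ j → μ l = ν l) : μ = pairExp i j ν a b := by
  ext l
  by_cases h1 : l = i
  · subst h1; rw [pairExp_left hij, hi]
  by_cases h2 : l = j
  · subst h2; rw [pairExp_right, hj]
  rw [pairExp_off h1 h2, hoff l h1 h2]

lemma X_left_mul_monomial_pairExp {i j : Fin n} (hij : i ≠ j) (ν : Fin n →₀ ℕ) (a b : ℕ) :
    X i * monomial (pairExp i j ν a b) (1 : ℝ) = monomial (pairExp i j ν (a + 1) b) 1 := by
  rw [X, monomial_mul, one_mul]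
  congr 2
  refine eq_pairExp hij ?_ ?_ fun l h1 h2 => ?_
  · simp [pairExp_left hij, add_comm]
  · simp [pairExp_right, hij]
  · simp [pairExp_off h1 h2, h1]

lemma X_right_mul_monomial_pairExp {i j : Fin n} (hij : i ≠ j) (ν : Fin n →₀ ℕ) (a b : ℕ) :
    X j * monomial (pairExp i j ν a b) (1 : ℝ) = monomial (pairExp i j ν a (b + 1)) 1 := by
  rw [X, monomial_mul, one_mul]
  congr 2
  refine eq_pairExp hij ?_ ?_ fun l h1 h2 => ?_
  · simp [pairExp_left hij, hij.symm]
  · simp [pairExp_right, add_comm]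
  · simp [pairExp_off h1 h2, h2]

/-- The divided difference `(x^ν - s_{ij} x^ν) / (x_i - x_j)` of a monomial. -/
def dividedDiffMonomial (i j : Fin n) (ν : Fin n →₀ ℕ) : MvPolynomial (Fin n) ℝ :=
  if ν j ≤ ν i then
    ∑ r ∈ range (ν i - ν j), monomial (pairExp i j ν (ν j + r) (ν i - 1 - r)) 1
  else -∑ r ∈ range (ν j - ν i), monomial (pairExp i j ν (ν i + r) (ν j - 1 - r)) 1

/-- A geometric sum: multiplication by x_i − x_j makes it telescope. -/
lemma sub_mul_sum_monomial_pairExp {i j : Fin n} (hij : i ≠ j) (ν : Fin n →₀ ℕ) {a b : ℕ}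
    (hab : a ≤ b) :
    (X i - X j) * ∑ r ∈ range (b - a), monomial (pairExp i j ν (a + r) (b - 1 - r)) (1 : ℝ) =
      monomial (pairExp i j ν b a) 1 - monomial (pairExp i j ν a b) 1 := by
  have h : ∀ r ∈ range (b - a),
      (X i - X j) * monomial (pairExp i j ν (a + r) (b - 1 - r)) (1 : ℝ) =
      monomial (pairExp i j ν (a + (r + 1)) (b - (r + 1))) 1 -
        monomial (pairExp i j ν (a + r) (b - r)) 1 := by
    intro r hr
    rw [mem_range] at hr
    rw [sub_mul, X_left_mul_monomial_pairExp hij, X_right_mul_monomial_pairExp hij]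
    congr 4 <;> omega
  rw [mul_sum, sum_congr rfl h, sum_range_sub fun r => monomial (pairExp i j ν (a + r) (b - r)) (1 : ℝ)]
  congr 3
  · congr 1 <;> omega

lemma sub_mul_dividedDiffMonomial {i j : Fin n} (hij : i ≠ j) (ν : Fin n →₀ ℕ) :
    (X i - X j) * dividedDiffMonomial i j ν =
      monomial ν 1 - monomial (ν.mapDomain (Equiv.swap i j)) 1 := by
  have e1 : ν = pairExp i j ν (ν i) (ν j) := eq_pairExp hij rfl rfl fun _ _ _ => rfl
  have e2 : ν.mapDomain (Equiv.swap i j) = pairExp i j ν (ν j) (ν i) :=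
    eq_pairExp hij (by simp) (by simp) fun l h1 h2 => by
      rw [mapDomain_swap_apply, Equiv.swap_apply_of_ne_of_ne h1 h2]
  rw [dividedDiffMonomial]
  split_ifs with h
  · rw [sub_mul_sum_monomial_pairExp hij ν h, e2, ← e1]
  · rw [mul_neg, sub_mul_sum_monomial_pairExp hij ν (by omega), e2, ← e1, neg_sub]

/-- The divided difference operator `g ↦ (g - s_{ij} g) / (x_i - x_j)`. -/
def dividedDiff (i j : Fin n) : MvPolynomial (Fin n) ℝ →ₗ[ℝ] MvPolynomial (Fin n) ℝ :=
  (basisMonomials (Fin n) ℝ).constr ℝ (dividedDiffMonomial i j)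

lemma dividedDiff_monomial (i j : Fin n) (ν : Fin n →₀ ℕ) (c : ℝ) :
    dividedDiff i j (monomial ν c) = c • dividedDiffMonomial i j ν := by
  have : dividedDiff i j (monomial ν 1) = dividedDiffMonomial i j ν := by
    have := (basisMonomials (Fin n) ℝ).constr_basis ℝ (dividedDiffMonomial i j) ν
    rwa [coe_basisMonomials] at this
  rw [← this, ← map_smul, smul_monomial, smul_eq_mul, mul_one]

lemma sub_mul_dividedDiff {i j : Fin n} (hij : i ≠ j) (g : MvPolynomial (Fin n) ℝ) :
    (X i - X j) * dividedDiff i j g = g - rename (Equiv.swap i j) g := by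
  induction g using MvPolynomial.induction_on' with
  | monomial ν c =>
    rw [dividedDiff_monomial, mul_smul_comm, sub_mul_dividedDiffMonomial hij, rename_monomial,
      smul_sub, smul_monomial, smul_monomial, smul_eq_mul, mul_one]
  | add p q hp hq => rw [map_add, mul_add, hp, hq, map_add]; ring

/-- The operator `f ↦ (x_i ^ e ∂_i f - x_j ^ e ∂_j f) / (x_i - x_j)` on symmetric polynomials. -/
def pairOp (e : ℕ) (i j : Fin n) : MvPolynomial (Fin n) ℝ →ₗ[ℝ] MvPolynomial (Fin n) ℝ :=
  dividedDiff i j ∘ₗ LinearMap.mulLeft ℝ (X i ^ e) ∘ₗ (pderiv i).toLinearMap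

lemma pairOp_apply (e : ℕ) (i j : Fin n) (f : MvPolynomial (Fin n) ℝ) :
    pairOp e i j f = dividedDiff i j (X i ^ e * pderiv i f) := rfl

lemma rename_pderiv_of_isSymmetric {f : MvPolynomial (Fin n) ℝ} (hf : f.IsSymmetric)
    (σ : Equiv.Perm (Fin n)) (i : Fin n) : rename σ (pderiv i f) = pderiv (σ i) f := by
  rw [← pderiv_rename σ.injective, hf σ]

/-- For symmetric f the swap sends x_i^e ∂_i f to x_j^e ∂_j f, so the divided difference of the
first is the desired quotient. Identities for `pairOp` follow by cancelling x_i − x_j. -/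
lemma sub_mul_pairOp {i j : Fin n} (hij : i ≠ j) (e : ℕ) {f : MvPolynomial (Fin n) ℝ}
    (hf : f.IsSymmetric) :
    (X i - X j) * pairOp e i j f = X i ^ e * pderiv i f - X j ^ e * pderiv j f := by
  rw [pairOp_apply, sub_mul_dividedDiff hij, map_mul, map_pow, rename_X,
    rename_pderiv_of_isSymmetric hf, Equiv.swap_apply_left]

lemma X_sub_X_ne_zero {i j : Fin n} (hij : i ≠ j) : (X i - X j : MvPolynomial (Fin n) ℝ) ≠ 0 :=
  sub_ne_zero.mpr fun h => hij (X_injective h)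

lemma pairOp_comm {i j : Fin n} (hij : i ≠ j) (e : ℕ) {f : MvPolynomial (Fin n) ℝ}
    (hf : f.IsSymmetric) : pairOp e i j f = pairOp e j i f := by
  refine mul_left_cancel₀ (X_sub_X_ne_zero hij) ?_
  rw [sub_mul_pairOp hij e hf, ← neg_sub (X j) (X i), neg_mul, sub_mul_pairOp hij.symm e hf]
  ring

lemma rename_pairOp {i j : Fin n} (hij : i ≠ j) (e : ℕ) {f : MvPolynomial (Fin n) ℝ}
    (hf : f.IsSymmetric) (σ : Equiv.Perm (Fin n)) :
    rename σ (pairOp e i j f) = pairOp e (σ i) (σ j) f := by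
  have hσ : σ i ≠ σ j := fun h => hij (σ.injective h)
  refine mul_left_cancel₀ (X_sub_X_ne_zero hσ) ?_
  have := congrArg (rename σ) (sub_mul_pairOp hij e hf)
  simp only [map_mul, map_sub, rename_X, map_pow, rename_pderiv_of_isSymmetric hf] at this
  rw [this, sub_mul_pairOp hσ e hf]

/-- A permutation of the indices permutes the unordered pairs. -/
lemma sum_pairs_comp {M : Type*} [AddCommMonoid M] (F : Fin n → Fin n → M)
    (hF : ∀ i j, i ≠ j → F i j = F j i) (σ : Equiv.Perm (Fin n)) :
    ∑ p : Pairs n, F (σ p.1.1) (σ p.1.2) = ∑ p : Pairs n, F p.1.1 p.1.2 := by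
  let φ : Pairs n → Pairs n := fun p =>
    if h : σ p.1.1 < σ p.1.2 then ⟨(σ p.1.1, σ p.1.2), h⟩
    else ⟨(σ p.1.2, σ p.1.1),
      lt_of_le_of_ne (not_lt.mp h) fun h' => p.2.ne (σ.injective h').symm⟩
  have hφ : Function.Injective φ := by
    rintro ⟨⟨a, b⟩, hab⟩ ⟨⟨c, d⟩, hcd⟩ h
    simp only [φ] at h
    split_ifs at h <;> simp only [Subtype.mk.injEq, Prod.mk.injEq, EmbeddingLike.apply_eq_iff_eq]
      at h ⊢
    · exact h
    · obtain ⟨rfl, rfl⟩ := h; exact absurd hab (not_lt.mpr hcd.le)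
    · obtain ⟨rfl, rfl⟩ := h; exact absurd hab (not_lt.mpr hcd.le)
    · exact ⟨h.2, h.1⟩
  refine Fintype.sum_bijective φ (Finite.injective_iff_bijective.mp hφ) _ _ fun p => ?_
  simp only [φ]
  split_ifs
  · rfl
  · exact hF _ _ fun h => p.2.ne (σ.injective h)

/-! ### The constituents of the BC_n and A_{n-1} operators, and their symmetry. -/

/-- Euler's operator `∑ x_i ∂_i`. -/
def eulerOp (n : ℕ) : MvPolynomial (Fin n) ℝ →ₗ[ℝ] MvPolynomial (Fin n) ℝ :=
  ∑ i, LinearMap.mulLeft ℝ (X i) ∘ₗ (pderiv i).toLinearMap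

/-- The operator `∑ ∂_i`. -/
def gradOp (n : ℕ) : MvPolynomial (Fin n) ℝ →ₗ[ℝ] MvPolynomial (Fin n) ℝ :=
  ∑ i, (pderiv i).toLinearMap

/-- The degree preserving part of the `BC_n` operator in the variables `sinh²(t_i / 2)`, without
the terms that contain `k₁` and `k₂`. -/
def topOp (n : ℕ) (k : ℝ) : MvPolynomial (Fin n) ℝ →ₗ[ℝ] MvPolynomial (Fin n) ℝ :=
  ∑ i, (LinearMap.mulLeft ℝ (X i ^ 2) ∘ₗ (pderiv i).toLinearMap ∘ₗ (pderiv i).toLinearMap +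
    LinearMap.mulLeft ℝ (X i) ∘ₗ (pderiv i).toLinearMap) +
  (2 * k) • ∑ p : Pairs n, pairOp 2 p.1.1 p.1.2

/-- The part of the `BC_n` operator in the variables `sinh²(t_i / 2)` that lowers the degree by
one, without the terms that contain `k₁` and `k₂`. -/
def lowOp (n : ℕ) (k : ℝ) : MvPolynomial (Fin n) ℝ →ₗ[ℝ] MvPolynomial (Fin n) ℝ :=
  ∑ i, (LinearMap.mulLeft ℝ (X i) ∘ₗ (pderiv i).toLinearMap ∘ₗ (pderiv i).toLinearMap +
    (1 / 2 : ℝ) • (pderiv i).toLinearMap) +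
  (2 * k) • ∑ p : Pairs n, pairOp 1 p.1.1 p.1.2

lemma eulerOp_apply (f : MvPolynomial (Fin n) ℝ) : eulerOp n f = ∑ i, X i * pderiv i f := by
  simp [eulerOp]

lemma gradOp_apply (f : MvPolynomial (Fin n) ℝ) : gradOp n f = ∑ i, pderiv i f := by
  simp [gradOp]

lemma topOp_apply (k : ℝ) (f : MvPolynomial (Fin n) ℝ) :
    topOp n k f = ∑ i, (X i ^ 2 * pderiv i (pderiv i f) + X i * pderiv i f) +
      (2 * k) • ∑ p : Pairs n, pairOp 2 p.1.1 p.1.2 f := by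
  simp [topOp]

lemma lowOp_apply (k : ℝ) (f : MvPolynomial (Fin n) ℝ) :
    lowOp n k f = ∑ i, (X i * pderiv i (pderiv i f) + (1 / 2 : ℝ) • pderiv i f) +
      (2 * k) • ∑ p : Pairs n, pairOp 1 p.1.1 p.1.2 f := by
  simp [lowOp]

lemma isSymmetric_sum_pairOp (e : ℕ) {f : MvPolynomial (Fin n) ℝ} (hf : f.IsSymmetric) :
    (∑ p : Pairs n, pairOp e p.1.1 p.1.2 f).IsSymmetric := fun σ => by
  rw [map_sum, sum_congr rfl fun p _ => rename_pairOp p.2.ne e hf σ,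
    sum_pairs_comp (fun i j => pairOp e i j f) fun i j h => pairOp_comm h e hf]

lemma isSymmetric_eulerOp {f : MvPolynomial (Fin n) ℝ} (hf : f.IsSymmetric) :
    (eulerOp n f).IsSymmetric := fun σ => by
  simp only [eulerOp_apply, map_sum, map_mul, rename_X, rename_pderiv_of_isSymmetric hf]
  exact Equiv.sum_comp σ fun i => X i * pderiv i f

lemma isSymmetric_gradOp {f : MvPolynomial (Fin n) ℝ} (hf : f.IsSymmetric) :
    (gradOp n f).IsSymmetric := fun σ => by
  simp only [gradOp_apply, map_sum, rename_pderiv_of_isSymmetric hf]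
  exact Equiv.sum_comp σ fun i => pderiv i f

lemma isSymmetric_topOp (k : ℝ) {f : MvPolynomial (Fin n) ℝ} (hf : f.IsSymmetric) :
    (topOp n k f).IsSymmetric := by
  rw [topOp_apply]
  refine IsSymmetric.add (fun σ => ?_) ((isSymmetric_sum_pairOp 2 hf).smul _)
  simp only [map_sum, map_add, map_mul, map_pow, rename_X, ← pderiv_rename σ.injective, hf σ]
  exact Equiv.sum_comp σ fun i => X i ^ 2 * pderiv i (pderiv i f) + X i * pderiv i f

lemma isSymmetric_lowOp (k : ℝ) {f : MvPolynomial (Fin n) ℝ} (hf : f.IsSymmetric) :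
    (lowOp n k f).IsSymmetric := by
  rw [lowOp_apply]
  refine IsSymmetric.add (fun σ => ?_) ((isSymmetric_sum_pairOp 1 hf).smul _)
  simp only [map_sum, map_add, map_mul, map_smul, rename_X, ← pderiv_rename σ.injective, hf σ]
  exact Equiv.sum_comp σ fun i => X i * pderiv i (pderiv i f) + (1 / 2 : ℝ) • pderiv i f

/-! #### Action on coefficients -/

lemma linearMap_eq_sum (T : MvPolynomial (Fin n) ℝ →ₗ[ℝ] MvPolynomial (Fin n) ℝ)
    (f : MvPolynomial (Fin n) ℝ) :
    T f = ∑ ν ∈ f.support, coeff ν f • T (monomial ν 1) := by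
  conv_lhs => rw [f.as_sum, map_sum]
  refine sum_congr rfl fun ν _ => ?_
  rw [← map_smul, smul_monomial, smul_eq_mul, mul_one]

lemma exists_of_coeff_linearMap_ne_zero
    (T : MvPolynomial (Fin n) ℝ →ₗ[ℝ] MvPolynomial (Fin n) ℝ)
    {f : MvPolynomial (Fin n) ℝ} {μ : Fin n →₀ ℕ} (h : coeff μ (T f) ≠ 0) :
    ∃ ν ∈ f.support, coeff μ (T (monomial ν 1)) ≠ 0 := by
  rw [linearMap_eq_sum T f, coeff_sum] at h
  obtain ⟨ν, hν, h⟩ := exists_ne_zero_of_sum_ne_zero h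
  exact ⟨ν, hν, fun h' => h (by rw [coeff_smul, h', smul_zero])⟩

lemma X_mul_pderiv_monomial_one (i : Fin n) (ν : Fin n →₀ ℕ) :
    X i * pderiv i (monomial ν (1 : ℝ)) = monomial ν (ν i : ℝ) := by
  rw [X_mul_pderiv_monomial, ← Nat.cast_smul_eq_nsmul ℝ, smul_monomial, smul_eq_mul, mul_one]

lemma X_sq_mul_pderiv_monomial_one (i : Fin n) (ν : Fin n →₀ ℕ) :
    X i ^ 2 * pderiv i (monomial ν (1 : ℝ)) = monomial (ν + Finsupp.single i 1) (ν i : ℝ) := by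
  rw [pow_two, mul_assoc, X_mul_pderiv_monomial_one, X, monomial_mul, one_mul, add_comm]

/-- The operator is (x_i ∂_i)², which is diagonal on monomials. -/
lemma topDiag_monomial (i : Fin n) (ν : Fin n →₀ ℕ) :
    X i ^ 2 * pderiv i (pderiv i (monomial ν (1 : ℝ))) + X i * pderiv i (monomial ν (1 : ℝ)) =
      monomial ν ((ν i : ℝ) ^ 2) := by
  have h : X i * pderiv i (X i * pderiv i (monomial ν (1 : ℝ))) =
      X i ^ 2 * pderiv i (pderiv i (monomial ν (1 : ℝ))) + X i * pderiv i (monomial ν (1 : ℝ)) := by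
    rw [Derivation.leibniz, pderiv_X_self]
    simp only [smul_eq_mul]
    ring
  rw [← h, X_mul_pderiv_monomial_one, X_mul_pderiv_monomial, ← Nat.cast_smul_eq_nsmul ℝ,
    smul_monomial, smul_eq_mul, pow_two]

lemma exists_of_coeff_dividedDiffMonomial_ne_zero {i j : Fin n} {ν μ : Fin n →₀ ℕ}
    (h : coeff μ (dividedDiffMonomial i j ν) ≠ 0) :
    ∃ a b, μ = pairExp i j ν a b ∧ a + b + 1 = ν i + ν j ∧ min (ν i) (ν j) ≤ a ∧
      a + 1 ≤ max (ν i) (ν j) := by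
  rw [dividedDiffMonomial] at h
  split_ifs at h with hc
  · rw [coeff_sum] at h
    obtain ⟨r, hr, h⟩ := exists_ne_zero_of_sum_ne_zero h
    rw [mem_range] at hr
    rw [coeff_monomial] at h
    refine ⟨_, _, (ite_ne_right_iff.mp h).1.symm, ?_, ?_, ?_⟩ <;> omega
  · rw [coeff_neg, coeff_sum, neg_ne_zero] at h
    obtain ⟨r, hr, h⟩ := exists_ne_zero_of_sum_ne_zero h
    rw [mem_range] at hr
    rw [coeff_monomial] at h
    refine ⟨_, _, (ite_ne_right_iff.mp h).1.symm, ?_, ?_, ?_⟩ <;> omega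

lemma move_of_coeff_pairOp_one_ne_zero {i j : Fin n} (hij : i ≠ j) {ν μ : Fin n →₀ ℕ}
    (h : coeff μ (pairOp 1 i j (monomial ν 1)) ≠ 0) :
    Move i j ν μ ∧ μ i + μ j + 1 = ν i + ν j := by
  rw [pairOp_apply, pow_one, X_mul_pderiv_monomial_one, dividedDiff_monomial, coeff_smul,
    smul_eq_mul] at h
  obtain ⟨a, b, rfl, h1, h2, h3⟩ :=
    exists_of_coeff_dividedDiffMonomial_ne_zero (right_ne_zero_of_mul h)
  refine ⟨⟨fun l hl hl' => pairExp_off hl hl' _ _ _, ?_, ?_, ?_⟩, ?_⟩ <;>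
    simp only [pairExp_right, pairExp_left hij]
  all_goals omega

/-- The factor x_i² ∂_i raises the degree by one and the divided difference lowers it again. The
last alternative says that every exponent other than ν itself is a strict move, hence invisible at
maximal weight. -/
lemma move_of_coeff_pairOp_two_ne_zero {i j : Fin n} (hij : i ≠ j) {ν μ : Fin n →₀ ℕ}
    (h : coeff μ (pairOp 2 i j (monomial ν 1)) ≠ 0) :
    Move i j ν μ ∧ μ i + μ j = ν i + ν j ∧ (μ = ν ∨ μ i < max (ν i) (ν j)) := by
  rw [pairOp_apply, X_sq_mul_pderiv_monomial_one, dividedDiff_monomial, coeff_smul,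
    smul_eq_mul] at h
  obtain ⟨a, b, hμ, h1, h2, h3⟩ :=
    exists_of_coeff_dividedDiffMonomial_ne_zero (right_ne_zero_of_mul h)
  have hi : μ i = a := by rw [hμ, pairExp_left hij]
  have hj : μ j = b := by rw [hμ, pairExp_right]
  have hoff : ∀ l, l ≠ i → l ≠ j → μ l = ν l := fun l hl hl' => by
    rw [hμ, pairExp_off hl hl']; simp [hl]
  simp only [Finsupp.add_apply, Finsupp.single_eq_same, Finsupp.single_apply, hij, if_false,
    add_zero] at h1 h2 h3
  refine ⟨⟨hoff, ?_, ?_, ?_⟩, ?_, ?_⟩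
  iterate 4 omega
  by_cases hc : μ i = ν i
  · left
    ext l
    by_cases hl : l = i
    · rw [hl, hc]
    by_cases hl' : l = j
    · rw [hl']; omega
    exact hoff l hl hl'
  · right; omega

lemma coeff_self_pairOp_two {i j : Fin n} (hij : i ≠ j) {ν : Fin n →₀ ℕ} (h : ν j ≤ ν i) :
    coeff ν (pairOp 2 i j (monomial ν 1)) = ν i := by
  rw [pairOp_apply, X_sq_mul_pderiv_monomial_one, dividedDiff_monomial, coeff_smul,
    smul_eq_mul]
  suffices coeff ν (dividedDiffMonomial i j (ν + Finsupp.single i 1)) = 1 by rw [this, mul_one]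
  have hi : (ν + Finsupp.single i 1 : Fin n →₀ ℕ) i = ν i + 1 := by simp
  have hj : (ν + Finsupp.single i 1 : Fin n →₀ ℕ) j = ν j := by simp [hij]
  -- The extra factor x_i lengthens the sum by one term; its last term, r = ν i − ν j, restores ν.
  rw [dividedDiffMonomial, hi, hj, if_pos (by omega), coeff_sum, sum_eq_single (ν i - ν j)]
  · rw [coeff_monomial, if_pos]
    refine (eq_pairExp hij (by omega) (by omega) fun l h1 h2 => by simp [h1]).symm
  · intro r hr hr'
    rw [mem_range] at hr
    rw [coeff_monomial, if_neg]
    intro h'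
    have := congrArg (fun μ => μ i) h'
    simp only [pairExp_left hij] at this
    omega
  · intro h'
    exact absurd (mem_range.mpr (by omega)) h'

lemma move_self (i j : Fin n) (ν : Fin n →₀ ℕ) : Move i j ν ν :=
  ⟨fun _ _ _ => rfl, le_rfl, le_max_left _ _, le_max_right _ _⟩

/-- The degenerate case i = j lets terms in a single variable be treated as moves as well. -/
lemma move_add_single (i : Fin n) (μ : Fin n →₀ ℕ) : Move i i (μ + Finsupp.single i 1) μ :=
  ⟨fun _ h _ => by simp [h], by simp; omega, by simp, by simp⟩

lemma exists_move_of_coeff_topOp_ne_zero {k : ℝ} {f : MvPolynomial (Fin n) ℝ} {μ : Fin n →₀ ℕ}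
    (h : coeff μ (topOp n k f) ≠ 0) :
    ∃ ν ∈ f.support, ∃ i j, Move i j ν μ ∧ μ.degree = ν.degree := by
  obtain ⟨ν, hν, h⟩ := exists_of_coeff_linearMap_ne_zero _ h
  refine ⟨ν, hν, ?_⟩
  rw [topOp_apply, coeff_add] at h
  by_cases h1 : coeff μ (∑ i, (X i ^ 2 * pderiv i (pderiv i (monomial ν (1 : ℝ))) +
      X i * pderiv i (monomial ν 1))) = 0
  · rw [h1, zero_add, coeff_smul, smul_eq_mul] at h
    have h := right_ne_zero_of_mul h
    rw [coeff_sum] at h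
    obtain ⟨p, -, h⟩ := exists_ne_zero_of_sum_ne_zero h
    obtain ⟨hm, hs, -⟩ := move_of_coeff_pairOp_two_ne_zero p.2.ne h
    exact ⟨_, _, hm, hm.degree_eq_of p.2.ne (a := 0) hs⟩
  · rw [coeff_sum] at h1
    obtain ⟨i, -, h1⟩ := exists_ne_zero_of_sum_ne_zero h1
    rw [topDiag_monomial, coeff_monomial] at h1
    obtain rfl := (ite_ne_right_iff.mp h1).1
    exact ⟨i, i, move_self _ _ _, rfl⟩

lemma eq_add_single_of_coeff_pderiv_ne_zero {i : Fin n} {ν μ : Fin n →₀ ℕ} {c : ℝ}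
    (h : coeff μ (pderiv i (monomial ν c)) ≠ 0) : ν = μ + Finsupp.single i 1 := by
  rw [coeff_pderiv] at h
  have := left_ne_zero_of_mul h
  rw [coeff_monomial] at this
  exact (ite_ne_right_iff.mp this).1

lemma exists_move_of_coeff_gradOp_ne_zero {f : MvPolynomial (Fin n) ℝ} {μ : Fin n →₀ ℕ}
    (h : coeff μ (gradOp n f) ≠ 0) :
    ∃ ν ∈ f.support, ∃ i, ν = μ + Finsupp.single i 1 := by
  obtain ⟨ν, hν, h⟩ := exists_of_coeff_linearMap_ne_zero _ h
  refine ⟨ν, hν, ?_⟩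
  rw [gradOp_apply, coeff_sum] at h
  obtain ⟨i, -, h⟩ := exists_ne_zero_of_sum_ne_zero h
  exact ⟨i, eq_add_single_of_coeff_pderiv_ne_zero h⟩

lemma exists_move_of_coeff_lowOp_ne_zero {k : ℝ} {f : MvPolynomial (Fin n) ℝ} {μ : Fin n →₀ ℕ}
    (h : coeff μ (lowOp n k f) ≠ 0) :
    ∃ ν ∈ f.support, (∃ i, ν = μ + Finsupp.single i 1) ∨
      ∃ i j, i < j ∧ Move i j ν μ ∧ μ i + μ j + 1 = ν i + ν j := by
  obtain ⟨ν, hν, h⟩ := exists_of_coeff_linearMap_ne_zero _ h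
  refine ⟨ν, hν, ?_⟩
  rw [lowOp_apply, coeff_add] at h
  by_cases h1 : coeff μ (∑ i, (X i * pderiv i (pderiv i (monomial ν (1 : ℝ))) +
      (1 / 2 : ℝ) • pderiv i (monomial ν 1))) = 0
  · rw [h1, zero_add, coeff_smul, smul_eq_mul] at h
    have h := right_ne_zero_of_mul h
    rw [coeff_sum] at h
    obtain ⟨p, -, h⟩ := exists_ne_zero_of_sum_ne_zero h
    exact Or.inr ⟨_, _, p.2, move_of_coeff_pairOp_one_ne_zero p.2.ne h⟩
  · rw [coeff_sum] at h1
    obtain ⟨i, -, h1⟩ := exists_ne_zero_of_sum_ne_zero h1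
    refine Or.inl ⟨i, ?_⟩
    by_contra hne
    refine h1 ?_
    have h2 : coeff μ (pderiv i (monomial ν (1 : ℝ))) = 0 := by
      by_contra h'
      exact hne (eq_add_single_of_coeff_pderiv_ne_zero h')
    rw [coeff_add, coeff_smul, h2, smul_zero, add_zero]
    rw [pderiv_monomial, X_mul_pderiv_monomial, coeff_smul, coeff_monomial]
    -- If ν i = 0, the truncated subtraction in the exponent is harmless because the coefficient
    -- vanishes.
    by_cases hi : ν i = 0
    · simp [hi]
    rw [if_neg, smul_zero]
    intro h'
    refine hne ?_
    rw [← h', tsub_add_cancel_of_le]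
    exact Finsupp.single_le_iff.mpr (Nat.one_le_iff_ne_zero.mpr hi)

lemma lowOp_degree {k : ℝ} {f : MvPolynomial (Fin n) ℝ} {μ : Fin n →₀ ℕ}
    (h : coeff μ (lowOp n k f) ≠ 0) :
    ∃ ν ∈ f.support, ∃ i j, Move i j ν μ ∧ μ.degree + 1 = ν.degree := by
  obtain ⟨ν, hν, ⟨i, rfl⟩ | ⟨i, j, hij, hm, hs⟩⟩ := exists_move_of_coeff_lowOp_ne_zero h
  · exact ⟨_, hν, i, i, move_add_single i μ, by simp⟩
  · exact ⟨ν, hν, i, j, hm, hm.degree_eq_of hij.ne hs⟩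

lemma gradOp_degree {f : MvPolynomial (Fin n) ℝ} {μ : Fin n →₀ ℕ}
    (h : coeff μ (gradOp n f) ≠ 0) :
    ∃ ν ∈ f.support, ∃ i j, Move i j ν μ ∧ μ.degree + 1 = ν.degree := by
  obtain ⟨ν, hν, i, rfl⟩ := exists_move_of_coeff_gradOp_ne_zero h
  exact ⟨_, hν, i, i, move_add_single i μ, by simp⟩

lemma coeff_eulerOp (f : MvPolynomial (Fin n) ℝ) (μ : Fin n →₀ ℕ) :
    coeff μ (eulerOp n f) = μ.degree * coeff μ f := by
  induction f using MvPolynomial.induction_on' with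
  | monomial ν c =>
    simp only [eulerOp_apply, X_mul_pderiv_monomial, coeff_sum, coeff_smul, coeff_monomial]
    split_ifs with h
    · subst h
      simp [Finsupp.degree_eq_sum, sum_mul]
    · simp
  | add p q hp hq => rw [map_add, coeff_add, hp, hq, coeff_add, mul_add]

lemma coeff_mapDomain_of_isSymmetric {f : MvPolynomial (Fin n) ℝ} (hf : f.IsSymmetric)
    (σ : Equiv.Perm (Fin n)) (ν : Fin n →₀ ℕ) : coeff (ν.mapDomain σ) f = coeff ν f := by
  conv_lhs => rw [← hf σ]
  exact coeff_rename_mapDomain σ σ.injective f ν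

/-- The eigenvalue of `topOp n k` belonging to the exponent `μ`. -/
def topEigenvalue (n : ℕ) (k : ℝ) (μ : Fin n →₀ ℕ) : ℝ :=
  ∑ i, (μ i : ℝ) ^ 2 + 2 * k * ∑ p : Pairs n, (μ p.1.1 : ℝ)

/-- The support of a symmetric polynomial is closed under swaps, so both alternatives of
`Move.weight_lt` contradict the maximality of the weight of μ. -/
lemma not_weight_lt_of_move {f : MvPolynomial (Fin n) ℝ} (hf : f.IsSymmetric) {μ ν : Fin n →₀ ℕ}
    (hmax : ∀ ν ∈ f.support, weight ν ≤ weight μ) (hν : ν ∈ f.support) {i j : Fin n} (hij : i < j)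
    (hm : Move i j ν μ) (hs : μ i < max (ν i) (ν j) ∨ μ i + μ j < ν i + ν j) : False := by
  rcases hm.weight_lt hij hs with h | h
  · exact absurd (hmax ν hν) (not_le.mpr h)
  · refine absurd (hmax (ν.mapDomain (Equiv.swap i j)) ?_) (not_le.mpr h)
    rwa [mem_support_iff, coeff_mapDomain_of_isSymmetric hf, ← mem_support_iff]

/-- A contribution from ν ≠ μ would come from a strict move, which maximality excludes; only the
diagonal coefficient remains. -/
lemma coeff_pairOp_two {f : MvPolynomial (Fin n) ℝ} (hf : f.IsSymmetric) {μ : Fin n →₀ ℕ}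
    (hμ : Antitone μ) (hmax : ∀ ν ∈ f.support, weight ν ≤ weight μ) {i j : Fin n} (hij : i < j) :
    coeff μ (pairOp 2 i j f) = μ i * coeff μ f := by
  rw [linearMap_eq_sum (pairOp 2 i j) f, coeff_sum, sum_eq_single μ]
  · rw [coeff_smul, coeff_self_pairOp_two hij.ne (hμ hij.le), smul_eq_mul, mul_comm]
  · intro ν hν hne
    rw [coeff_smul, smul_eq_mul]
    by_contra h
    obtain ⟨hm, hs, h'⟩ := move_of_coeff_pairOp_two_ne_zero hij.ne (right_ne_zero_of_mul h)
    exact not_weight_lt_of_move hf hmax hν hij hm (Or.inl (h'.resolve_left hne.symm))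
  · intro h
    rw [notMem_support_iff.mp h, zero_smul, coeff_zero]

/-- At an antitone exponent of maximal weight, `topOp` acts by the scalar `topEigenvalue`. -/
lemma coeff_topOp (k : ℝ) {f : MvPolynomial (Fin n) ℝ} (hf : f.IsSymmetric) {μ : Fin n →₀ ℕ}
    (hμ : Antitone μ) (hmax : ∀ ν ∈ f.support, weight ν ≤ weight μ) :
    coeff μ (topOp n k f) = topEigenvalue n k μ * coeff μ f := by
  have hdiag : ∀ i (g : MvPolynomial (Fin n) ℝ),
      coeff μ (X i ^ 2 * pderiv i (pderiv i g) + X i * pderiv i g) = (μ i : ℝ) ^ 2 * coeff μ g := by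
    intro i g
    induction g using MvPolynomial.induction_on' with
    | monomial ν c =>
      have : monomial ν c = c • monomial ν (1 : ℝ) := by simp [smul_monomial]
      rw [this, Derivation.map_smul, Derivation.map_smul, mul_smul_comm, mul_smul_comm, ← smul_add, topDiag_monomial,
        coeff_smul, coeff_smul, coeff_monomial, coeff_monomial]
      split_ifs with h
      · subst h; simp [mul_comm]
      · simp
    | add p q hp hq =>
      rw [coeff_add] at hp hq
      simp only [map_add, mul_add, coeff_add]
      linear_combination hp + hq
  rw [topOp_apply, coeff_add, coeff_sum, sum_congr rfl fun i _ => hdiag i f, coeff_smul, coeff_sum,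
    sum_congr rfl fun p _ => coeff_pairOp_two hf hμ hmax p.2, topEigenvalue, add_mul,
    sum_mul, smul_eq_mul, mul_assoc (2 * k), sum_mul]

/-- Each term loses mass, so its source, or a swap of it, would be heavier than μ. -/
lemma coeff_lowOp (k : ℝ) {f : MvPolynomial (Fin n) ℝ} (hf : f.IsSymmetric) {μ : Fin n →₀ ℕ}
    (hmax : ∀ ν ∈ f.support, weight ν ≤ weight μ) : coeff μ (lowOp n k f) = 0 := by
  by_contra h
  obtain ⟨ν, hν, ⟨i, rfl⟩ | ⟨i, j, hij, hm, hs⟩⟩ := exists_move_of_coeff_lowOp_ne_zero h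
  · refine absurd (hmax _ hν) (not_le.mpr (weight_lt_of_lt ?_))
    exact lt_add_of_pos_right _ (pos_iff_ne_zero.mpr (by simp))
  · exact not_weight_lt_of_move hf hmax hν hij hm (Or.inr (by omega))

lemma coeff_gradOp {f : MvPolynomial (Fin n) ℝ} {μ : Fin n →₀ ℕ}
    (hmax : ∀ ν ∈ f.support, weight ν ≤ weight μ) : coeff μ (gradOp n f) = 0 := by
  by_contra h
  obtain ⟨ν, hν, i, rfl⟩ := exists_move_of_coeff_gradOp_ne_zero h
  refine absurd (hmax _ hν) (not_le.mpr (weight_lt_of_lt ?_))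
  exact lt_add_of_pos_right _ (pos_iff_ne_zero.mpr (by simp))

end Operators

/-! ### Orbit sums and triangular operators on symmetric polynomials -/

section Triangular

open MvPolynomial Finset

variable {n : ℕ}

/-- The symmetric polynomials with all exponents in `D`. -/
def symmSupp (D : Set (Fin n →₀ ℕ)) : Submodule ℝ (MvPolynomial (Fin n) ℝ) :=
  (symmetricSubalgebra (Fin n) ℝ).toSubmodule ⊓ restrictSupport ℝ D

lemma mem_symmSupp {D : Set (Fin n →₀ ℕ)} {f : MvPolynomial (Fin n) ℝ} :
    f ∈ symmSupp D ↔ f.IsSymmetric ∧ ∀ ν, coeff ν f ≠ 0 → ν ∈ D := by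
  rw [symmSupp, Submodule.mem_inf, mem_restrictSupport_iff]
  refine and_congr (mem_symmetricSubalgebra f) ?_
  simp [Set.subset_def]

lemma finite_restrictSupport {D : Set (Fin n →₀ ℕ)} (hD : D.Finite) :
    Module.Finite ℝ (restrictSupport ℝ D : Submodule ℝ (MvPolynomial (Fin n) ℝ)) := by
  have := hD.to_subtype
  exact Module.Finite.of_basis (basisRestrictSupport ℝ D)

lemma antitone_of_weight_max {f : MvPolynomial (Fin n) ℝ} (hf : f.IsSymmetric) {μ : Fin n →₀ ℕ}
    (hμ : μ ∈ f.support) (hmax : ∀ ν ∈ f.support, weight ν ≤ weight μ) : Antitone μ :=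
  antitone_of_weight_swap_le fun i j => hmax _ <| by
    rwa [mem_support_iff, coeff_mapDomain_of_isSymmetric hf, ← mem_support_iff]

/-- `L` preserves `symmSupp D` and acts by `ev μ` on the coefficient at an exponent `μ` of maximal
weight. -/
structure IsTriangular (D : Set (Fin n →₀ ℕ))
    (L : MvPolynomial (Fin n) ℝ →ₗ[ℝ] MvPolynomial (Fin n) ℝ) (ev : (Fin n →₀ ℕ) → ℝ) : Prop where
  maps : ∀ f ∈ symmSupp D, L f ∈ symmSupp D
  coeff_max : ∀ f ∈ symmSupp D, ∀ μ ∈ D, Antitone μ → (∀ ν ∈ f.support, weight ν ≤ weight μ) →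
    coeff μ (L f) = ev μ * coeff μ f

variable {D : Set (Fin n →₀ ℕ)} {L : MvPolynomial (Fin n) ℝ →ₗ[ℝ] MvPolynomial (Fin n) ℝ}
  {ev : (Fin n →₀ ℕ) → ℝ} {lam : Fin n →₀ ℕ}

/-- At a support exponent μ of maximal weight, antitone by symmetry, the eigenvalue equation reads
ev μ = ev lam. This forces μ = lam, whose coefficient vanishes. -/
lemma IsTriangular.eq_zero_of_eigen (hL : IsTriangular D L ev)
    (hne : ∀ μ ∈ D, Antitone μ → μ ≠ lam → ev μ ≠ ev lam) {f : MvPolynomial (Fin n) ℝ}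
    (hf : f ∈ symmSupp D) (h0 : coeff lam f = 0) (heig : L f = ev lam • f) : f = 0 := by
  by_contra hne0
  obtain ⟨μ, hμ, hmax⟩ := exists_max_image f.support weight (support_nonempty.mpr hne0)
  have hμ' := mem_support_iff.mp hμ
  have hanti := antitone_of_weight_max (mem_symmSupp.mp hf).1 hμ hmax
  have hD := (mem_symmSupp.mp hf).2 μ hμ'
  have h1 := hL.coeff_max f hf μ hD hanti hmax
  rw [heig, coeff_smul, smul_eq_mul] at h1
  exact hne μ hD hanti (by rintro rfl; exact hμ' h0) (mul_right_cancel₀ hμ' h1).symm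

/-- Existence and uniqueness of eigenvectors with prescribed leading coefficient. -/
lemma IsTriangular.existsUnique_eigen (hL : IsTriangular D L ev) (hD : D.Finite) (hlam : lam ∈ D)
    (hanti : Antitone lam) (hmax : ∀ ν ∈ D, weight ν ≤ weight lam)
    (hne : ∀ μ ∈ D, Antitone μ → μ ≠ lam → ev μ ≠ ev lam)
    {m : MvPolynomial (Fin n) ℝ} (hm : m ∈ symmSupp D) :
    ∃! f, f ∈ symmSupp D ∧ coeff lam f = coeff lam m ∧ L f = ev lam • f := by
  have hcoeff : ∀ f ∈ symmSupp D, coeff lam (L f) = ev lam * coeff lam f := fun f hf =>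
    hL.coeff_max f hf lam hlam hanti fun ν hν =>
      hmax ν ((mem_symmSupp.mp hf).2 ν (mem_support_iff.mp hν))
  -- T = L − ev lam maps `symmSupp D` into V₀, because lam has maximal weight. On the
  -- finite-dimensional V₀ it is injective, hence surjective, so m can be corrected by some g in V₀
  -- with T g = T m.
  let V₀ : Submodule ℝ (MvPolynomial (Fin n) ℝ) := symmSupp D ⊓ LinearMap.ker (lcoeff ℝ lam)
  have hV₀ : ∀ f, f ∈ V₀ ↔ f ∈ symmSupp D ∧ coeff lam f = 0 := fun f => Iff.rfl
  let T : MvPolynomial (Fin n) ℝ →ₗ[ℝ] MvPolynomial (Fin n) ℝ := L - ev lam • LinearMap.id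
  have hTapp : ∀ f, T f = L f - ev lam • f := fun f => rfl
  have hT : ∀ f ∈ symmSupp D, T f ∈ V₀ := fun f hf => (hV₀ _).mpr
    ⟨sub_mem (hL.maps f hf) (Submodule.smul_mem _ _ hf), by
      rw [hTapp, coeff_sub, coeff_smul, hcoeff f hf, smul_eq_mul, sub_self]⟩
  have : Module.Finite ℝ (restrictSupport ℝ D : Submodule ℝ (MvPolynomial (Fin n) ℝ)) :=
    finite_restrictSupport hD
  have : FiniteDimensional ℝ V₀ :=
    Submodule.finiteDimensional_of_le (inf_le_left.trans inf_le_right :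
      V₀ ≤ restrictSupport ℝ D)
  let T₀ : V₀ →ₗ[ℝ] V₀ := T.restrict fun f hf => hT f hf.1
  have hinj : Function.Injective T₀ := by
    rw [← LinearMap.ker_eq_bot, LinearMap.ker_eq_bot']
    rintro ⟨f, hf⟩ h
    have h' : T f = 0 := congrArg Subtype.val h
    exact Subtype.ext (hL.eq_zero_of_eigen hne hf.1 hf.2 (sub_eq_zero.mp h'))
  obtain ⟨⟨g, hg⟩, hg'⟩ := (LinearMap.injective_iff_surjective.mp hinj) ⟨T m, hT m hm⟩
  have hg' : T g = T m := congrArg Subtype.val hg'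
  have hg2 : coeff lam g = 0 := hg.2
  refine ⟨m - g, ⟨sub_mem hm hg.1, by rw [coeff_sub, hg2, sub_zero], ?_⟩, ?_⟩
  · rw [← sub_eq_zero, ← hTapp, map_sub, hg', sub_self]
  · rintro f ⟨hf, hf1, hf2⟩
    refine sub_eq_zero.mp (hL.eq_zero_of_eigen hne (sub_mem hf (sub_mem hm hg.1)) ?_ ?_)
    · rw [coeff_sub, coeff_sub, hf1, hg2]; ring
    · rw [← sub_eq_zero, ← hTapp, map_sub, map_sub T m, hg', sub_self, sub_zero, hTapp, hf2,
        sub_self]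

/-! ### Orbit sums built from one-variable polynomials q_m of degree m, for both root systems at
once. -/

/-- The rearrangements of an exponent. -/
def permOrbit (μ : Fin n →₀ ℕ) : Finset (Fin n →₀ ℕ) :=
  univ.image fun σ : Equiv.Perm (Fin n) => μ.mapDomain σ

lemma mem_permOrbit {μ ν : Fin n →₀ ℕ} :
    ν ∈ permOrbit μ ↔ ∃ σ : Equiv.Perm (Fin n), μ.mapDomain σ = ν := by
  simp [permOrbit]

lemma self_mem_permOrbit (μ : Fin n →₀ ℕ) : μ ∈ permOrbit μ :=
  mem_permOrbit.mpr ⟨1, by simp⟩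

lemma mapDomain_mem_permOrbit {μ ν : Fin n →₀ ℕ} (σ : Equiv.Perm (Fin n)) (h : ν ∈ permOrbit μ) :
    ν.mapDomain σ ∈ permOrbit μ := by
  obtain ⟨τ, rfl⟩ := mem_permOrbit.mp h
  exact mem_permOrbit.mpr ⟨σ * τ, by rw [← Finsupp.mapDomain_comp, Equiv.Perm.coe_mul]⟩

lemma degree_of_mem_permOrbit {μ ν : Fin n →₀ ℕ} (h : ν ∈ permOrbit μ) : ν.degree = μ.degree := by
  obtain ⟨σ, rfl⟩ := mem_permOrbit.mp h
  simp only [Finsupp.degree_eq_sum, Finsupp.mapDomain_equiv_apply]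
  exact Equiv.sum_comp σ.symm μ

lemma mem_dominated_of_mem_permOrbit {lam : Fin n → ℕ} {μ ν : Fin n →₀ ℕ} (h : ν ∈ permOrbit μ)
    (hμ : μ ∈ dominated lam) : ν ∈ dominated lam := by
  obtain ⟨σ, rfl⟩ := mem_permOrbit.mp h
  exact mapDomain_mem_dominated hμ σ

lemma weight_le_of_mem_permOrbit {μ ν : Fin n →₀ ℕ} (hμ : Antitone μ) (h : ν ∈ permOrbit μ) :
    weight ν ≤ weight μ := by
  have := weight_le_of_mem_dominated
    (mem_dominated_of_mem_permOrbit h (by simpa using self_mem_dominated hμ))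
  simpa using this

lemma eq_of_mem_permOrbit {μ ν : Fin n →₀ ℕ} (hμ : Antitone μ) (hν : Antitone ν)
    (h : ν ∈ permOrbit μ) : ν = μ := by
  obtain ⟨σ, rfl⟩ := mem_permOrbit.mp h
  have e : ⇑(μ.mapDomain σ) = ⇑μ ∘ ⇑σ.symm := by
    ext i; simp [Finsupp.mapDomain_equiv_apply]
  rw [e] at hν
  have := Tuple.unique_antitone (f := ⇑μ) (σ := σ.symm) (τ := 1) hν hμ
  ext i
  rw [e]
  exact congrFun this i

lemma coeff_prod_aeval_X (p : Fin n → Polynomial ℝ) (ν : Fin n →₀ ℕ) :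
    coeff ν (∏ i, Polynomial.aeval (X i : MvPolynomial (Fin n) ℝ) (p i)) =
      ∏ i, (p i).coeff (ν i) := by
  have h1 : ∀ i, Polynomial.aeval (X i : MvPolynomial (Fin n) ℝ) (p i) =
      ∑ m ∈ range ((p i).natDegree + 1), (p i).coeff m • X i ^ m := fun i =>
    Polynomial.aeval_eq_sum_range _
  have h2 : ∀ x : Fin n → ℕ, ∏ i, ((p i).coeff (x i) • (X i : MvPolynomial (Fin n) ℝ) ^ x i) =
      monomial (Finsupp.equivFunOnFinite.symm x) (∏ i, (p i).coeff (x i)) := by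
    intro x
    simp only [smul_eq_C_mul, prod_mul_distrib, monomial_eq, Finsupp.prod_fintype _ _
      (fun i => pow_zero _), map_prod, Finsupp.equivFunOnFinite_symm_apply_apply]
  simp_rw [h1]
  rw [prod_univ_sum, coeff_sum, sum_congr rfl fun x _ => by rw [h2 x, coeff_monomial]]
  rw [sum_eq_single ⇑ν]
  · simp
  · intro x _ hx
    rw [if_neg]
    rintro rfl
    exact hx (by simp)
  · intro h
    rw [if_pos (by simp)]
    simp only [Fintype.mem_piFinset, not_forall, mem_range, not_lt] at h
    obtain ⟨i, hi⟩ := h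
    exact prod_eq_zero (mem_univ i) (Polynomial.coeff_eq_zero_of_natDegree_lt (by omega))

/-- The sum of the products `∏ q_{ν_i}(x_i)` over the rearrangements `ν` of `μ`. -/
def orbitPoly (q : ℕ → Polynomial ℝ) (μ : Fin n →₀ ℕ) : MvPolynomial (Fin n) ℝ :=
  ∑ ν ∈ permOrbit μ, ∏ i, Polynomial.aeval (X i) (q (ν i))

lemma isSymmetric_orbitPoly (q : ℕ → Polynomial ℝ) (μ : Fin n →₀ ℕ) :
    (orbitPoly q μ).IsSymmetric := by
  intro σ
  have h : ∀ ν : Fin n →₀ ℕ,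
      rename σ (∏ i, Polynomial.aeval (X i : MvPolynomial (Fin n) ℝ) (q (ν i))) =
      ∏ i, Polynomial.aeval (X i) (q (ν.mapDomain σ i)) := by
    intro ν
    rw [map_prod, ← Equiv.prod_comp σ fun i =>
      Polynomial.aeval (X i : MvPolynomial (Fin n) ℝ) (q (ν.mapDomain σ i))]
    refine prod_congr rfl fun i _ => ?_
    rw [← Polynomial.aeval_algHom_apply, rename_X, Finsupp.mapDomain_apply σ.injective]
  rw [orbitPoly, map_sum, sum_congr rfl fun ν _ => h ν]
  refine sum_bij' (fun ν _ => ν.mapDomain σ) (fun ν _ => ν.mapDomain σ.symm)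
    (fun ν hν => mapDomain_mem_permOrbit σ hν) (fun ν hν => mapDomain_mem_permOrbit σ.symm hν)
    (fun ν _ => ?_) (fun ν _ => ?_) fun ν _ => rfl
  · rw [← Finsupp.mapDomain_comp]; simp
  · rw [← Finsupp.mapDomain_comp]; simp

lemma coeff_orbitPoly (q : ℕ → Polynomial ℝ) (μ ν : Fin n →₀ ℕ) :
    coeff ν (orbitPoly q μ) = ∑ ν' ∈ permOrbit μ, ∏ i, (q (ν' i)).coeff (ν i) := by
  rw [orbitPoly, coeff_sum]
  exact sum_congr rfl fun ν' _ => coeff_prod_aeval_X _ _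

variable {q : ℕ → Polynomial ℝ}

lemma exists_le_of_prod_coeff_ne_zero (hq : ∀ m, (q m).natDegree ≤ m) {ν ν' : Fin n →₀ ℕ}
    (h : ∏ i, (q (ν' i)).coeff (ν i) ≠ 0) : ν ≤ ν' := fun i => by
  have := prod_ne_zero_iff.mp h i (mem_univ i)
  exact (Polynomial.le_natDegree_of_ne_zero this).trans (hq _)

lemma exists_le_of_coeff_orbitPoly_ne_zero (hq : ∀ m, (q m).natDegree ≤ m) {μ ν : Fin n →₀ ℕ}
    (h : coeff ν (orbitPoly q μ) ≠ 0) : ∃ ν' ∈ permOrbit μ, ν ≤ ν' := by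
  rw [coeff_orbitPoly] at h
  obtain ⟨ν', hν', h⟩ := exists_ne_zero_of_sum_ne_zero h
  exact ⟨ν', hν', exists_le_of_prod_coeff_ne_zero hq h⟩

lemma weight_le_of_coeff_orbitPoly_ne_zero (hq : ∀ m, (q m).natDegree ≤ m) {μ ν : Fin n →₀ ℕ}
    (hμ : Antitone μ) (h : coeff ν (orbitPoly q μ) ≠ 0) : weight ν ≤ weight μ := by
  obtain ⟨ν', hν', hle⟩ := exists_le_of_coeff_orbitPoly_ne_zero hq h
  exact (weight_le_of_le hle).trans (weight_le_of_mem_permOrbit hμ hν')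

/-- ν lies entrywise below a rearrangement ν' of μ, so weight ν ≤ weight ν' ≤ weight μ ≤ weight ν.
Hence ν = ν', and an orbit has only one antitone member. -/
lemma eq_of_coeff_orbitPoly_ne_zero (hq : ∀ m, (q m).natDegree ≤ m) {μ ν : Fin n →₀ ℕ}
    (hμ : Antitone μ) (hν : Antitone ν) (hw : weight μ ≤ weight ν)
    (h : coeff ν (orbitPoly q μ) ≠ 0) : ν = μ := by
  obtain ⟨ν', hν', hle⟩ := exists_le_of_coeff_orbitPoly_ne_zero hq h
  have h1 := weight_le_of_mem_permOrbit hμ hν'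
  have h2 : ν = ν' := by
    by_contra hne
    have := weight_lt_of_lt (lt_of_le_of_ne hle hne)
    omega
  exact eq_of_mem_permOrbit hμ hν (h2 ▸ hν')

/-- Rearrangements have equal degree, so none but μ itself lies entrywise above μ: a single product
of leading coefficients survives. -/
lemma coeff_self_orbitPoly_ne_zero (hq : ∀ m, (q m).natDegree ≤ m) (hq' : ∀ m, (q m).coeff m ≠ 0)
    (μ : Fin n →₀ ℕ) : coeff μ (orbitPoly q μ) ≠ 0 := by
  rw [coeff_orbitPoly, sum_eq_single μ]
  · exact prod_ne_zero_iff.mpr fun i _ => hq' _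
  · intro ν hν hne
    by_contra h
    have hle := exists_le_of_prod_coeff_ne_zero hq h
    have h1 := weight_lt_of_lt (lt_of_le_of_ne hle hne.symm)
    have hd := degree_of_mem_permOrbit hν
    obtain ⟨i, hi⟩ : ∃ i, μ i < ν i := by
      by_contra! hc
      exact hne (le_antisymm hc hle)
    have : ∑ i, μ i < ∑ i, ν i := sum_lt_sum (fun i _ => hle i) ⟨i, mem_univ i, hi⟩
    rw [Finsupp.degree_eq_sum, Finsupp.degree_eq_sum] at hd
    omega
  · intro h; exact absurd (self_mem_permOrbit μ) h

/-- Symmetric polynomials without leading coefficient are combinations of lower orbit sums. -/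
lemma mem_span_orbitPoly (hq : ∀ m, (q m).natDegree ≤ m) (hq' : ∀ m, (q m).coeff m ≠ 0)
    (hM : ∀ μ ∈ D, Antitone μ → orbitPoly q μ ∈ symmSupp D)
    (hanti : Antitone lam) (hmax : ∀ ν ∈ D, weight ν ≤ weight lam) (H : ℕ) :
    ∀ f ∈ symmSupp D, (∀ ν ∈ f.support, weight ν < H) → coeff lam f = 0 →
      f ∈ Submodule.span ℝ (orbitPoly q '' {μ | μ ∈ D ∧ Antitone μ ∧ μ ≠ lam}) := by
  classical
  induction H with
  | zero =>
    intro f _ h _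
    have : f = 0 := by
      rw [← support_eq_empty]
      exact eq_empty_of_forall_notMem fun ν hν => absurd (h ν hν) (by omega)
    rw [this]; exact zero_mem _
  | succ H ih =>
    intro f hf hlt h0
    obtain ⟨hfs, hfD⟩ := mem_symmSupp.mp hf
    -- Subtracting g cancels every antitone coefficient of weight H. A weight-maximal exponent of a
    -- symmetric polynomial is antitone, so f − g has weights below H and the induction applies.
    let T := f.support.filter fun μ : Fin n →₀ ℕ => Antitone μ ∧ weight μ = H
    let g := ∑ μ ∈ T, (coeff μ f / coeff μ (orbitPoly q μ)) • orbitPoly q μ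
    have hT : ∀ μ ∈ T, coeff μ f ≠ 0 ∧ μ ∈ D ∧ Antitone μ ∧ weight μ = H ∧ μ ≠ lam := by
      intro μ hμ
      obtain ⟨h1, h2, h3⟩ := mem_filter.mp hμ
      have h1 := mem_support_iff.mp h1
      exact ⟨h1, hfD μ h1, h2, h3, by rintro rfl; exact h1 h0⟩
    have hg : g ∈ Submodule.span ℝ (orbitPoly q '' {μ | μ ∈ D ∧ Antitone μ ∧ μ ≠ lam}) :=
      sum_mem fun μ hμ => Submodule.smul_mem _ _ (Submodule.subset_span
        ⟨μ, ⟨(hT μ hμ).2.1, (hT μ hμ).2.2.1, (hT μ hμ).2.2.2.2⟩, rfl⟩)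
    have hgD : g ∈ symmSupp D :=
      sum_mem fun μ hμ => Submodule.smul_mem _ _ (hM μ (hT μ hμ).2.1 (hT μ hμ).2.2.1)
    have hcoeff : ∀ ν : Fin n →₀ ℕ, Antitone ν → H ≤ weight ν →
        coeff ν g = if ν ∈ T then coeff ν f else 0 := by
      intro ν hν hw
      have hz : ∀ μ ∈ T, μ ≠ ν →
          coeff ν ((coeff μ f / coeff μ (orbitPoly q μ)) • orbitPoly q μ) = 0 := by
        intro μ hμ hne
        rw [coeff_smul, smul_eq_mul]
        by_contra h
        exact hne (eq_of_coeff_orbitPoly_ne_zero hq (hT μ hμ).2.2.1 hν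
          (by rw [(hT μ hμ).2.2.2.1]; exact hw) (right_ne_zero_of_mul h)).symm
      rw [coeff_sum]
      split_ifs with hνT
      · rw [sum_eq_single_of_mem ν hνT hz, coeff_smul, smul_eq_mul,
          div_mul_cancel₀ _ (coeff_self_orbitPoly_ne_zero hq hq' ν)]
      · exact sum_eq_zero fun μ hμ => hz μ hμ (by rintro rfl; exact hνT hμ)
    have hgw : ∀ ν ∈ g.support, weight ν ≤ H := by
      intro ν hν
      rw [mem_support_iff, coeff_sum] at hν
      obtain ⟨μ, hμ, h⟩ := exists_ne_zero_of_sum_ne_zero hν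
      rw [coeff_smul, smul_eq_mul] at h
      exact (weight_le_of_coeff_orbitPoly_ne_zero hq (hT μ hμ).2.2.1
        (right_ne_zero_of_mul h)).trans (hT μ hμ).2.2.2.1.le
    have hsub := sub_mem hf hgD
    have hle : ∀ ν ∈ (f - g).support, weight ν ≤ H := by
      intro ν hν
      rw [mem_support_iff, coeff_sub] at hν
      by_cases hν0 : coeff ν f = 0
      · rw [hν0, zero_sub, neg_ne_zero] at hν
        exact hgw ν (mem_support_iff.mpr hν)
      · exact Nat.lt_succ_iff.mp (hlt ν (mem_support_iff.mpr hν0))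
    have key : f - g ∈ Submodule.span ℝ (orbitPoly q '' {μ | μ ∈ D ∧ Antitone μ ∧ μ ≠ lam}) := by
      refine ih _ hsub (fun ν hν => ?_) ?_
      · by_contra hc
        have hw : weight ν = H := le_antisymm (hle ν hν) (not_lt.mp hc)
        have hνanti := antitone_of_weight_max (mem_symmSupp.mp hsub).1 hν
          fun ν' hν' => hw ▸ hle ν' hν'
        rw [mem_support_iff, coeff_sub, hcoeff ν hνanti hw.ge] at hν
        split_ifs at hν with h
        · exact hν (sub_self _)
        · refine h (mem_filter.mpr ⟨?_, hνanti, hw⟩)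
          rwa [sub_zero, ← mem_support_iff] at hν
      · rw [coeff_sub, h0, zero_sub, neg_eq_zero]
        by_contra h
        rw [coeff_sum] at h
        obtain ⟨μ, hμ, h⟩ := exists_ne_zero_of_sum_ne_zero h
        rw [coeff_smul, smul_eq_mul] at h
        exact (hT μ hμ).2.2.2.2 (eq_of_coeff_orbitPoly_ne_zero hq (hT μ hμ).2.2.1 hanti
          (hmax μ (hT μ hμ).2.1) (right_ne_zero_of_mul h)).symm
    simpa using add_mem key hg

/-! ### Jacobi polynomials as eigenvectors in a polynomial model. -/

variable {V : Type*} [NormedAddCommGroup V] [InnerProductSpace ℝ V] [FiniteDimensional ℝ V]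
  {ι : Type*} [Fintype ι]

/-- A polynomial model `Ξ` of the functions spanned by orbit sums: `vec` sends exponents to
weights, and `L` is the operator that corresponds to `jacobiOperator`. -/
structure IsModel (root : ι → V) (κ : ι → ℝ) (D : Set (Fin n →₀ ℕ))
    (L : MvPolynomial (Fin n) ℝ →ₗ[ℝ] MvPolynomial (Fin n) ℝ) (ev : (Fin n →₀ ℕ) → ℝ)
    (q : ℕ → Polynomial ℝ) (vec : (Fin n →₀ ℕ) → V) (Ξ : MvPolynomial (Fin n) ℝ →ₗ[ℝ] (V → ℝ))
    (lam : Fin n →₀ ℕ) : Prop where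
  finite : D.Finite
  mem : lam ∈ D
  anti : Antitone lam
  max : ∀ ν ∈ D, weight ν ≤ weight lam
  triangular : IsTriangular D L ev
  natDegree_le : ∀ m, (q m).natDegree ≤ m
  coeff_ne_zero : ∀ m, (q m).coeff m ≠ 0
  orbitPoly_mem : ∀ μ ∈ D, Antitone μ → orbitPoly q μ ∈ symmSupp D
  orbit : ∀ μ ∈ D, Antitone μ → Ξ (orbitPoly q μ) = orbitSum root (vec μ)
  lower : lowerWeights root (vec lam) = vec '' {μ | μ ∈ D ∧ Antitone μ ∧ μ ≠ lam}
  op : ∀ f ∈ symmSupp D, ∀ t, (∀ i, ⟪root i, t⟫_ℝ ≠ 0) →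
    jacobiOperator root κ (Ξ f) t = Ξ (L f) t
  inj : ∀ f ∈ symmSupp D, (∀ t, (∀ i, ⟪root i, t⟫_ℝ ≠ 0) → Ξ f t = 0) → f = 0
  ev_eq : ∀ μ ∈ D, Antitone μ → eigenvalue root κ (vec μ) = ev μ

variable {root : ι → V} {κ : ι → ℝ} {vec : (Fin n →₀ ℕ) → V}
  {Ξ : MvPolynomial (Fin n) ℝ →ₗ[ℝ] (V → ℝ)}

lemma IsModel.ev_ne (h : IsModel root κ D L ev q vec Ξ lam)
    (hnd : Nondegenerate root κ (vec lam)) : ∀ μ ∈ D, Antitone μ → μ ≠ lam → ev μ ≠ ev lam := by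
  intro μ hμ hanti hne
  rw [← h.ev_eq μ hμ hanti, ← h.ev_eq lam h.mem h.anti]
  exact hnd _ (h.lower ▸ ⟨μ, ⟨hμ, hanti, hne⟩, rfl⟩)

/-- The span of the lower orbit sums is the image of the polynomials in `symmSupp D` without the
exponent lam. Triangularity therefore amounts to a prescribed leading coefficient. -/
lemma IsModel.triangular_iff (h : IsModel root κ D L ev q vec Ξ lam) (p : V → ℝ) :
    p - orbitSum root (vec lam) ∈
        Submodule.span ℝ (orbitSum root '' lowerWeights root (vec lam)) ↔
      ∃ f ∈ symmSupp D, coeff lam f = coeff lam (orbitPoly q lam) ∧ p = Ξ f := by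
  have hspan : orbitSum root '' lowerWeights root (vec lam) =
      Ξ '' (orbitPoly q '' {μ | μ ∈ D ∧ Antitone μ ∧ μ ≠ lam}) := by
    rw [h.lower, Set.image_image, Set.image_image]
    exact Set.image_congr fun μ hμ => (h.orbit μ hμ.1 hμ.2.1).symm
  rw [hspan, ← Submodule.map_span, ← h.orbit lam h.mem h.anti]
  constructor
  · rintro ⟨g, hg, hg'⟩
    have hg2 : g ∈ symmSupp D ⊓ LinearMap.ker (lcoeff ℝ lam) := by
      refine Submodule.span_le.mpr ?_ hg
      rintro _ ⟨μ, ⟨hμ, hanti, hne⟩, rfl⟩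
      refine ⟨h.orbitPoly_mem μ hμ hanti, ?_⟩
      by_contra hc
      exact hne (eq_of_coeff_orbitPoly_ne_zero h.natDegree_le hanti h.anti (h.max μ hμ) hc).symm
    have hg3 : coeff lam g = 0 := hg2.2
    refine ⟨orbitPoly q lam + g, add_mem (h.orbitPoly_mem _ h.mem h.anti) hg2.1, ?_, ?_⟩
    · rw [coeff_add, hg3, add_zero]
    · rw [map_add, hg', add_sub_cancel]
  · rintro ⟨f, hf, hc, rfl⟩
    refine ⟨f - orbitPoly q lam, ?_, map_sub _ _ _⟩
    have hf' := sub_mem hf (h.orbitPoly_mem _ h.mem h.anti)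
    refine mem_span_orbitPoly h.natDegree_le h.coeff_ne_zero h.orbitPoly_mem h.anti h.max
      (weight lam + 1) _ hf' (fun ν hν => ?_) ?_
    · exact Nat.lt_succ_iff.mpr (h.max ν ((mem_symmSupp.mp hf').2 ν (mem_support_iff.mp hν)))
    · rw [coeff_sub, hc, sub_self]

/-- A polynomial in the model is determined by its values off the root hyperplanes, so the
differential equation there is equivalent to an identity of polynomials. -/
lemma IsModel.isJacobi_iff (h : IsModel root κ D L ev q vec Ξ lam) (p : V → ℝ) :
    IsJacobi root κ (vec lam) p ↔
      ∃ f, (f ∈ symmSupp D ∧ coeff lam f = coeff lam (orbitPoly q lam) ∧ L f = ev lam • f) ∧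
        p = Ξ f := by
  constructor
  · rintro ⟨h1, h2⟩
    obtain ⟨f, hf, hc, rfl⟩ := (h.triangular_iff p).mp h1
    refine ⟨f, ⟨hf, hc, ?_⟩, rfl⟩
    refine sub_eq_zero.mp (h.inj _ (sub_mem (h.triangular.maps f hf) (Submodule.smul_mem _ _ hf))
      fun t ht => ?_)
    rw [map_sub, map_smul, Pi.sub_apply, ← h.op f hf t ht, h2 t ht, h.ev_eq lam h.mem h.anti,
      Pi.smul_apply, smul_eq_mul, sub_self]
  · rintro ⟨f, ⟨hf, hc, he⟩, rfl⟩
    refine ⟨(h.triangular_iff _).mpr ⟨f, hf, hc, rfl⟩, fun t ht => ?_⟩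
    rw [h.op f hf t ht, he, map_smul, h.ev_eq lam h.mem h.anti, Pi.smul_apply, smul_eq_mul]

/-- Existence and uniqueness of the Jacobi polynomial in a polynomial model. -/
lemma IsModel.existsUnique (h : IsModel root κ D L ev q vec Ξ lam)
    (hnd : Nondegenerate root κ (vec lam)) :
    ∃! f, f ∈ symmSupp D ∧ coeff lam f = coeff lam (orbitPoly q lam) ∧ L f = ev lam • f :=
  h.triangular.existsUnique_eigen h.finite h.mem h.anti h.max (h.ev_ne hnd)
    (h.orbitPoly_mem lam h.mem h.anti)

lemma IsModel.existsUnique_isJacobi (h : IsModel root κ D L ev q vec Ξ lam)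
    (hnd : Nondegenerate root κ (vec lam)) : ∃! p, IsJacobi root κ (vec lam) p := by
  obtain ⟨f, hf, huniq⟩ := h.existsUnique hnd
  refine ⟨Ξ f, (h.isJacobi_iff _).mpr ⟨f, hf, rfl⟩, fun p hp => ?_⟩
  obtain ⟨g, hg, rfl⟩ := (h.isJacobi_iff p).mp hp
  rw [huniq g hg]

lemma IsModel.exists_jacobi_eq (h : IsModel root κ D L ev q vec Ξ lam)
    (hnd : Nondegenerate root κ (vec lam)) :
    ∃ f, (f ∈ symmSupp D ∧ coeff lam f = coeff lam (orbitPoly q lam) ∧ L f = ev lam • f) ∧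
      jacobi root κ (vec lam) = Ξ f :=
  (h.isJacobi_iff _).mp (Classical.epsilon_spec (h.existsUnique_isJacobi hnd).exists)

end Triangular

/-! ### Weyl orbits, polynomial functions of exponentials, and the Jacobi operator -/

section Geometry

variable {V : Type*} [NormedAddCommGroup V] [InnerProductSpace ℝ V] {ι : Type*}

lemma reflection_span_orthogonal_apply (v x : V) :
    (Submodule.span ℝ {v})ᗮ.reflection x = x - (2 * ⟪v, x⟫_ℝ / ⟪v, v⟫_ℝ) • v := by
  rw [Submodule.reflection_orthogonal_apply, Submodule.reflection_singleton_apply, neg_sub,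
    real_inner_self_eq_norm_sq, two_smul, ← add_smul]
  congr 2
  simp only [RCLike.ofReal_real_eq_id, id_eq]
  ring

lemma weylOrbit_subset {root : ι → V} {μ : V} {O : Set V} (hμ : μ ∈ O)
    (hO : ∀ i, ∀ ν ∈ O, (Submodule.span ℝ {root i})ᗮ.reflection ν ∈ O) :
    weylOrbit root μ ⊆ O := by
  rintro _ ⟨w, hw, rfl⟩
  -- The equivalence, unlike the implication, passes to inverses; for a generator it holds because
  -- reflections are involutions.
  suffices h : ∀ ν, ν ∈ O ↔ w ν ∈ O from (h μ).mp hμ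
  refine Subgroup.closure_induction (p := fun w _ => ∀ ν, ν ∈ O ↔ w ν ∈ O) ?_ ?_ ?_ ?_ hw
  · rintro _ ⟨i, rfl⟩ ν
    refine ⟨hO i ν, fun h => ?_⟩
    have := hO i _ h
    rwa [Submodule.reflection_reflection] at this
  · intro ν; rfl
  · intro x y _ _ hx hy ν
    exact (hy ν).trans (hx _)
  · intro x _ hx ν
    rw [hx (x⁻¹ ν)]
    change _ ↔ (x * x⁻¹) ν ∈ O
    rw [mul_inv_cancel]
    rfl

lemma self_mem_weylOrbit (root : ι → V) (μ : V) : μ ∈ weylOrbit root μ :=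
  ⟨1, one_mem _, rfl⟩

lemma reflection_mem_weylOrbit {root : ι → V} {μ ν : V} (h : ν ∈ weylOrbit root μ) (i : ι) :
    (Submodule.span ℝ {root i})ᗮ.reflection ν ∈ weylOrbit root μ := by
  obtain ⟨w, hw, rfl⟩ := h
  exact ⟨_ * w, mul_mem (Subgroup.subset_closure ⟨i, rfl⟩) hw, rfl⟩

lemma inner_two_smul_rho [Fintype ι] (root : ι → V) (κ : ι → ℝ) (μ : V) :
    ⟪μ, (2 : ℝ) • rho root κ⟫_ℝ = ∑ i, κ i * ⟪μ, root i⟫_ℝ := by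
  rw [rho, smul_smul, inner_smul_right, inner_sum]
  norm_num [inner_smul_right]

lemma eigenvalue_eq [Fintype ι] (root : ι → V) (κ : ι → ℝ) (μ : V) :
    eigenvalue root κ μ = ⟪μ, μ⟫_ℝ + ∑ i, κ i * ⟪μ, root i⟫_ℝ := by
  rw [eigenvalue, inner_add_right, inner_two_smul_rho]

/-- A polynomial that vanishes at all points with distinct positive coordinates is zero. -/
lemma eq_zero_of_eval_eq_zero {n : ℕ} {F : MvPolynomial (Fin n) ℝ}
    (h : ∀ x : Fin n → ℝ, (∀ i, 0 < x i) → Function.Injective x → MvPolynomial.eval x F = 0) :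
    F = 0 := by
  -- The Vandermonde product vanishes where coordinates coincide, so F · W vanishes on the whole
  -- positive orthant.
  let W : MvPolynomial (Fin n) ℝ := ∏ p : Pairs n, (MvPolynomial.X p.1.1 - MvPolynomial.X p.1.2)
  have hW : W ≠ 0 := Finset.prod_ne_zero_iff.mpr fun p _ => X_sub_X_ne_zero p.2.ne
  refine (mul_eq_zero.mp ?_).resolve_right hW
  refine MvPolynomial.funext_set (fun _ => Set.Ioi 0) (fun _ => Set.Ioi_infinite 0) fun x hx => ?_
  rw [map_mul, map_zero]
  by_cases hinj : Function.Injective x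
  · rw [h x (fun i => hx i trivial) hinj, zero_mul]
  · have : ∃ p : Pairs n, x p.1.1 = x p.1.2 := by
      simp only [Function.Injective, not_forall] at hinj
      obtain ⟨i, j, hij, hne⟩ := hinj
      rcases lt_or_gt_of_ne hne with hlt | hlt
      · exact ⟨⟨(i, j), hlt⟩, hij⟩
      · exact ⟨⟨(j, i), hlt⟩, hij.symm⟩
    obtain ⟨p, hp⟩ := this
    rw [map_prod, Finset.prod_eq_zero (Finset.mem_univ p), mul_zero]
    simp [hp]

variable {n : ℕ}

/-- The function `t ↦ f(u⟨a_1,t⟩, …, u⟨a_n,t⟩)`. -/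
def polyFun (u : ℝ → ℝ) (a : Fin n → V) : MvPolynomial (Fin n) ℝ →ₗ[ℝ] (V → ℝ) :=
  LinearMap.pi fun t => (MvPolynomial.aeval fun i => u ⟪a i, t⟫_ℝ).toLinearMap

lemma polyFun_apply (u : ℝ → ℝ) (a : Fin n → V) (f : MvPolynomial (Fin n) ℝ) (t : V) :
    polyFun u a f t = MvPolynomial.eval (fun i => u ⟪a i, t⟫_ℝ) f := rfl

open MvPolynomial in
lemma hasFDerivAt_polyFun {u u' : ℝ → ℝ} (hu : ∀ x, HasDerivAt u (u' x) x) (a : Fin n → V)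
    (f : MvPolynomial (Fin n) ℝ) (t : V) :
    HasFDerivAt (polyFun u a f)
      (∑ i, (u' ⟪a i, t⟫_ℝ * polyFun u a (pderiv i f) t) • innerSL ℝ (a i)) t := by
  induction f using MvPolynomial.induction_on with
  | C c =>
    have h0 : polyFun u a (C c : MvPolynomial (Fin n) ℝ) = fun _ => c := by
      ext s; simp [polyFun_apply]
    rw [h0]
    simpa using hasFDerivAt_const c t
  | add p q hp hq =>
    rw [map_add]
    refine (hp.add hq).congr_fderiv ?_
    rw [← Finset.sum_add_distrib]
    refine Finset.sum_congr rfl fun i _ => ?_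
    rw [map_add, map_add, Pi.add_apply, mul_add, add_smul]
  | mul_X p j hp =>
    have h1 : HasFDerivAt (fun s => u ⟪a j, s⟫_ℝ) (u' ⟪a j, t⟫_ℝ • innerSL ℝ (a j)) t :=
      (hu _).comp_hasFDerivAt t (innerSL ℝ (a j)).hasFDerivAt
    have h2 : polyFun u a (p * X j) = fun s => polyFun u a p s * u ⟪a j, s⟫_ℝ := by
      ext s; simp [polyFun_apply]
    rw [h2]
    refine (hp.mul h1).congr_fderiv ?_
    symm
    have h3 : ∀ i, (u' ⟪a i, t⟫_ℝ * polyFun u a (pderiv i (p * X j)) t) • innerSL ℝ (a i) =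
        (if i = j then (polyFun u a p t * u' ⟪a j, t⟫_ℝ) • innerSL ℝ (a j) else 0) +
        u ⟪a j, t⟫_ℝ • ((u' ⟪a i, t⟫_ℝ * polyFun u a (pderiv i p) t) • innerSL ℝ (a i)) := by
      intro i
      rw [Derivation.leibniz, map_add, Pi.add_apply, polyFun_apply, polyFun_apply, polyFun_apply,
        polyFun_apply]
      split_ifs with h
      · subst h
        simp only [pderiv_X_self, smul_eq_mul, map_mul, map_one, eval_X, smul_smul, ← add_smul]
        congr 1; ring
      · simp only [pderiv_X_of_ne (Ne.symm h), smul_eq_mul, map_mul, map_zero, eval_X, smul_smul]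
        rw [zero_add]; congr 1; ring
    rw [Finset.sum_congr rfl fun i _ => h3 i, Finset.sum_add_distrib, Finset.sum_ite_eq' Finset.univ,
      ← Finset.smul_sum, smul_smul]
    simp

open MvPolynomial in
lemma fderiv_polyFun {u u' : ℝ → ℝ} (hu : ∀ x, HasDerivAt u (u' x) x) (a : Fin n → V)
    (f : MvPolynomial (Fin n) ℝ) (t v : V) :
    fderiv ℝ (polyFun u a f) t v =
      ∑ i, u' ⟪a i, t⟫_ℝ * polyFun u a (pderiv i f) t * ⟪a i, v⟫_ℝ := by
  rw [(hasFDerivAt_polyFun hu a f t).fderiv]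
  simp

-- The chain rule in an orthonormal basis; Parseval's identity collapses the sums over the basis to
-- the inner products of the a_i. These need not be orthogonal, as type A requires.
open MvPolynomial in
lemma laplacian_polyFun [FiniteDimensional ℝ V] {u u' u'' : ℝ → ℝ} (hu : ∀ x, HasDerivAt u (u' x) x)
    (hu' : ∀ x, HasDerivAt u' (u'' x) x) (a : Fin n → V) (f : MvPolynomial (Fin n) ℝ) (t : V) :
    Δ (polyFun u a f) t =
      ∑ i, (⟪a i, a i⟫_ℝ * (u'' ⟪a i, t⟫_ℝ * polyFun u a (pderiv i f) t) +
        ∑ l, ⟪a i, a l⟫_ℝ * (u' ⟪a i, t⟫_ℝ * u' ⟪a l, t⟫_ℝ *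
          polyFun u a (pderiv l (pderiv i f)) t)) := by
  have hfd : fderiv ℝ (polyFun u a f) =
      fun s => ∑ i, (u' ⟪a i, s⟫_ℝ * polyFun u a (pderiv i f) s) • innerSL ℝ (a i) :=
    funext fun s => (hasFDerivAt_polyFun hu a f s).fderiv
  have h1 : ∀ i, HasFDerivAt (fun s => u' ⟪a i, s⟫_ℝ) (u'' ⟪a i, t⟫_ℝ • innerSL ℝ (a i)) t :=
    fun i => (hu' _).comp_hasFDerivAt t (innerSL ℝ (a i)).hasFDerivAt
  have h2 := HasFDerivAt.fun_sum (u := Finset.univ) fun i _ =>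
    (((h1 i).mul (hasFDerivAt_polyFun hu a (pderiv i f) t)).smul_const (innerSL ℝ (a i)))
  have h3 := fun v : V => congrArg (fun T => T v v) h2.fderiv
  rw [InnerProductSpace.laplacian_eq_iteratedFDeriv_stdOrthonormalBasis]
  simp only [iteratedFDeriv_two_apply, Matrix.cons_val_zero, Matrix.cons_val_one, hfd]
  refine (Finset.sum_congr rfl fun b _ => h3 _).trans ?_
  have hb : ∀ x y : V, ∑ b, ⟪x, stdOrthonormalBasis ℝ V b⟫_ℝ * ⟪y, stdOrthonormalBasis ℝ V b⟫_ℝ =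
      ⟪x, y⟫_ℝ := fun x y => by
    rw [← (stdOrthonormalBasis ℝ V).sum_inner_mul_inner x y]
    exact Finset.sum_congr rfl fun b _ => by rw [real_inner_comm y]
  simp only [_root_.sum_apply, ContinuousLinearMap.smulRight_apply,
    _root_.add_apply, _root_.smul_apply, innerSL_apply_apply, smul_eq_mul]
  rw [Finset.sum_comm]
  refine Finset.sum_congr rfl fun i _ => ?_
  rw [← hb (a i) (a i), Finset.sum_mul]
  simp_rw [← hb (a i) (a _), Finset.sum_mul]
  rw [Finset.sum_comm (s := (Finset.univ : Finset (Fin n))), ← Finset.sum_add_distrib]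
  refine Finset.sum_congr rfl fun b _ => ?_
  rw [Finset.mul_sum, add_mul, Finset.sum_mul, add_comm]
  congr 1
  · ring
  · exact Finset.sum_congr rfl fun l _ => by ring

open Finset in
/-- Summation by parts: a vector in terms of its partial sums and the simple roots. -/
lemma eq_sum_partial_smul (y : EuclideanSpace ℝ (Fin n)) :
    y = ∑ k : Fin n, (∑ i ∈ Iic k, y i) •
      (stdVec k - if h : k.val + 1 < n then stdVec ⟨k.val + 1, h⟩ else 0) := by
  ext l
  have h1 : ∀ k : Fin n, (stdVec k - if h : k.val + 1 < n then stdVec ⟨k.val + 1, h⟩ else 0 :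
      EuclideanSpace ℝ (Fin n)) l =
      (if k = l then 1 else 0) - (if k.val + 1 = l.val then 1 else 0) := by
    intro k
    have e1 : (stdVec k : EuclideanSpace ℝ (Fin n)) l = if k = l then 1 else 0 := by
      simp [eq_comm]
    rw [PiLp.sub_apply, e1]
    congr 1
    split_ifs with h2 h3 h3
    · simp [h3]
    · rw [PiLp.single_apply, if_neg]
      rintro rfl; exact h3 rfl
    · have := l.2; omega
    · rfl
  rw [WithLp.ofLp_sum, Finset.sum_apply]
  simp only [PiLp.smul_apply, h1, smul_eq_mul, mul_sub, mul_ite, mul_one, mul_zero,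
    sum_sub_distrib, sum_ite_eq', mem_univ, if_true]
  have h2 : ∑ k : Fin n, (if k.val + 1 = l.val then ∑ i ∈ Iic k, y i else 0) =
      ∑ i ∈ Iio l, y i := by
    rcases Nat.eq_zero_or_pos l.val with h0 | h0
    · rw [sum_eq_zero fun k _ => if_neg (by omega), eq_comm]
      refine sum_eq_zero fun i hi => ?_
      rw [mem_Iio, Fin.lt_def] at hi; omega
    · rw [sum_eq_single (⟨l.val - 1, by omega⟩ : Fin n)]
      · rw [if_pos (by simp; omega)]
        refine sum_congr ?_ fun _ _ => rfl
        ext i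
        simp only [mem_Iic, mem_Iio, Fin.le_def, Fin.lt_def]
        omega
      · intro k _ hk
        rw [if_neg]
        intro h; exact hk (Fin.ext (by simp; omega))
      · simp
  rw [h2, ← Iio_insert, sum_insert (by simp)]
  ring

end Geometry

/-! ### The root system `BC_n` -/

section TypeBC

open Finset

variable {n : ℕ}

@[simp]
lemma inner_stdVec_left (i : Fin n) (t : EuclideanSpace ℝ (Fin n)) : ⟪stdVec i, t⟫_ℝ = t i :=
  (EuclideanSpace.inner_single_left i 1 t).trans (by simp)

@[simp]
lemma inner_stdVec_right (i : Fin n) (t : EuclideanSpace ℝ (Fin n)) : ⟪t, stdVec i⟫_ℝ = t i := by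
  rw [real_inner_comm, inner_stdVec_left]

lemma toVec_apply (μ : Fin n → ℕ) (i : Fin n) : toVec μ i = μ i := rfl

lemma toVec_injective : Function.Injective (toVec : (Fin n → ℕ) → EuclideanSpace ℝ (Fin n)) :=
  fun μ ν h => funext fun i => by
    have := congrArg (fun v : EuclideanSpace ℝ (Fin n) => v i) h
    simpa [toVec_apply] using this

lemma inner_toVec_self (μ : Fin n → ℕ) : ⟪toVec μ, toVec μ⟫_ℝ = ∑ i, (μ i : ℝ) ^ 2 := by
  rw [PiLp.inner_apply]
  simp [toVec_apply]

/-- Reflection in a long or short root. -/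
lemma reflection_stdVec (c : ℝ) (hc : c ≠ 0) (i : Fin n) (x : EuclideanSpace ℝ (Fin n)) (l : Fin n) :
    (Submodule.span ℝ {c • stdVec i})ᗮ.reflection x l = if l = i then -x l else x l := by
  rw [reflection_span_orthogonal_apply]
  simp only [inner_smul_left, inner_smul_right, inner_stdVec_left, PiLp.sub_apply, PiLp.smul_apply,
    PiLp.single_apply, smul_eq_mul, conj_trivial]
  by_cases h : l = i
  · subst h
    simp only [if_true]
    field_simp
    ring
  · simp [h]

lemma reflection_stdVec_sub {i j : Fin n} (hij : i ≠ j) (x : EuclideanSpace ℝ (Fin n)) (l : Fin n) :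
    (Submodule.span ℝ {stdVec i - stdVec j})ᗮ.reflection x l = x (Equiv.swap i j l) := by
  rw [reflection_span_orthogonal_apply]
  simp only [inner_sub_left, inner_stdVec_left, PiLp.sub_apply, PiLp.smul_apply,
    PiLp.single_apply, smul_eq_mul]
  rw [if_neg hij, if_neg hij.symm]
  by_cases h1 : l = i
  · subst h1; simp [hij]
    ring
  by_cases h2 : l = j
  · subst h2; simp [h1]
    ring
  simp [h1, h2, Equiv.swap_apply_of_ne_of_ne h1 h2]

lemma reflection_stdVec_add {i j : Fin n} (hij : i ≠ j) (x : EuclideanSpace ℝ (Fin n)) (l : Fin n) :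
    (Submodule.span ℝ {stdVec i + stdVec j})ᗮ.reflection x l =
      if l = i ∨ l = j then -x (Equiv.swap i j l) else x l := by
  rw [reflection_span_orthogonal_apply]
  simp only [inner_add_left, inner_stdVec_left, PiLp.sub_apply, PiLp.smul_apply, PiLp.add_apply,
    PiLp.single_apply, smul_eq_mul]
  rw [if_neg hij, if_neg hij.symm]
  by_cases h1 : l = i
  · subst h1; simp [hij]
    ring
  by_cases h2 : l = j
  · subst h2; simp [h1]
    ring
  simp [h1, h2]

lemma swap_toVec (i j : Fin n) (ν : Fin n →₀ ℕ) (l : Fin n) :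
    toVec ⇑(ν.mapDomain (Equiv.swap i j)) l = toVec ν (Equiv.swap i j l) := by
  rw [toVec_apply, toVec_apply, mapDomain_swap_apply]

/-- The Weyl orbits of `BC_n` consist of the signed rearrangements. -/
lemma weylOrbit_bcRoot (μ : Fin n →₀ ℕ) :
    weylOrbit (bcRoot n) (toVec μ) =
      {v | ∃ ν ∈ permOrbit μ, ∀ i, v i = (ν i : ℝ) ∨ v i = -(ν i : ℝ)} := by
  refine subset_antisymm (weylOrbit_subset ⟨μ, self_mem_permOrbit μ, fun i => Or.inl rfl⟩ ?_) ?_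
  · rintro ((i | i) | (p | p)) v ⟨ν, hν, hv⟩
    · refine ⟨ν, hν, fun l => ?_⟩
      have := reflection_stdVec 1 one_ne_zero i v l
      rw [one_smul] at this
      change (Submodule.span ℝ {stdVec i})ᗮ.reflection v l = _ ∨
        (Submodule.span ℝ {stdVec i})ᗮ.reflection v l = _
      rw [this]
      rcases hv l with h | h <;> rw [h] <;> split_ifs <;> simp
    · refine ⟨ν, hν, fun l => ?_⟩
      change (Submodule.span ℝ {(2 : ℝ) • stdVec i})ᗮ.reflection v l = _ ∨
        (Submodule.span ℝ {(2 : ℝ) • stdVec i})ᗮ.reflection v l = _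
      rw [reflection_stdVec 2 two_ne_zero]
      rcases hv l with h | h <;> rw [h] <;> split_ifs <;> simp
    · refine ⟨_, mapDomain_mem_permOrbit (Equiv.swap p.1.1 p.1.2) hν, fun l => ?_⟩
      change (Submodule.span ℝ {stdVec p.1.1 - stdVec p.1.2})ᗮ.reflection v l = _ ∨
        (Submodule.span ℝ {stdVec p.1.1 - stdVec p.1.2})ᗮ.reflection v l = _
      rw [reflection_stdVec_sub p.2.ne, mapDomain_swap_apply]
      exact hv _
    · refine ⟨_, mapDomain_mem_permOrbit (Equiv.swap p.1.1 p.1.2) hν, fun l => ?_⟩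
      change (Submodule.span ℝ {stdVec p.1.1 + stdVec p.1.2})ᗮ.reflection v l = _ ∨
        (Submodule.span ℝ {stdVec p.1.1 + stdVec p.1.2})ᗮ.reflection v l = _
      rw [reflection_stdVec_add p.2.ne, mapDomain_swap_apply]
      split_ifs with h
      · rcases hv (Equiv.swap p.1.1 p.1.2 l) with h | h <;> rw [h] <;> simp
      · push Not at h
        rw [Equiv.swap_apply_of_ne_of_ne h.1 h.2]
        exact hv _
  · rintro v ⟨ν, hν, hv⟩
    -- The reflections in e_i − e_j give all rearrangements; signs are then changed one at a time by
    -- the reflections in 2e_j.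
    have hperm : ∀ σ : Equiv.Perm (Fin n),
        toVec ⇑(μ.mapDomain σ) ∈ weylOrbit (bcRoot n) (toVec μ) := by
      intro σ
      induction σ using Equiv.Perm.swap_induction_on with
      | one => simpa using self_mem_weylOrbit _ _
      | swap_mul σ i j hij ih =>
        have : ∀ i j : Fin n, i < j → toVec ⇑((μ.mapDomain σ).mapDomain (Equiv.swap i j)) ∈
            weylOrbit (bcRoot n) (toVec μ) := by
          intro i j hij
          convert reflection_mem_weylOrbit ih (Sum.inr (Sum.inl ⟨(i, j), hij⟩)) using 1
          ext l
          rw [swap_toVec]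
          exact (reflection_stdVec_sub hij.ne _ l).symm
        rw [Equiv.Perm.coe_mul, Finsupp.mapDomain_comp]
        rcases lt_or_gt_of_ne hij with h | h
        · exact this i j h
        · rw [Equiv.swap_comm]; exact this j i h
    have hsign : ∀ S : Finset (Fin n), WithLp.toLp 2 (fun i => if i ∈ S then -(ν i : ℝ) else ν i) ∈
        weylOrbit (bcRoot n) (toVec μ) := by
      intro S
      induction S using Finset.induction_on with
      | empty =>
        obtain ⟨σ, rfl⟩ := mem_permOrbit.mp hν
        simp only [notMem_empty, if_false]
        exact hperm σ
      | insert j S hj ih =>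
        convert reflection_mem_weylOrbit ih (Sum.inl (Sum.inr j)) using 1
        ext l
        refine Eq.trans ?_ (reflection_stdVec 2 two_ne_zero j _ l).symm
        simp only [mem_insert]
        by_cases h : l = j
        · subst h; simp [hj]
        · simp [h]
    convert hsign (univ.filter fun i => v i ≠ ν i) using 1
    ext i
    rcases hv i with h | h
    · simp [h]
    · simp only [mem_filter, mem_univ, true_and]
      split_ifs with h'
      · exact h
      · exact not_not.mp h'

/-! ### The orbit sums of BC_n as polynomials in sinh²(t_i/2). -/

/-- The polynomial that expresses `2 cosh(m t)` in terms of `sinh²(t/2)`. -/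
def coshPoly : ℕ → Polynomial ℝ
  | 0 => Polynomial.C 2
  | 1 => Polynomial.C 4 * Polynomial.X + Polynomial.C 2
  | m + 2 => (Polynomial.C 4 * Polynomial.X + Polynomial.C 2) * coshPoly (m + 1) - coshPoly m

/-- Chebyshev's recursion: 2 cosh t = 4 sinh²(t/2) + 2, and 2 cosh t · 2 cosh((m+1)t) is the sum of
2 cosh((m+2)t) and 2 cosh(mt). -/
lemma coshPoly_eval (m : ℕ) (t : ℝ) :
    (coshPoly m).eval (Real.sinh (t / 2) ^ 2) = Real.exp (m * t) + Real.exp (-m * t) := by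
  have h4 : 4 * Real.sinh (t / 2) ^ 2 + 2 = Real.exp t + Real.exp (-t) := by
    have h1 : Real.exp t = Real.exp (t / 2) ^ 2 := by rw [← Real.exp_nat_mul]; ring_nf
    have h2 : Real.exp (-t) = Real.exp (-(t / 2)) ^ 2 := by rw [← Real.exp_nat_mul]; ring_nf
    have h3 : Real.exp (t / 2) * Real.exp (-(t / 2)) = 1 := by rw [← Real.exp_add]; simp
    rw [Real.sinh_eq, h1, h2]
    linear_combination (-2) * h3
  induction m using Nat.strong_induction_on with
  | _ m ih =>
    match m with
    | 0 => norm_num [coshPoly]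
    | 1 => simpa [coshPoly] using h4
    | m + 2 =>
      rw [coshPoly]
      simp only [Polynomial.eval_sub, Polynomial.eval_mul, Polynomial.eval_add, Polynomial.eval_C,
        Polynomial.eval_X, ih (m + 1) (by omega), ih m (by omega), h4]
      have e1 : Real.exp t * Real.exp ((m + 1 : ℕ) * t) = Real.exp ((m + 2 : ℕ) * t) := by
        rw [← Real.exp_add]; push_cast; ring_nf
      have e2 : Real.exp t * Real.exp (-(m + 1 : ℕ) * t) = Real.exp (-m * t) := by
        rw [← Real.exp_add]; push_cast; ring_nf
      have e3 : Real.exp (-t) * Real.exp ((m + 1 : ℕ) * t) = Real.exp (m * t) := by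
        rw [← Real.exp_add]; push_cast; ring_nf
      have e4 : Real.exp (-t) * Real.exp (-(m + 1 : ℕ) * t) = Real.exp (-(m + 2 : ℕ) * t) := by
        rw [← Real.exp_add]; push_cast; ring_nf
      linear_combination e1 + e2 + e3 + e4

lemma coshPoly_natDegree_coeff (m : ℕ) : (coshPoly m).natDegree ≤ m ∧ 0 < (coshPoly m).coeff m := by
  have hlin : (Polynomial.C 4 * Polynomial.X + Polynomial.C 2 : Polynomial ℝ).natDegree ≤ 1 :=
    Polynomial.natDegree_linear_le
  induction m using Nat.strong_induction_on with
  | _ m ih =>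
    match m with
    | 0 => simp [coshPoly]
    | 1 => exact ⟨hlin, by simp [coshPoly]⟩
    | m + 2 =>
      obtain ⟨h1, h1'⟩ := ih (m + 1) (by omega)
      obtain ⟨h2, -⟩ := ih m (by omega)
      rw [coshPoly]
      constructor
      · refine (Polynomial.natDegree_sub_le _ _).trans (max_le ?_ (by omega))
        exact Polynomial.natDegree_mul_le.trans (by omega)
      · rw [Polynomial.coeff_sub, add_mul, Polynomial.coeff_add, mul_assoc, Polynomial.coeff_C_mul,
          Polynomial.coeff_C_mul, Polynomial.coeff_X_mul,
          Polynomial.coeff_eq_zero_of_natDegree_lt (p := coshPoly m) (by omega),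
          Polynomial.coeff_eq_zero_of_natDegree_lt (p := coshPoly (m + 1)) (n := m + 2) (by omega)]
        linarith

/-- The orbit sum of `m` in rank one as a polynomial in `sinh²(t/2)`. -/
def rankOnePoly (m : ℕ) : Polynomial ℝ := if m = 0 then 1 else coshPoly m

lemma rankOnePoly_natDegree (m : ℕ) : (rankOnePoly m).natDegree ≤ m := by
  rw [rankOnePoly]
  split_ifs
  · simp
  · exact (coshPoly_natDegree_coeff m).1

lemma rankOnePoly_coeff (m : ℕ) : (rankOnePoly m).coeff m ≠ 0 := by
  rw [rankOnePoly]
  split_ifs with h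
  · simp [h]
  · exact (coshPoly_natDegree_coeff m).2.ne'

/-- For m = 0 the set {m, −m} collapses to one point, which is why `rankOnePoly` takes the value 1
there and not 2. -/
lemma rankOnePoly_eval (m : ℕ) (t : ℝ) :
    (rankOnePoly m).eval (Real.sinh (t / 2) ^ 2) =
      ∑ s ∈ ({(m : ℝ), -(m : ℝ)} : Finset ℝ), Real.exp (s * t) := by
  rw [rankOnePoly]
  split_ifs with h
  · simp [h]
  · have : (m : ℝ) ≠ -m := by
      have : (0 : ℝ) < m := by exact_mod_cast Nat.pos_of_ne_zero h
      intro h'; linarith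
    rw [sum_pair this, coshPoly_eval]

/-- The functions on `ℝⁿ` that are polynomials in the variables `sinh²(t_i/2)`. -/
def bcFun (n : ℕ) : MvPolynomial (Fin n) ℝ →ₗ[ℝ] (EuclideanSpace ℝ (Fin n) → ℝ) :=
  polyFun (fun x => Real.sinh (x / 2) ^ 2) stdVec

lemma bcFun_apply (f : MvPolynomial (Fin n) ℝ) (t : EuclideanSpace ℝ (Fin n)) :
    bcFun n f t = MvPolynomial.eval (fun i => Real.sinh (t i / 2) ^ 2) f := by
  rw [bcFun, polyFun_apply]
  simp only [inner_stdVec_left]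

/-- A signed rearrangement determines its rearrangement through absolute values, so the orbit is a
disjoint union over ν; for fixed ν the sum over signs factors over the coordinates. -/
lemma bcFun_orbitPoly (μ : Fin n →₀ ℕ) :
    bcFun n (orbitPoly rankOnePoly μ) = orbitSum (bcRoot n) (toVec μ) := by
  classical
  ext t
  let B : (Fin n →₀ ℕ) → Finset (Fin n → ℝ) := fun ν =>
    Fintype.piFinset fun i => ({(ν i : ℝ), -(ν i : ℝ)} : Finset ℝ)
  have hB : ∀ ν y, y ∈ B ν ↔ ∀ i, y i = ν i ∨ y i = -(ν i : ℝ) := fun ν y => by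
    simp [B, Fintype.mem_piFinset]
  have horb : weylOrbit (bcRoot n) (toVec μ) =
      WithLp.toLp 2 '' ((permOrbit μ).biUnion B : Set (Fin n → ℝ)) := by
    rw [weylOrbit_bcRoot]
    ext v
    simp only [Set.mem_ofPred_eq, Set.mem_image, mem_coe, mem_biUnion, hB]
    constructor
    · rintro ⟨ν, hν, hv⟩
      exact ⟨WithLp.ofLp v, ⟨ν, hν, hv⟩, rfl⟩
    · rintro ⟨y, ⟨ν, hν, hv⟩, rfl⟩
      exact ⟨ν, hν, hv⟩
  have hdisj : (permOrbit μ : Set (Fin n →₀ ℕ)).PairwiseDisjoint B := by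
    intro ν _ ν' _ hne
    rw [Function.onFun, Finset.disjoint_left]
    intro y hy hy'
    refine hne (Finsupp.ext fun i => ?_)
    have habs : ∀ ν, y ∈ B ν → |y i| = ν i := fun ν h => by
      rcases (hB ν y).mp h i with h | h <;> rw [h] <;> simp
    exact_mod_cast (habs ν hy).symm.trans (habs ν' hy')
  rw [orbitSum, horb, finsum_mem_image (WithLp.toLp_injective 2).injOn, finsum_mem_coe_finset,
    sum_biUnion hdisj, bcFun_apply, orbitPoly, map_sum]
  refine sum_congr rfl fun ν _ => ?_
  have h1 : ∀ i, MvPolynomial.eval (fun i => Real.sinh (t i / 2) ^ 2)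
      (Polynomial.aeval (MvPolynomial.X i : MvPolynomial (Fin n) ℝ) (rankOnePoly (ν i))) =
      ∑ s ∈ ({(ν i : ℝ), -(ν i : ℝ)} : Finset ℝ), Real.exp (s * t i) := by
    intro i
    rw [← rankOnePoly_eval, ← MvPolynomial.coe_aeval_eq_eval, RingHom.coe_coe,
      ← Polynomial.aeval_algHom_apply, MvPolynomial.aeval_X, Polynomial.coe_aeval_eq_eval]
  rw [map_prod, prod_congr rfl fun i _ => h1 i, prod_univ_sum]
  refine sum_congr rfl fun y _ => ?_
  rw [← Real.exp_sum]
  congr 1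
  simp [PiLp.inner_apply, mul_comm]

lemma sum_bcIndex {M : Type*} [AddCommMonoid M] (F : BCIndex n → M) :
    ∑ x, F x = ∑ i, F (Sum.inl (Sum.inl i)) + ∑ i, F (Sum.inl (Sum.inr i)) +
      (∑ p, F (Sum.inr (Sum.inl p)) + ∑ p, F (Sum.inr (Sum.inr p))) := by
  simp only [Fintype.sum_sum_type]

/-- The roots e_i ± e_j together contribute 2 k₃ μ_i. The parameters k₁ and k₂ enter only through
the degree, which is what separates degrees in the limit. -/
lemma eigenvalue_bc (k₁ k₂ k₃ : ℝ) (μ : Fin n →₀ ℕ) :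
    eigenvalue (bcRoot n) (bcMult n k₁ k₂ k₃) (toVec μ) =
      topEigenvalue n k₃ μ + (k₁ + 2 * k₂) * μ.degree := by
  rw [eigenvalue_eq, inner_toVec_self, sum_bcIndex, topEigenvalue, Finsupp.degree_eq_sum]
  simp only [bcRoot, bcMult, Sum.elim_inl, Sum.elim_inr, inner_add_right, inner_sub_right,
    inner_smul_right, inner_stdVec_right, toVec_apply, ← mul_sum, Nat.cast_sum,
    sum_sub_distrib, sum_add_distrib]
  ring

/-! ### Dominant weights of BC_n and their partial order. -/

lemma mem_dominantWeights_bc {x : EuclideanSpace ℝ (Fin n)} :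
    x ∈ dominantWeights (bcRoot n) ↔ ∃ μ : Fin n →₀ ℕ, Antitone μ ∧ x = toVec μ := by
  constructor
  · intro h
    have h1 : ∀ i, ∃ m : ℕ, x i = m := fun i => by
      obtain ⟨m, hm⟩ := h (Sum.inl (Sum.inr i))
      refine ⟨m, ?_⟩
      rw [← hm]
      simp only [bcRoot, Sum.elim_inl, Sum.elim_inr, inner_smul_right, inner_smul_left,
        inner_stdVec_right, PiLp.single_apply, conj_trivial, if_true]
      ring
    choose μ hμ using h1
    refine ⟨Finsupp.equivFunOnFinite.symm μ, ?_, ?_⟩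
    · intro i j hij
      rcases hij.eq_or_lt with rfl | hlt
      · exact le_rfl
      obtain ⟨m, hm⟩ := h (Sum.inr (Sum.inl ⟨(i, j), hlt⟩))
      simp only [bcRoot, Sum.elim_inl, Sum.elim_inr, inner_sub_right, inner_sub_left,
        inner_stdVec_right, PiLp.single_apply, hlt.ne, hlt.ne', if_true, if_false, hμ] at hm
      have : (μ j : ℝ) ≤ μ i := by
        have h0 : (0 : ℝ) ≤ m := Nat.cast_nonneg m
        linarith
      simpa using this
    · ext i
      simp [toVec_apply, hμ]
  · rintro ⟨μ, hμ, rfl⟩ ((i | i) | (p | p))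
    · refine ⟨2 * μ i, ?_⟩
      simp [bcRoot, toVec_apply]
    · refine ⟨μ i, ?_⟩
      simp only [bcRoot, Sum.elim_inl, Sum.elim_inr, inner_smul_right, inner_smul_left,
        inner_stdVec_right, PiLp.single_apply, conj_trivial, if_true, toVec_apply]
      ring
    · refine ⟨μ p.1.1 - μ p.1.2, ?_⟩
      rw [Nat.cast_sub (hμ p.2.le)]
      simp only [bcRoot, Sum.elim_inl, Sum.elim_inr, inner_sub_right, inner_sub_left,
        inner_stdVec_right, PiLp.single_apply, p.2.ne, p.2.ne', if_true, if_false, toVec_apply]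
      ring
    · refine ⟨μ p.1.1 + μ p.1.2, ?_⟩
      simp only [bcRoot, Sum.elim_inr, inner_add_right, inner_add_left,
        inner_stdVec_right, PiLp.single_apply, p.2.ne, p.2.ne', if_true, if_false, toVec_apply,
        Nat.cast_add]
      ring

lemma sum_Iic_stdVec (i k : Fin n) :
    ∑ l ∈ Iic k, (stdVec i : EuclideanSpace ℝ (Fin n)) l = if i ≤ k then 1 else 0 := by
  simp [PiLp.single_apply]

lemma sum_Iic_stdVec_sub_nonneg {i j : Fin n} (hij : i < j) (k : Fin n) :
    0 ≤ ∑ l ∈ Iic k, (stdVec i - stdVec j : EuclideanSpace ℝ (Fin n)) l := by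
  simp only [PiLp.sub_apply, sum_sub_distrib, sum_Iic_stdVec]
  split_ifs with h1 h2 h2
  · simp
  · simp
  · exact absurd (hij.le.trans h2) h1
  · simp

/-- All positive roots have nonnegative partial sums. Conversely, the partial sums of λ − μ are its
coefficients with respect to the simple roots e_k − e_{k+1} and the last basis vector. -/
lemma weightLE_bc_iff {lam : Fin n → ℕ} {μ : Fin n →₀ ℕ} (hμ : Antitone μ) :
    weightLE (bcRoot n) (toVec μ) (toVec lam) ↔ μ ∈ dominated lam := by
  rw [mem_dominated_iff_of_antitone hμ]
  constructor
  · intro h k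
    have key : 0 ≤ ∑ i ∈ Iic k, (toVec lam - toVec μ) i := by
      refine AddSubmonoid.closure_induction
        (motive := fun y : EuclideanSpace ℝ (Fin n) => fun _ => 0 ≤ ∑ i ∈ Iic k, y i) ?_ ?_ ?_ h
      · rintro _ ⟨(i | i) | (p | p), rfl⟩
        · change 0 ≤ ∑ l ∈ Iic k, (stdVec i : EuclideanSpace ℝ (Fin n)) l
          rw [sum_Iic_stdVec]; split_ifs <;> norm_num
        · change 0 ≤ ∑ l ∈ Iic k, ((2 : ℝ) • stdVec i : EuclideanSpace ℝ (Fin n)) l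
          simp only [PiLp.smul_apply, ← smul_sum]
          rw [sum_Iic_stdVec]; split_ifs <;> norm_num
        · exact sum_Iic_stdVec_sub_nonneg p.2 k
        · change 0 ≤ ∑ l ∈ Iic k, (stdVec p.1.1 + stdVec p.1.2 : EuclideanSpace ℝ (Fin n)) l
          simp only [PiLp.add_apply, sum_add_distrib]
          rw [sum_Iic_stdVec, sum_Iic_stdVec]; split_ifs <;> norm_num
      · simp
      · intro x y _ _ hx hy
        simpa [sum_add_distrib] using add_nonneg hx hy
    simp only [PiLp.sub_apply, sum_sub_distrib, toVec_apply] at key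
    have : (∑ i ∈ Iic k, (μ i : ℝ)) ≤ ∑ i ∈ Iic k, (lam i : ℝ) := by linarith
    exact_mod_cast this
  · intro h
    rw [weightLE, eq_sum_partial_smul (toVec lam - toVec μ)]
    refine sum_mem fun k _ => ?_
    have e : ∑ i ∈ Iic k, (toVec lam - toVec μ) i =
        ((∑ i ∈ Iic k, lam i - ∑ i ∈ Iic k, μ i : ℕ) : ℝ) := by
      rw [Nat.cast_sub (h k)]
      simp [toVec_apply, sum_sub_distrib]
    rw [e, Nat.cast_smul_eq_nsmul]
    refine nsmul_mem (AddSubmonoid.subset_closure ?_) _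
    split_ifs with hk
    · exact ⟨Sum.inr (Sum.inl ⟨(k, ⟨k.val + 1, hk⟩), by simp [Fin.lt_def]⟩), rfl⟩
    · exact ⟨Sum.inl (Sum.inl k), by simp [bcRoot]⟩

lemma lowerWeights_bc (lam : Fin n →₀ ℕ) :
    lowerWeights (bcRoot n) (toVec lam) =
      (fun μ : Fin n →₀ ℕ => toVec μ) '' {μ | μ ∈ dominated lam ∧ Antitone μ ∧ μ ≠ lam} := by
  ext x
  constructor
  · rintro ⟨hx, hle, hne⟩
    obtain ⟨μ, hμ, rfl⟩ := mem_dominantWeights_bc.mp hx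
    exact ⟨μ, ⟨(weightLE_bc_iff hμ).mp hle, hμ, by rintro rfl; exact hne rfl⟩, rfl⟩
  · rintro ⟨μ, ⟨h1, h2, h3⟩, rfl⟩
    exact ⟨mem_dominantWeights_bc.mpr ⟨μ, h2, rfl⟩, (weightLE_bc_iff h2).mpr h1,
      fun h => h3 (DFunLike.coe_injective (toVec_injective h))⟩

/-! ### The BC_n operator in the variables sinh²(t_i/2). -/

/-- The operator on symmetric polynomials that corresponds to the `BC_n` operator. -/
def bcOp (n : ℕ) (k₁ k₂ k₃ : ℝ) : MvPolynomial (Fin n) ℝ →ₗ[ℝ] MvPolynomial (Fin n) ℝ :=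
  topOp n k₃ + (k₁ + 2 * k₂) • eulerOp n + lowOp n k₃ + (k₁ + k₂) • gradOp n

lemma bcOp_apply (k₁ k₂ k₃ : ℝ) (f : MvPolynomial (Fin n) ℝ) :
    bcOp n k₁ k₂ k₃ f = topOp n k₃ f + (k₁ + 2 * k₂) • eulerOp n f + lowOp n k₃ f +
      (k₁ + k₂) • gradOp n f := rfl

lemma hasDerivAt_sinh_half_sq (x : ℝ) :
    HasDerivAt (fun x => Real.sinh (x / 2) ^ 2) (Real.sinh x / 2) x := by
  have h := ((Real.hasDerivAt_sinh (x / 2)).comp x ((hasDerivAt_id x).div_const 2)).pow 2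
  refine h.congr_deriv ?_
  have : Real.sinh x = 2 * Real.sinh (x / 2) * Real.cosh (x / 2) := by
    rw [← Real.sinh_two_mul]; ring_nf
  rw [this]
  simp
  ring

lemma cosh_half_eq (x : ℝ) : Real.cosh x / 2 = Real.sinh (x / 2) ^ 2 + 1 / 2 := by
  have : Real.cosh x = Real.cosh (x / 2) ^ 2 + Real.sinh (x / 2) ^ 2 := by
    rw [← Real.cosh_two_mul]; ring_nf
  rw [this, Real.cosh_sq]; ring

lemma sinh_half_sq_eq (x : ℝ) : (Real.sinh x / 2) ^ 2 =
    (Real.sinh (x / 2) ^ 2) ^ 2 + Real.sinh (x / 2) ^ 2 := by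
  have : Real.sinh x = 2 * Real.sinh (x / 2) * Real.cosh (x / 2) := by
    rw [← Real.sinh_two_mul]; ring_nf
  rw [this]
  linear_combination Real.sinh (x / 2) ^ 2 * Real.cosh_sq (x / 2)

lemma coth_half_mul {x : ℝ} (hx : x ≠ 0) : coth (x / 2) * (Real.sinh x / 2) =
    Real.sinh (x / 2) ^ 2 + 1 := by
  have h0 : Real.sinh (x / 2) ≠ 0 := by simpa [Real.sinh_eq_zero] using hx
  have : Real.sinh x = 2 * Real.sinh (x / 2) * Real.cosh (x / 2) := by
    rw [← Real.sinh_two_mul]; ring_nf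
  rw [this, coth, ← Real.cosh_sq]
  field_simp

lemma coth_mul {x : ℝ} (hx : x ≠ 0) : coth x * (Real.sinh x / 2) =
    Real.sinh (x / 2) ^ 2 + 1 / 2 := by
  have h0 : Real.sinh x ≠ 0 := by simpa [Real.sinh_eq_zero] using hx
  rw [← cosh_half_eq, coth]
  field_simp

/-- Let X = sinh²(x/2), Y = sinh²(y/2). Multiplication by sinh((x−y)/2) sinh((x+y)/2) = X − Y turns
the left side into ½(sinh² x · A − sinh² y · B). Since sinh² x = 4(X² + X), the squares give P and
the linear terms give Q. -/
lemma coth_pair_eq {x y P Q A B : ℝ} (h1 : x - y ≠ 0) (h2 : x + y ≠ 0)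
    (hP : (Real.sinh (x / 2) ^ 2 - Real.sinh (y / 2) ^ 2) * P =
      (Real.sinh (x / 2) ^ 2) ^ 2 * A - (Real.sinh (y / 2) ^ 2) ^ 2 * B)
    (hQ : (Real.sinh (x / 2) ^ 2 - Real.sinh (y / 2) ^ 2) * Q =
      Real.sinh (x / 2) ^ 2 * A - Real.sinh (y / 2) ^ 2 * B) :
    coth ((x - y) / 2) * (Real.sinh x / 2 * A - Real.sinh y / 2 * B) +
      coth ((x + y) / 2) * (Real.sinh x / 2 * A + Real.sinh y / 2 * B) = 2 * P + 2 * Q := by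
  have hs1 : Real.sinh ((x - y) / 2) ≠ 0 := by
    rw [Ne, Real.sinh_eq_zero]; intro h; exact h1 (by linarith)
  have hs2 : Real.sinh ((x + y) / 2) ≠ 0 := by
    rw [Ne, Real.sinh_eq_zero]; intro h; exact h2 (by linarith)
  have hx : Real.sinh x = 2 * Real.sinh (x / 2) * Real.cosh (x / 2) := by
    rw [← Real.sinh_two_mul]; ring_nf
  have hy : Real.sinh y = 2 * Real.sinh (y / 2) * Real.cosh (y / 2) := by
    rw [← Real.sinh_two_mul]; ring_nf
  have e1 : Real.sinh ((x - y) / 2) = Real.sinh (x / 2) * Real.cosh (y / 2) -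
      Real.cosh (x / 2) * Real.sinh (y / 2) := by rw [sub_div, Real.sinh_sub]
  have e2 : Real.sinh ((x + y) / 2) = Real.sinh (x / 2) * Real.cosh (y / 2) +
      Real.cosh (x / 2) * Real.sinh (y / 2) := by rw [add_div, Real.sinh_add]
  have e3 : Real.cosh ((x - y) / 2) = Real.cosh (x / 2) * Real.cosh (y / 2) -
      Real.sinh (x / 2) * Real.sinh (y / 2) := by rw [sub_div, Real.cosh_sub]
  have e4 : Real.cosh ((x + y) / 2) = Real.cosh (x / 2) * Real.cosh (y / 2) +
      Real.sinh (x / 2) * Real.sinh (y / 2) := by rw [add_div, Real.cosh_add]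
  have hprod : Real.sinh ((x - y) / 2) * Real.sinh ((x + y) / 2) =
      Real.sinh (x / 2) ^ 2 - Real.sinh (y / 2) ^ 2 := by
    rw [e1, e2]
    linear_combination Real.sinh (x / 2) ^ 2 * Real.cosh_sq (y / 2) -
      Real.sinh (y / 2) ^ 2 * Real.cosh_sq (x / 2)
  have hsum : Real.cosh ((x - y) / 2) * Real.sinh ((x + y) / 2) +
      Real.cosh ((x + y) / 2) * Real.sinh ((x - y) / 2) = Real.sinh x := by
    rw [add_comm, mul_comm, ← Real.sinh_add]; ring_nf
  have hdiff : Real.cosh ((x - y) / 2) * Real.sinh ((x + y) / 2) -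
      Real.cosh ((x + y) / 2) * Real.sinh ((x - y) / 2) = Real.sinh y := by
    have : Real.sinh y = Real.sinh ((x + y) / 2 - (x - y) / 2) := by ring_nf
    rw [this, Real.sinh_sub]; ring
  have hne : Real.sinh ((x - y) / 2) * Real.sinh ((x + y) / 2) ≠ 0 := mul_ne_zero hs1 hs2
  refine mul_left_cancel₀ hne ?_
  have hL : Real.sinh ((x - y) / 2) * Real.sinh ((x + y) / 2) *
      (coth ((x - y) / 2) * (Real.sinh x / 2 * A - Real.sinh y / 2 * B) +
      coth ((x + y) / 2) * (Real.sinh x / 2 * A + Real.sinh y / 2 * B)) =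
      Real.sinh x * (Real.sinh x / 2 * A) - Real.sinh y * (Real.sinh y / 2 * B) := by
    rw [coth, coth]
    field_simp
    linear_combination (A * Real.sinh x) * hsum - (B * Real.sinh y) * hdiff
  rw [hL, hprod]
  linear_combination 2 * A * sinh_half_sq_eq x - 2 * B * sinh_half_sq_eq y - 2 * hP - 2 * hQ

-- With u = sinh²(x/2) one has u'² = u² + u, u'' = u + 1/2, coth(x/2) u' = u + 1 and 2 coth(x) u' =
-- 2u + 1. The short and long roots therefore contribute (k₁ + 2k₂) u + (k₁ + k₂) as coefficient of
-- ∂_i, and `coth_pair_eq` treats the pairs.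
open MvPolynomial in
lemma jacobiOperator_bcFun (k₁ k₂ k₃ : ℝ) {f : MvPolynomial (Fin n) ℝ} (hf : f.IsSymmetric)
    (t : EuclideanSpace ℝ (Fin n)) (ht : ∀ i, ⟪bcRoot n i, t⟫_ℝ ≠ 0) :
    jacobiOperator (bcRoot n) (bcMult n k₁ k₂ k₃) (bcFun n f) t =
      bcFun n (bcOp n k₁ k₂ k₃ f) t := by
  have ht0 : ∀ i, t i ≠ 0 := fun i => by
    simpa [bcRoot] using ht (Sum.inl (Sum.inl i))
  have htsub : ∀ p : Pairs n, t p.1.1 - t p.1.2 ≠ 0 := fun p => by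
    simpa [bcRoot, inner_sub_left] using ht (Sum.inr (Sum.inl p))
  have htadd : ∀ p : Pairs n, t p.1.1 + t p.1.2 ≠ 0 := fun p => by
    simpa [bcRoot, inner_add_left] using ht (Sum.inr (Sum.inr p))
  set A : Fin n → ℝ := fun i => bcFun n (pderiv i f) t with hA
  have hfd : ∀ v, fderiv ℝ (bcFun n f) t v = ∑ l, Real.sinh (t l) / 2 * A l * v l := fun v => by
    rw [bcFun, fderiv_polyFun hasDerivAt_sinh_half_sq]
    simp only [inner_stdVec_left]
    rfl
  have hstd : ∀ i, fderiv ℝ (bcFun n f) t (stdVec i) = Real.sinh (t i) / 2 * A i := fun i => by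
    rw [hfd]; simp [PiLp.single_apply]
  have hlap : Δ (bcFun n f) t = ∑ i, ((Real.sinh (t i / 2) ^ 2 + 1 / 2) * A i +
      ((Real.sinh (t i / 2) ^ 2) ^ 2 + Real.sinh (t i / 2) ^ 2) *
        bcFun n (pderiv i (pderiv i f)) t) := by
    rw [bcFun, laplacian_polyFun hasDerivAt_sinh_half_sq
      fun x => (Real.hasDerivAt_sinh x).div_const 2]
    refine sum_congr rfl fun i _ => ?_
    simp only [inner_stdVec_left, PiLp.single_apply, ite_mul, one_mul, zero_mul, sum_ite_eq,
      mem_univ, if_true, cosh_half_eq, ← pow_two, sinh_half_sq_eq]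
    rfl
  have hpair : ∀ p : Pairs n,
      coth ((t p.1.1 - t p.1.2) / 2) *
        (Real.sinh (t p.1.1) / 2 * A p.1.1 - Real.sinh (t p.1.2) / 2 * A p.1.2) +
      coth ((t p.1.1 + t p.1.2) / 2) *
        (Real.sinh (t p.1.1) / 2 * A p.1.1 + Real.sinh (t p.1.2) / 2 * A p.1.2) =
      2 * bcFun n (pairOp 2 p.1.1 p.1.2 f) t + 2 * bcFun n (pairOp 1 p.1.1 p.1.2 f) t := by
    intro p
    have key := fun e => congrArg (fun g => bcFun n g t) (sub_mul_pairOp p.2.ne e hf)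
    refine coth_pair_eq (htsub p) (htadd p) ?_ ?_
    · simpa only [bcFun_apply, map_mul, map_sub, map_pow, eval_X, hA] using key 2
    · simpa only [bcFun_apply, map_mul, map_sub, map_pow, eval_X, hA, pow_one] using key 1
  have hX : ∀ i g, bcFun n (X i * g) t = Real.sinh (t i / 2) ^ 2 * bcFun n g t := fun i g => by
    simp only [bcFun_apply, map_mul, eval_X]
  have hX2 : ∀ i g, bcFun n (X i ^ 2 * g) t = (Real.sinh (t i / 2) ^ 2) ^ 2 * bcFun n g t :=
    fun i g => by simp only [bcFun_apply, map_mul, map_pow, eval_X]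
  rw [jacobiOperator, sum_bcIndex, hlap, bcOp_apply, topOp_apply, lowOp_apply, eulerOp_apply,
    gradOp_apply]
  simp only [bcRoot, bcMult, Sum.elim_inl, Sum.elim_inr, inner_add_left, inner_sub_left,
    inner_smul_left, inner_stdVec_left, conj_trivial, map_add, map_sub, map_smul, map_sum, hstd,
    Pi.add_apply, Finset.sum_apply, Pi.smul_apply, smul_eq_mul, hX, hX2,
    mul_div_cancel_left₀ _ (two_ne_zero : (2 : ℝ) ≠ 0)]
  have s1 : ∀ i, k₁ * coth (t i / 2) * (Real.sinh (t i) / 2 * A i) =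
      k₁ * ((Real.sinh (t i / 2) ^ 2 + 1) * A i) := fun i => by
    rw [← coth_half_mul (ht0 i)]; ring
  have s2 : ∀ i, k₂ * coth (t i) * (2 * (Real.sinh (t i) / 2 * A i)) =
      k₂ * ((2 * Real.sinh (t i / 2) ^ 2 + 1) * A i) := fun i => by
    linear_combination 2 * k₂ * A i * coth_mul (ht0 i)
  rw [sum_congr rfl fun i _ => s1 i, sum_congr rfl fun i _ => s2 i, ← sum_add_distrib (s := (univ : Finset (Pairs n)))]
  have s3 : ∑ p : Pairs n, (k₃ * coth ((t p.1.1 - t p.1.2) / 2) *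
        (Real.sinh (t p.1.1) / 2 * A p.1.1 - Real.sinh (t p.1.2) / 2 * A p.1.2) +
      k₃ * coth ((t p.1.1 + t p.1.2) / 2) *
        (Real.sinh (t p.1.1) / 2 * A p.1.1 + Real.sinh (t p.1.2) / 2 * A p.1.2)) =
      2 * k₃ * ∑ p : Pairs n, bcFun n (pairOp 2 p.1.1 p.1.2 f) t +
      2 * k₃ * ∑ p : Pairs n, bcFun n (pairOp 1 p.1.1 p.1.2 f) t := by
    rw [mul_sum, mul_sum, ← sum_add_distrib]
    exact sum_congr rfl fun p _ => by linear_combination k₃ * hpair p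
  rw [s3]
  have s4 : ∑ i, ((Real.sinh (t i / 2) ^ 2 + 1 / 2) * A i +
      ((Real.sinh (t i / 2) ^ 2) ^ 2 + Real.sinh (t i / 2) ^ 2) *
        bcFun n (pderiv i (pderiv i f)) t) +
      (∑ i, k₁ * ((Real.sinh (t i / 2) ^ 2 + 1) * A i) +
        ∑ i, k₂ * ((2 * Real.sinh (t i / 2) ^ 2 + 1) * A i)) =
      ∑ i, ((Real.sinh (t i / 2) ^ 2) ^ 2 * bcFun n (pderiv i (pderiv i f)) t +
        Real.sinh (t i / 2) ^ 2 * A i) +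
      (k₁ + 2 * k₂) * ∑ i, Real.sinh (t i / 2) ^ 2 * A i +
      ∑ i, (Real.sinh (t i / 2) ^ 2 * bcFun n (pderiv i (pderiv i f)) t + 1 / 2 * A i) +
      (k₁ + k₂) * ∑ i, A i := by
    simp only [mul_sum, ← sum_add_distrib]
    exact sum_congr rfl fun i _ => by ring
  linear_combination s4

lemma bcFun_injective {f : MvPolynomial (Fin n) ℝ}
    (h : ∀ t, (∀ i, ⟪bcRoot n i, t⟫_ℝ ≠ 0) → bcFun n f t = 0) : f = 0 := by
  refine eq_zero_of_eval_eq_zero fun x hx hinj => ?_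
  -- This inverts x = sinh²(t/2); distinct positive x_i give a point off all root hyperplanes.
  let t : EuclideanSpace ℝ (Fin n) := WithLp.toLp 2 fun i => 2 * Real.arsinh (√(x i))
  have ht : ∀ i, t i = 2 * Real.arsinh (√(x i)) := fun i => rfl
  have hpos : ∀ i, 0 < t i := fun i => by
    rw [ht]; exact mul_pos two_pos (Real.arsinh_pos_iff.mpr (Real.sqrt_pos.mpr (hx i)))
  have hsinh : ∀ i, Real.sinh (t i / 2) ^ 2 = x i := fun i => by
    rw [ht, mul_div_cancel_left₀ _ two_ne_zero, Real.sinh_arsinh, Real.sq_sqrt (hx i).le]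
  have hne : ∀ p : Pairs n, t p.1.1 ≠ t p.1.2 := fun p h' =>
    p.2.ne (hinj (by rw [← hsinh, ← hsinh, h']))
  have := h t ?_
  · rw [bcFun_apply] at this
    simpa only [hsinh] using this
  · rintro ((i | i) | (p | p))
    · simpa [bcRoot] using (hpos i).ne'
    · simpa [bcRoot, inner_smul_left] using (hpos i).ne'
    · simpa [bcRoot, inner_sub_left, sub_eq_zero] using hne p
    · simpa [bcRoot, inner_add_left] using (add_pos (hpos p.1.1) (hpos p.1.2)).ne'

lemma isTriangular_bcOp (k₁ k₂ k₃ : ℝ) (lam : Fin n → ℕ) :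
    IsTriangular (dominated lam) (bcOp n k₁ k₂ k₃)
      (fun μ => topEigenvalue n k₃ μ + (k₁ + 2 * k₂) * μ.degree) := by
  constructor
  · intro f hf
    obtain ⟨hs, hD⟩ := mem_symmSupp.mp hf
    have hD' : ∀ ν ∈ f.support, ν ∈ dominated lam := fun ν hν =>
      hD ν (MvPolynomial.mem_support_iff.mp hν)
    rw [bcOp_apply]
    refine add_mem (add_mem (add_mem ?_ (Submodule.smul_mem _ _ ?_)) ?_)
      (Submodule.smul_mem _ _ ?_) <;> rw [mem_symmSupp]
    · refine ⟨isSymmetric_topOp k₃ hs, fun μ hμ => ?_⟩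
      obtain ⟨ν, hν, i, j, hm, -⟩ := exists_move_of_coeff_topOp_ne_zero hμ
      exact hm.mem_dominated (hD' ν hν)
    · refine ⟨isSymmetric_eulerOp hs, fun μ hμ => hD μ ?_⟩
      rw [coeff_eulerOp] at hμ
      exact right_ne_zero_of_mul hμ
    · refine ⟨isSymmetric_lowOp k₃ hs, fun μ hμ => ?_⟩
      obtain ⟨ν, hν, i, j, hm, -⟩ := lowOp_degree hμ
      exact hm.mem_dominated (hD' ν hν)
    · refine ⟨isSymmetric_gradOp hs, fun μ hμ => ?_⟩
      obtain ⟨ν, hν, i, j, hm, -⟩ := gradOp_degree hμ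
      exact hm.mem_dominated (hD' ν hν)
  · intro f hf μ _ hμ hmax
    have hs := (mem_symmSupp.mp hf).1
    rw [bcOp_apply, MvPolynomial.coeff_add, MvPolynomial.coeff_add, MvPolynomial.coeff_add,
      MvPolynomial.coeff_smul, MvPolynomial.coeff_smul, coeff_topOp k₃ hs hμ hmax,
      coeff_lowOp k₃ hs hmax, coeff_gradOp hmax, coeff_eulerOp]
    simp only [smul_eq_mul]
    ring

lemma isModel_bc (k₁ k₂ k₃ : ℝ) {lam : Fin n →₀ ℕ} (hlam : Antitone lam) :
    IsModel (bcRoot n) (bcMult n k₁ k₂ k₃) (dominated lam) (bcOp n k₁ k₂ k₃)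
      (fun μ => topEigenvalue n k₃ μ + (k₁ + 2 * k₂) * μ.degree) rankOnePoly
      (fun μ => toVec μ) (bcFun n) lam where
  finite := finite_dominated _
  mem := by simpa using self_mem_dominated hlam
  anti := hlam
  max := fun ν hν => by simpa using weight_le_of_mem_dominated hν
  triangular := isTriangular_bcOp k₁ k₂ k₃ _
  natDegree_le := rankOnePoly_natDegree
  coeff_ne_zero := rankOnePoly_coeff
  orbitPoly_mem := fun μ hμ _ => mem_symmSupp.mpr ⟨isSymmetric_orbitPoly _ _, fun ν hν => by
    obtain ⟨ν', hν', hle⟩ := exists_le_of_coeff_orbitPoly_ne_zero rankOnePoly_natDegree hν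
    exact dominated_of_le hle (mem_dominated_of_mem_permOrbit hν' hμ)⟩
  orbit := fun μ _ _ => bcFun_orbitPoly μ
  lower := lowerWeights_bc lam
  op := fun f hf t ht => jacobiOperator_bcFun k₁ k₂ k₃ (mem_symmSupp.mp hf).1 t ht
  inj := fun f _ h => bcFun_injective h
  ev_eq := fun μ _ _ => eigenvalue_bc k₁ k₂ k₃ μ

end TypeBC

/-! ### The root system `A_{n-1}` -/

section TypeA

open Finset

variable {n : ℕ}

lemma sum_coe_sumZero (t : sumZero n) : ∑ i, (t : EuclideanSpace ℝ (Fin n)) i = 0 := t.2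

lemma proj_apply (v : EuclideanSpace ℝ (Fin n)) (i : Fin n) :
    (proj n v : EuclideanSpace ℝ (Fin n)) i = v i - (∑ l, v l) / n := by
  have hn : (n : ℝ) ≠ 0 := by
    have := i.2
    exact_mod_cast (show n ≠ 0 by omega)
  let w : EuclideanSpace ℝ (Fin n) := WithLp.toLp 2 fun i => v i - (∑ l, v l) / n
  have hw : w ∈ sumZero n := by
    change ∑ i, (v i - (∑ l, v l) / n) = 0
    rw [sum_sub_distrib, sum_const, card_univ, Fintype.card_fin, nsmul_eq_mul]
    field_simp
    ring
  have h : (proj n v : EuclideanSpace ℝ (Fin n)) = w := by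
    refine Submodule.eq_starProjection_of_mem_of_inner_eq_zero hw fun u hu => ?_
    have hu : ∑ i, u i = 0 := hu
    rw [PiLp.inner_apply]
    simp [w, ← sum_mul, hu]
  rw [h]

lemma inner_proj_left (v : EuclideanSpace ℝ (Fin n)) (t : sumZero n) :
    ⟪proj n v, t⟫_ℝ = ⟪v, (t : EuclideanSpace ℝ (Fin n))⟫_ℝ := by
  rw [proj, Submodule.inner_orthogonalProjectionOnto_eq_of_mem_right]

lemma inner_proj_stdVec (i : Fin n) (t : sumZero n) :
    ⟪proj n (stdVec i), t⟫_ℝ = (t : EuclideanSpace ℝ (Fin n)) i := by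
  rw [inner_proj_left, inner_stdVec_left]

lemma coe_aRoot (p : Pairs n) :
    (aRoot n p : EuclideanSpace ℝ (Fin n)) = stdVec p.1.1 - stdVec p.1.2 := rfl

lemma inner_aRoot (p : Pairs n) (t : sumZero n) :
    ⟪aRoot n p, t⟫_ℝ = (t : EuclideanSpace ℝ (Fin n)) p.1.1 -
      (t : EuclideanSpace ℝ (Fin n)) p.1.2 := by
  rw [Submodule.coe_inner, coe_aRoot, inner_sub_left, inner_stdVec_left, inner_stdVec_left]

lemma sum_toVec (μ : Fin n →₀ ℕ) : ∑ i, toVec μ i = μ.degree := by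
  simp [toVec_apply, Finsupp.degree_eq_sum]

/-- The projection forgets only multiples of (1, …, 1), which the degree restores. -/
lemma proj_toVec_injective {μ ν : Fin n →₀ ℕ} (hd : μ.degree = ν.degree)
    (h : proj n (toVec μ) = proj n (toVec ν)) : μ = ν := by
  refine Finsupp.ext fun i => ?_
  have : (proj n (toVec μ) : EuclideanSpace ℝ (Fin n)) i =
      (proj n (toVec ν) : EuclideanSpace ℝ (Fin n)) i := by rw [h]
  rw [proj_apply, proj_apply, sum_toVec, sum_toVec, hd, sub_left_inj, toVec_apply,
    toVec_apply] at this
  exact Nat.cast_injective (R := ℝ) this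

lemma reflection_aRoot (p : Pairs n) (x : sumZero n) (l : Fin n) :
    ((Submodule.span ℝ {aRoot n p})ᗮ.reflection x : EuclideanSpace ℝ (Fin n)) l =
      (x : EuclideanSpace ℝ (Fin n)) (Equiv.swap p.1.1 p.1.2 l) := by
  rw [← reflection_stdVec_sub p.2.ne, reflection_span_orthogonal_apply,
    reflection_span_orthogonal_apply]
  rfl

lemma reflection_proj_toVec (p : Pairs n) (ν : Fin n →₀ ℕ) :
    (Submodule.span ℝ {aRoot n p})ᗮ.reflection (proj n (toVec ν)) =
      proj n (toVec ⇑(ν.mapDomain (Equiv.swap p.1.1 p.1.2))) := by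
  refine Subtype.ext ?_
  ext l
  rw [reflection_aRoot, proj_apply, proj_apply, swap_toVec, sum_toVec, sum_toVec,
    degree_of_mem_permOrbit (mapDomain_mem_permOrbit _ (self_mem_permOrbit ν))]

/-- The Weyl orbits of `A_{n-1}` consist of the rearrangements. -/
lemma weylOrbit_aRoot (μ : Fin n →₀ ℕ) :
    weylOrbit (aRoot n) (proj n (toVec μ)) =
      (fun ν : Fin n →₀ ℕ => proj n (toVec ν)) '' (permOrbit μ : Set (Fin n →₀ ℕ)) := by
  refine subset_antisymm (weylOrbit_subset ⟨μ, self_mem_permOrbit μ, rfl⟩ ?_) ?_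
  · rintro p _ ⟨ν, hν, rfl⟩
    exact ⟨_, mapDomain_mem_permOrbit (Equiv.swap p.1.1 p.1.2) hν, (reflection_proj_toVec p ν).symm⟩
  · rintro _ ⟨ν, hν, rfl⟩
    obtain ⟨σ, rfl⟩ := mem_permOrbit.mp hν
    simp only
    induction σ using Equiv.Perm.swap_induction_on with
    | one => simpa using self_mem_weylOrbit _ _
    | swap_mul σ i j hij ih =>
      have ih := ih (mem_permOrbit.mpr ⟨σ, rfl⟩)
      have : ∀ i j : Fin n, i < j →
          proj n (toVec ⇑((μ.mapDomain σ).mapDomain (Equiv.swap i j))) ∈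
            weylOrbit (aRoot n) (proj n (toVec μ)) := by
        intro i j hij
        have h := reflection_mem_weylOrbit ih ⟨(i, j), hij⟩
        rwa [reflection_proj_toVec] at h
      rw [Equiv.Perm.coe_mul, Finsupp.mapDomain_comp]
      rcases lt_or_gt_of_ne hij with h | h
      · exact this i j h
      · rw [Equiv.swap_comm]; exact this j i h

/-- The functions on the hyperplane that are polynomials in the variables `e^{t_i}`. -/
def aFun (n : ℕ) : MvPolynomial (Fin n) ℝ →ₗ[ℝ] (sumZero n → ℝ) :=
  polyFun Real.exp fun i => proj n (stdVec i)

lemma aFun_apply (f : MvPolynomial (Fin n) ℝ) (t : sumZero n) :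
    aFun n f t = MvPolynomial.eval (fun i => Real.exp ((t : EuclideanSpace ℝ (Fin n)) i)) f := by
  rw [aFun, polyFun_apply]
  simp only [inner_proj_stdVec]

lemma aFun_orbitPoly (μ : Fin n →₀ ℕ) :
    aFun n (orbitPoly (fun m => Polynomial.X ^ m) μ) = orbitSum (aRoot n) (proj n (toVec μ)) := by
  ext t
  have hinj : Set.InjOn (fun ν : Fin n →₀ ℕ => proj n (toVec ν)) (permOrbit μ) :=
    fun ν hν ν' hν' h => proj_toVec_injective
      ((degree_of_mem_permOrbit hν).trans (degree_of_mem_permOrbit hν').symm) h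
  rw [orbitSum, weylOrbit_aRoot, finsum_mem_image hinj, finsum_mem_coe_finset, aFun_apply,
    orbitPoly, map_sum]
  refine sum_congr rfl fun ν _ => ?_
  rw [map_prod, inner_proj_left, PiLp.inner_apply, Real.exp_sum]
  refine prod_congr rfl fun i _ => ?_
  simp [toVec_apply, ← Real.exp_nat_mul, mul_comm]

lemma sum_pairs_eq {M : Type*} [AddCommMonoid M] (F : Fin n → Fin n → M) :
    ∑ p : Pairs n, F p.1.1 p.1.2 = ∑ i, ∑ j, if i < j then F i j else 0 := by
  rw [← Fintype.sum_prod_type', ← sum_filter]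
  exact (sum_subtype _ (fun x => by simp) fun x : Fin n × Fin n => F x.1 x.2).symm

lemma sum_pairs_left (g : Fin n → ℝ) :
    ∑ p : Pairs n, g p.1.1 = ∑ j, ∑ i ∈ Iio j, g i := by
  rw [sum_pairs_eq fun i _ => g i, sum_comm]
  refine sum_congr rfl fun j _ => ?_
  rw [← sum_filter]
  exact sum_congr (by ext; simp) fun _ _ => rfl

/-- Each index belongs to n − 1 pairs. -/
lemma sum_pairs_add (g : Fin n → ℝ) :
    ∑ p : Pairs n, (g p.1.1 + g p.1.2) = (n - 1) * ∑ i, g i := by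
  have h2 : ∑ p : Pairs n, g p.1.2 = ∑ j, ∑ i ∈ Ioi j, g i := by
    rw [sum_pairs_eq fun _ j => g j]
    refine sum_congr rfl fun j _ => ?_
    rw [← sum_filter]
    exact sum_congr (by ext; simp) fun _ _ => rfl
  rw [sum_add_distrib, sum_pairs_left, h2, ← sum_add_distrib]
  have h3 : ∀ j, ∑ i ∈ Iio j, g i + ∑ i ∈ Ioi j, g i = ∑ i, g i - g j := by
    intro j
    rw [← sum_union (by
      rw [Finset.disjoint_left]; intro i hi hi'
      exact lt_asymm (mem_Iio.mp hi) (mem_Ioi.mp hi')), eq_sub_iff_add_eq,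
      ← sum_erase_add univ g (mem_univ j)]
    congr 1
    refine sum_congr ?_ fun _ _ => rfl
    ext i
    simp [lt_or_lt_iff_ne]
  rw [sum_congr rfl fun j _ => h3 j, sum_sub_distrib, sum_const, card_univ, Fintype.card_fin,
    nsmul_eq_mul]
  ring

/-- The difference between the `A_{n-1}` operator and `topOp` in degree `d`. -/
def aShift (n : ℕ) (k : ℝ) (d : ℕ) : ℝ := (d : ℝ) ^ 2 / n + k * (n - 1) * d

lemma inner_proj_toVec_self (μ : Fin n →₀ ℕ) :
    ⟪proj n (toVec μ), proj n (toVec μ)⟫_ℝ = ∑ i, (μ i : ℝ) ^ 2 - (μ.degree : ℝ) ^ 2 / n := by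
  rw [inner_proj_left, PiLp.inner_apply]
  simp only [proj_apply, RCLike.inner_apply, conj_trivial, sub_mul, toVec_apply,
    sum_sub_distrib, ← mul_sum, ← pow_two]
  rw [Finsupp.degree_eq_sum]
  push_cast
  ring

lemma inner_proj_toVec_aRoot (μ : Fin n →₀ ℕ) (p : Pairs n) :
    ⟪proj n (toVec μ), aRoot n p⟫_ℝ = μ p.1.1 - μ p.1.2 := by
  rw [inner_proj_left, coe_aRoot, inner_sub_right, inner_stdVec_right, inner_stdVec_right,
    toVec_apply, toVec_apply]

/-- The projection removes |μ|²/n from the square norm. Writing μ_i − μ_j = 2μ_i − (μ_i + μ_j) and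
summing over pairs yields the remaining term k(n − 1)|μ| of `aShift`. -/
lemma eigenvalue_a (k : ℝ) (μ : Fin n →₀ ℕ) :
    eigenvalue (aRoot n) (aMult n k) (proj n (toVec μ)) =
      topEigenvalue n k μ - aShift n k μ.degree := by
  have h := sum_pairs_add fun i => (μ i : ℝ)
  rw [eigenvalue_eq, inner_proj_toVec_self, topEigenvalue, aShift]
  simp only [inner_proj_toVec_aRoot, aMult, ← mul_sum, sum_sub_distrib]
  rw [sum_add_distrib] at h
  rw [Finsupp.degree_eq_sum]
  push_cast
  linear_combination (-k) * h

/-- The exponents of degree `∑ lam i` dominated by `lam`. -/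
def homDominated (lam : Fin n →₀ ℕ) : Set (Fin n →₀ ℕ) :=
  {ν | ν ∈ dominated lam ∧ ν.degree = lam.degree}

lemma inner_aRoot_self (p : Pairs n) : ⟪aRoot n p, aRoot n p⟫_ℝ = 2 := by
  rw [inner_aRoot, coe_aRoot]
  simp [p.2.ne, p.2.ne']
  norm_num

lemma mem_closure_aRoot_iff {y : sumZero n} :
    y ∈ AddSubmonoid.closure (Set.range (aRoot n)) ↔ (y : EuclideanSpace ℝ (Fin n)) ∈
      AddSubmonoid.closure (Set.range fun p : Pairs n =>
        (stdVec p.1.1 - stdVec p.1.2 : EuclideanSpace ℝ (Fin n))) := by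
  have h := AddMonoidHom.map_mclosure (sumZero n).subtype.toAddMonoidHom (Set.range (aRoot n))
  rw [← Set.range_comp] at h
  have h' : (⇑(sumZero n).subtype.toAddMonoidHom ∘ aRoot n) = fun p : Pairs n =>
      (stdVec p.1.1 - stdVec p.1.2 : EuclideanSpace ℝ (Fin n)) := rfl
  rw [h'] at h
  rw [← h]
  constructor
  · intro hy; exact ⟨y, hy, rfl⟩
  · rintro ⟨z, hz, hzy⟩
    rwa [← Subtype.ext (show (z : EuclideanSpace ℝ (Fin n)) = y from hzy)]

lemma weightLE_a {lam μ : Fin n →₀ ℕ} (hμ : μ ∈ homDominated lam) :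
    weightLE (aRoot n) (proj n (toVec μ)) (proj n (toVec lam)) := by
  have hk : ∀ k : Fin n, ∑ i ∈ Iic k, μ i ≤ ∑ i ∈ Iic k, lam i := fun k => by
    have := hμ.1 (Iic k)
    rwa [filter_lt_card_Iic] at this
  rw [weightLE, mem_closure_aRoot_iff]
  have e0 : ((proj n (toVec lam) - proj n (toVec μ) : sumZero n) : EuclideanSpace ℝ (Fin n)) =
      toVec lam - toVec μ := by
    ext i
    rw [Submodule.coe_sub, PiLp.sub_apply, proj_apply, proj_apply, sum_toVec, sum_toVec, hμ.2,
      PiLp.sub_apply]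
    ring
  rw [e0, eq_sum_partial_smul (toVec lam - toVec μ)]
  refine sum_mem fun k _ => ?_
  have e : ∑ i ∈ Iic k, (toVec lam - toVec μ) i =
      ((∑ i ∈ Iic k, lam i - ∑ i ∈ Iic k, μ i : ℕ) : ℝ) := by
    rw [Nat.cast_sub (hk k)]
    simp [toVec_apply, sum_sub_distrib]
  rw [e, Nat.cast_smul_eq_nsmul]
  split_ifs with h
  · exact nsmul_mem (AddSubmonoid.subset_closure
      (Set.mem_range_self (⟨(k, ⟨k.val + 1, h⟩), by simp [Fin.lt_def]⟩ : Pairs n))) _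
  -- The last basis vector is not a root of the hyperplane; its coefficient is the difference of the
  -- degrees, which is zero.
  · have hIic : Iic k = univ := by
      ext i
      have := i.2
      simp only [mem_Iic, mem_univ, iff_true, Fin.le_def]
      omega
    have : ∑ i ∈ Iic k, lam i - ∑ i ∈ Iic k, μ i = 0 := by
      have := hμ.2
      rw [Finsupp.degree_eq_sum, Finsupp.degree_eq_sum] at this
      rw [hIic, this, Nat.sub_self]
    rw [this, zero_smul]
    exact zero_mem _

/-- With y = π(λ) − x, the lift of x is λ − y. It is integral because y is, and antitone because x
is dominant. The last coordinate of a sum of positive roots is ≤ 0, so the last entry of λ − y, and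
hence every entry, is nonnegative. -/
lemma exists_of_mem_lowerWeights_a {lam : Fin n →₀ ℕ} {x : sumZero n}
    (hdom : x ∈ dominantWeights (aRoot n)) (hle : weightLE (aRoot n) x (proj n (toVec lam))) :
    ∃ μ ∈ homDominated lam, Antitone μ ∧ proj n (toVec μ) = x := by
  set y : sumZero n := proj n (toVec lam) - x with hy
  have hcl : (y : EuclideanSpace ℝ (Fin n)) ∈ AddSubmonoid.closure (Set.range fun p : Pairs n =>
      (stdVec p.1.1 - stdVec p.1.2 : EuclideanSpace ℝ (Fin n))) := mem_closure_aRoot_iff.mp hle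
  have hprop : (∀ i, ∃ z : ℤ, (y : EuclideanSpace ℝ (Fin n)) i = z) ∧
      (∀ k, 0 ≤ ∑ i ∈ Iic k, (y : EuclideanSpace ℝ (Fin n)) i) ∧
      (∀ l : Fin n, (∀ i, i ≤ l) → (y : EuclideanSpace ℝ (Fin n)) l ≤ 0) := by
    refine AddSubmonoid.closure_induction (motive := fun (v : EuclideanSpace ℝ (Fin n)) _ =>
      (∀ i, ∃ z : ℤ, v i = z) ∧ (∀ k, 0 ≤ ∑ i ∈ Iic k, v i) ∧
      (∀ l : Fin n, (∀ i, i ≤ l) → v l ≤ 0)) ?_ ?_ ?_ hcl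
    · rintro _ ⟨p, rfl⟩
      refine ⟨fun i => ⟨(if i = p.1.1 then 1 else 0) - (if i = p.1.2 then 1 else 0), ?_⟩,
        fun k => sum_Iic_stdVec_sub_nonneg p.2 k, fun l hl => ?_⟩
      · simp [PiLp.single_apply]
      · have : l ≠ p.1.1 := fun h => absurd (hl p.1.2) (not_le.mpr (h ▸ p.2))
        simp only [PiLp.sub_apply, PiLp.single_apply, this, if_false]
        split_ifs <;> norm_num
    · exact ⟨fun i => ⟨0, by simp⟩, fun k => by simp, fun l _ => by simp⟩
    · rintro v w _ _ ⟨h1, h2, h3⟩ ⟨h1', h2', h3'⟩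
      refine ⟨fun i => ?_, fun k => ?_, fun l hl => ?_⟩
      · obtain ⟨a, ha⟩ := h1 i
        obtain ⟨b, hb⟩ := h1' i
        exact ⟨a + b, by simp [ha, hb]⟩
      · simpa [sum_add_distrib] using add_nonneg (h2 k) (h2' k)
      · simpa using add_nonpos (h3 l hl) (h3' l hl)
  obtain ⟨h1, h2, h3⟩ := hprop
  choose z hz using h1
  have hx : ∀ i, (x : EuclideanSpace ℝ (Fin n)) i =
      lam i - (lam.degree : ℝ) / n - z i := fun i => by
    have : (x : EuclideanSpace ℝ (Fin n)) i = (proj n (toVec lam) : EuclideanSpace ℝ (Fin n)) i -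
        (y : EuclideanSpace ℝ (Fin n)) i := by
      rw [hy, Submodule.coe_sub, PiLp.sub_apply]; ring
    rw [this, proj_apply, sum_toVec, hz, toVec_apply]
  have hanti : ∀ i j : Fin n, i ≤ j → (lam j : ℤ) - z j ≤ lam i - z i := by
    intro i j hij
    rcases hij.eq_or_lt with rfl | hlt
    · exact le_rfl
    obtain ⟨m, hm⟩ := hdom ⟨(i, j), hlt⟩
    rw [inner_aRoot_self, real_inner_comm, inner_aRoot] at hm
    simp only [hx] at hm
    have h0 : (0 : ℝ) ≤ m := Nat.cast_nonneg m
    have : ((lam j : ℤ) - z j : ℝ) ≤ (lam i : ℤ) - z i := by push_cast; linarith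
    exact_mod_cast this
  have hnonneg : ∀ i, 0 ≤ (lam i : ℤ) - z i := by
    intro i
    have hn : 0 < n := by have := i.2; omega
    let l : Fin n := ⟨n - 1, by omega⟩
    have hl : ∀ i : Fin n, i ≤ l := fun i => by
      have := i.2; simp only [l, Fin.le_def]; omega
    refine le_trans ?_ (hanti i l (hl i))
    have := h3 l hl
    rw [hz] at this
    have : z l ≤ 0 := Int.cast_nonpos.mp this
    omega
  let μ : Fin n →₀ ℕ := Finsupp.equivFunOnFinite.symm fun i => ((lam i : ℤ) - z i).toNat
  have hμ : ∀ i, (μ i : ℤ) = lam i - z i := fun i => Int.toNat_of_nonneg (hnonneg i)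
  have hμ' : ∀ i, (μ i : ℝ) = lam i - z i := fun i => by exact_mod_cast hμ i
  have hanti' : Antitone μ := fun i j hij => by
    have := hanti i j hij
    have h1 := hμ i
    have h2 := hμ j
    omega
  have hsum : ∑ i, (z i : ℝ) = 0 := by
    rw [← sum_coe_sumZero y]; exact sum_congr rfl fun i _ => (hz i).symm
  have hdeg : μ.degree = lam.degree := by
    have : (∑ i, (μ i : ℝ)) = ∑ i, (lam i : ℝ) := by
      simp only [hμ', sum_sub_distrib, hsum, sub_zero]
    rw [Finsupp.degree_eq_sum, Finsupp.degree_eq_sum]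
    exact_mod_cast this
  refine ⟨μ, ⟨(mem_dominated_iff_of_antitone hanti').mpr fun k => ?_, hdeg⟩, hanti', ?_⟩
  · have h2 := h2 k
    simp only [hz] at h2
    have : (∑ i ∈ Iic k, (μ i : ℝ)) ≤ ∑ i ∈ Iic k, (lam i : ℝ) := by
      simp only [hμ', sum_sub_distrib]; linarith
    exact_mod_cast this
  · refine Subtype.ext ?_
    ext i
    rw [proj_apply, sum_toVec, hdeg, hx, toVec_apply, hμ']
    ring

lemma proj_toVec_mem_dominantWeights {μ : Fin n →₀ ℕ} (hμ : Antitone μ) :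
    proj n (toVec μ) ∈ dominantWeights (aRoot n) := fun p => ⟨μ p.1.1 - μ p.1.2, by
  rw [inner_proj_toVec_aRoot, inner_aRoot_self, Nat.cast_sub (hμ p.2.le)]
  ring⟩

lemma lowerWeights_a (lam : Fin n →₀ ℕ) :
    lowerWeights (aRoot n) (proj n (toVec lam)) =
      (fun μ : Fin n →₀ ℕ => proj n (toVec μ)) ''
        {μ | μ ∈ homDominated lam ∧ Antitone μ ∧ μ ≠ lam} := by
  ext x
  constructor
  · rintro ⟨hx, hle, hne⟩
    obtain ⟨μ, h1, h2, rfl⟩ := exists_of_mem_lowerWeights_a hx hle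
    exact ⟨μ, ⟨h1, h2, by rintro rfl; exact hne rfl⟩, rfl⟩
  · rintro ⟨μ, ⟨h1, h2, h3⟩, rfl⟩
    exact ⟨proj_toVec_mem_dominantWeights h2, weightLE_a h1,
      fun h => h3 (proj_toVec_injective h1.2 h)⟩

/-- For nonnegative multiplicity the eigenvalues are strictly increasing. -/
lemma nondegenerate_of_nonneg {k : ℝ} (hk : 0 ≤ k) (lam : Fin n →₀ ℕ) :
    Nondegenerate (aRoot n) (aMult n k) (proj n (toVec lam)) := by
  intro x hx
  rw [lowerWeights_a] at hx
  obtain ⟨μ, ⟨h1, h2, h3⟩, rfl⟩ := hx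
  have hle := weightLE_a h1
  rw [weightLE] at hle
  set y := proj n (toVec lam) - proj n (toVec μ) with hy
  -- Since μ is dominant and y is a sum of positive roots, |π(λ)|² ≥ |π(μ)|² + |y|², which is strict
  -- growth.
  have hinner : 0 ≤ ⟪proj n (toVec μ), y⟫_ℝ := by
    refine AddSubmonoid.closure_induction
      (motive := fun v _ => 0 ≤ ⟪proj n (toVec μ), v⟫_ℝ) ?_ ?_ ?_ hle
    · rintro _ ⟨p, rfl⟩
      rw [inner_proj_toVec_aRoot, sub_nonneg]
      exact_mod_cast h2 p.2.le
    · simp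
    · intro v w _ _ hv hw
      rw [inner_add_right]; exact add_nonneg hv hw
  have hy0 : y ≠ 0 := fun h => h3 (proj_toVec_injective h1.2 (sub_eq_zero.mp h).symm)
  have hpos : 0 < ⟪y, y⟫_ℝ := real_inner_self_pos.mpr hy0
  have hlam : proj n (toVec lam) = proj n (toVec μ) + y := by rw [hy]; abel
  have hsq : ⟪proj n (toVec μ), proj n (toVec μ)⟫_ℝ <
      ⟪proj n (toVec lam), proj n (toVec lam)⟫_ℝ := by
    rw [hlam, inner_add_left, inner_add_right, inner_add_right, real_inner_comm y]
    linarith [real_inner_comm y (proj n (toVec μ))]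
  rw [inner_proj_toVec_self, inner_proj_toVec_self, h1.2] at hsq
  -- The coefficient of 2k is a sum of partial sums, so it is monotone in the dominance order.
  have hpair : ∑ p : Pairs n, (μ p.1.1 : ℝ) ≤ ∑ p : Pairs n, (lam p.1.1 : ℝ) := by
    rw [sum_pairs_left fun i => (μ i : ℝ), sum_pairs_left fun i => (lam i : ℝ)]
    refine sum_le_sum fun j _ => ?_
    have := h1.1 (Iio j)
    have e : (univ.filter fun i : Fin n => i.val < #(Iio j)) = Iio j := by
      ext i
      simp only [mem_filter, mem_univ, true_and, Fin.card_Iio, mem_Iio]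
      rfl
    rw [e] at this
    exact_mod_cast this
  rw [eigenvalue_a, eigenvalue_a, h1.2, topEigenvalue, topEigenvalue]
  have := mul_le_mul_of_nonneg_left hpair (by positivity : 0 ≤ 2 * k)
  apply ne_of_lt
  linarith

lemma eulerOp_of_degree {f : MvPolynomial (Fin n) ℝ} {d : ℕ}
    (h : ∀ ν, MvPolynomial.coeff ν f ≠ 0 → ν.degree = d) : eulerOp n f = (d : ℝ) • f := by
  ext ν
  rw [coeff_eulerOp, MvPolynomial.coeff_smul, smul_eq_mul]
  by_cases h0 : MvPolynomial.coeff ν f = 0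
  · simp [h0]
  · rw [h ν h0]

lemma eval_mul_of_degree {f : MvPolynomial (Fin n) ℝ} {d : ℕ}
    (h : ∀ ν, MvPolynomial.coeff ν f ≠ 0 → ν.degree = d) (c : ℝ) (z : Fin n → ℝ) :
    MvPolynomial.eval (fun i => c * z i) f = c ^ d * MvPolynomial.eval z f := by
  rw [MvPolynomial.eval_eq', MvPolynomial.eval_eq', mul_sum]
  refine sum_congr rfl fun ν hν => ?_
  simp only [mul_pow, prod_mul_distrib, prod_pow_eq_pow_sum, ← Finsupp.degree_eq_sum,
    h ν (MvPolynomial.mem_support_iff.mp hν)]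
  ring

/-- The operator on symmetric polynomials of degree `d` that corresponds to the `A_{n-1}`
operator. -/
def aOp (n : ℕ) (k : ℝ) (d : ℕ) : MvPolynomial (Fin n) ℝ →ₗ[ℝ] MvPolynomial (Fin n) ℝ :=
  topOp n k - aShift n k d • LinearMap.id

lemma aOp_apply (k : ℝ) (d : ℕ) (f : MvPolynomial (Fin n) ℝ) :
    aOp n k d f = topOp n k f - aShift n k d • f := rfl

/-- With X = e^x, Y = e^y, coth((x−y)/2) = (X + Y)/(X − Y), and (X + Y)(XA − YB) = 2(X²A − Y²B) − (X
− Y)(XA + YB). -/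
lemma coth_half_sub_eq {x y P A B : ℝ} (h : x - y ≠ 0)
    (hP : (Real.exp x - Real.exp y) * P = Real.exp x ^ 2 * A - Real.exp y ^ 2 * B) :
    coth ((x - y) / 2) * (Real.exp x * A - Real.exp y * B) =
      2 * P - (Real.exp x * A + Real.exp y * B) := by
  have hne : Real.exp x - Real.exp y ≠ 0 := fun h' => h (by
    rw [Real.exp_injective (sub_eq_zero.mp h'), sub_self])
  have hs : Real.sinh ((x - y) / 2) ≠ 0 := by
    rw [Ne, Real.sinh_eq_zero]; intro h'; exact h (by linarith)
  have e1 : Real.exp ((x - y) / 2) * Real.exp (-((x - y) / 2)) = 1 := by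
    rw [← Real.exp_add]; simp
  have e2 : Real.exp x = Real.exp y * Real.exp ((x - y) / 2) ^ 2 := by
    rw [← Real.exp_nat_mul, ← Real.exp_add]; ring_nf
  have hcoth : (Real.exp x - Real.exp y) * coth ((x - y) / 2) = Real.exp x + Real.exp y := by
    rw [coth, ← mul_div_assoc, div_eq_iff hs, Real.sinh_eq, Real.cosh_eq, e2]
    linear_combination (Real.exp y * Real.exp ((x - y) / 2)) * e1
  refine mul_left_cancel₀ hne ?_
  linear_combination (Real.exp x * A - Real.exp y * B) * hcoth - 2 * hP

-- The projected basis vectors have inner products δ_{il} − 1/n, so the Laplacian of the hyperplane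
-- is the full one minus E²/n; the pairs contribute an extra −k(n − 1)E. On degree d Euler's
-- operator E is the scalar d, and both corrections combine to `aShift`.
open MvPolynomial in
lemma jacobiOperator_aFun (k : ℝ) {f : MvPolynomial (Fin n) ℝ} (hf : f.IsSymmetric) {d : ℕ}
    (hd : ∀ ν, coeff ν f ≠ 0 → ν.degree = d)
    (t : sumZero n) (ht : ∀ i, ⟪aRoot n i, t⟫_ℝ ≠ 0) :
    jacobiOperator (aRoot n) (aMult n k) (aFun n f) t = aFun n (aOp n k d f) t := by
  set s : Fin n → ℝ := fun i => (t : EuclideanSpace ℝ (Fin n)) i with hs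
  set A : Fin n → ℝ := fun i => aFun n (pderiv i f) t with hA
  set B : Fin n → Fin n → ℝ := fun i l => aFun n (pderiv l (pderiv i f)) t with hB
  have hX : ∀ i g, aFun n (X i * g) t = Real.exp (s i) * aFun n g t := fun i g => by
    simp only [aFun_apply, map_mul, eval_X, hs]
  have hX2 : ∀ i g, aFun n (X i ^ 2 * g) t = Real.exp (s i) ^ 2 * aFun n g t := fun i g => by
    simp only [aFun_apply, map_mul, map_pow, eval_X, hs]
  have hE := eulerOp_of_degree hd
  have hE1 : ∑ i, Real.exp (s i) * A i = d * aFun n f t := by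
    have := congrArg (fun g => aFun n g t) hE
    simpa only [eulerOp_apply, map_sum, Finset.sum_apply, hX, map_smul, Pi.smul_apply,
      smul_eq_mul] using this
  have hE2 : ∑ i, Real.exp (s i) * A i + ∑ i, ∑ l, Real.exp (s i) * Real.exp (s l) * B i l =
      d * (d * aFun n f t) := by
    have h1 : eulerOp n (eulerOp n f) = (d : ℝ) • (d : ℝ) • f := by rw [hE, map_smul, hE]
    have h2 : eulerOp n (eulerOp n f) =
        ∑ l, X l * pderiv l f + ∑ i, ∑ l, X i * (X l * pderiv l (pderiv i f)) := by
      rw [eulerOp_apply, eulerOp_apply, sum_comm, ← sum_add_distrib]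
      refine sum_congr rfl fun l _ => ?_
      rw [map_sum, mul_sum]
      have h3 : ∀ i, X l * pderiv l (X i * pderiv i f) =
          (if i = l then X l * pderiv l f else 0) + X i * (X l * pderiv l (pderiv i f)) := by
        intro i
        rw [Derivation.leibniz]
        split_ifs with h
        · subst h; rw [pderiv_X_self]; simp only [smul_eq_mul]; ring
        · rw [pderiv_X_of_ne h]; simp only [smul_eq_mul]; ring
      rw [sum_congr rfl fun i _ => h3 i, sum_add_distrib, sum_ite_eq' univ, if_pos (mem_univ l)]
    have := congrArg (fun g => aFun n g t) (h2.symm.trans h1)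
    simp only [map_add, map_sum, Pi.add_apply, Finset.sum_apply, hX, map_smul, Pi.smul_apply,
      smul_eq_mul] at this
    rw [← this]
    exact congrArg _ (sum_congr rfl fun i _ => sum_congr rfl fun l _ => mul_assoc _ _ _)
  have hlap : Δ (aFun n f) t = ∑ i, (Real.exp (s i) ^ 2 * B i i + Real.exp (s i) * A i) -
      (d : ℝ) ^ 2 / n * aFun n f t := by
    have hin : ∀ i l : Fin n, ⟪proj n (stdVec i), proj n (stdVec l)⟫_ℝ =
        (if i = l then 1 else 0) - 1 / n := fun i l => by
      rw [inner_proj_stdVec, proj_apply]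
      simp [PiLp.single_apply]
    rw [aFun, laplacian_polyFun Real.hasDerivAt_exp Real.hasDerivAt_exp]
    simp only [hin, inner_proj_stdVec, if_true]
    change ∑ i, ((1 - 1 / (n : ℝ)) * (Real.exp (s i) * A i) +
      ∑ l, ((if i = l then 1 else 0) - 1 / (n : ℝ)) * (Real.exp (s i) * Real.exp (s l) * B i l)) = _
    simp only [sub_mul, sum_sub_distrib, ite_mul, one_mul, zero_mul, sum_ite_eq, mem_univ, if_true,
      ← mul_sum, sum_add_distrib]
    rw [sum_congr rfl fun i _ => show Real.exp (s i) * Real.exp (s i) * B i i =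
      Real.exp (s i) ^ 2 * B i i by ring]
    change _ = _ - (d : ℝ) ^ 2 / n * aFun n f t
    linear_combination (-1 / (n : ℝ)) * hE2
  have hfd : ∀ p : Pairs n, fderiv ℝ (aFun n f) t (aRoot n p) =
      Real.exp (s p.1.1) * A p.1.1 - Real.exp (s p.1.2) * A p.1.2 := fun p => by
    rw [aFun, fderiv_polyFun Real.hasDerivAt_exp]
    simp only [inner_proj_stdVec, coe_aRoot, PiLp.sub_apply, PiLp.single_apply, mul_sub, mul_ite,
      mul_one, mul_zero, sum_sub_distrib, sum_ite_eq', mem_univ, if_true]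
    rfl
  have hpair : ∀ p : Pairs n, coth (⟪aRoot n p, t⟫_ℝ / 2) *
      (Real.exp (s p.1.1) * A p.1.1 - Real.exp (s p.1.2) * A p.1.2) =
      2 * aFun n (pairOp 2 p.1.1 p.1.2 f) t -
        (Real.exp (s p.1.1) * A p.1.1 + Real.exp (s p.1.2) * A p.1.2) := by
    intro p
    have h0 := ht p
    rw [inner_aRoot] at h0 ⊢
    refine coth_half_sub_eq h0 ?_
    have key := congrArg (fun g => aFun n g t) (sub_mul_pairOp p.2.ne 2 hf)
    simpa only [aFun_apply, map_mul, map_sub, map_pow, eval_X, hA] using key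
  rw [jacobiOperator, hlap, aOp_apply, topOp_apply]
  simp only [hfd, aMult, mul_assoc, hpair]
  simp only [map_sub, map_add, map_smul, map_sum, Pi.sub_apply, Pi.add_apply, Finset.sum_apply,
    Pi.smul_apply, smul_eq_mul, hX, hX2, ← mul_sum, sum_sub_distrib, aShift]
  rw [sum_pairs_add fun i => Real.exp (s i) * A i, hE1]
  change _ = ∑ i, (Real.exp (s i) ^ 2 * B i i + Real.exp (s i) * A i) + _ - _
  ring

lemma aFun_injective {f : MvPolynomial (Fin n) ℝ} {d : ℕ}
    (hd : ∀ ν, MvPolynomial.coeff ν f ≠ 0 → ν.degree = d)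
    (h : ∀ t, (∀ i, ⟪aRoot n i, t⟫_ℝ ≠ 0) → aFun n f t = 0) : f = 0 := by
  refine eq_zero_of_eval_eq_zero fun x hx hinj => ?_
  let v : EuclideanSpace ℝ (Fin n) := WithLp.toLp 2 fun i => Real.log (x i)
  have hv : ∀ i, v i = Real.log (x i) := fun i => rfl
  have h0 := h (proj n v) fun p => by
    rw [inner_aRoot, proj_apply, proj_apply, sub_sub_sub_cancel_right, sub_ne_zero, hv, hv]
    exact fun h' => p.2.ne (hinj (Real.log_injOn_pos (hx _) (hx _) h'))
  -- Up to a common positive factor every point with positive coordinates comes from the hyperplane,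
  -- and homogeneity removes that factor.
  have e : (fun i => Real.exp ((proj n v : EuclideanSpace ℝ (Fin n)) i)) =
      fun i => Real.exp (-((∑ l, v l) / n)) * x i := by
    ext i
    rw [proj_apply, sub_eq_add_neg, Real.exp_add, hv, Real.exp_log (hx i), mul_comm]
  rw [aFun_apply, e, eval_mul_of_degree hd] at h0
  exact (mul_eq_zero.mp h0).resolve_left (pow_ne_zero _ (Real.exp_ne_zero _))

lemma isTriangular_aOp (k : ℝ) (lam : Fin n →₀ ℕ) :
    IsTriangular (homDominated lam) (aOp n k lam.degree)
      (fun μ => topEigenvalue n k μ - aShift n k lam.degree) := by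
  constructor
  · intro f hf
    obtain ⟨hs, hD⟩ := mem_symmSupp.mp hf
    rw [aOp_apply]
    refine sub_mem (mem_symmSupp.mpr ⟨isSymmetric_topOp k hs, fun μ hμ => ?_⟩)
      (Submodule.smul_mem _ _ hf)
    obtain ⟨ν, hν, i, j, hm, hdeg⟩ := exists_move_of_coeff_topOp_ne_zero hμ
    have := hD ν (MvPolynomial.mem_support_iff.mp hν)
    exact ⟨hm.mem_dominated this.1, hdeg.trans this.2⟩
  · intro f hf μ _ hμ hmax
    rw [aOp_apply, MvPolynomial.coeff_sub, MvPolynomial.coeff_smul,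
      coeff_topOp k (mem_symmSupp.mp hf).1 hμ hmax, smul_eq_mul, sub_mul]

lemma isModel_a (k : ℝ) {lam : Fin n →₀ ℕ} (hlam : Antitone lam) :
    IsModel (aRoot n) (aMult n k) (homDominated lam) (aOp n k lam.degree)
      (fun μ => topEigenvalue n k μ - aShift n k lam.degree) (fun m => Polynomial.X ^ m)
      (fun μ => proj n (toVec μ)) (aFun n) lam where
  finite := (finite_dominated _).subset fun _ h => h.1
  mem := ⟨by simpa using self_mem_dominated hlam, rfl⟩
  anti := hlam
  max := fun ν hν => by simpa using weight_le_of_mem_dominated hν.1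
  triangular := isTriangular_aOp k lam
  natDegree_le := fun m => Polynomial.natDegree_X_pow_le m
  coeff_ne_zero := fun m => by simp
  orbitPoly_mem := fun μ hμ _ => mem_symmSupp.mpr ⟨isSymmetric_orbitPoly _ _, fun ν hν => by
    rw [coeff_orbitPoly] at hν
    obtain ⟨ν', hν', h⟩ := exists_ne_zero_of_sum_ne_zero hν
    have : ν = ν' := Finsupp.ext fun i => by
      have := prod_ne_zero_iff.mp h i (mem_univ i)
      rw [Polynomial.coeff_X_pow] at this
      exact (ite_ne_right_iff.mp this).1
    subst this
    exact ⟨mem_dominated_of_mem_permOrbit hν' hμ.1, (degree_of_mem_permOrbit hν').trans hμ.2⟩⟩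
  orbit := fun μ _ _ => aFun_orbitPoly μ
  lower := lowerWeights_a lam
  op := fun f hf t ht => jacobiOperator_aFun k (mem_symmSupp.mp hf).1
    (fun ν hν => ((mem_symmSupp.mp hf).2 ν hν).2) t ht
  inj := fun f hf h => aFun_injective (fun ν hν => ((mem_symmSupp.mp hf).2 ν hν).2) h
  ev_eq := fun μ hμ _ => by rw [eigenvalue_a, hμ.2]

end TypeA

/-! ### The limit transition -/

section Limit

open MvPolynomial Finset

variable {n : ℕ}

/-- Once |ε|‖S‖ + |δ|‖T‖ < 1/2, the terms with u on the right are absorbed into the left, leaving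
‖u‖ ≤ 2(|ε|‖v‖ + |δ|‖w‖). -/
lemma tendsto_zero_of_perturbation_normed {W α : Type*} [NormedAddCommGroup W] [NormedSpace ℝ W]
    {F : Filter α} (S T : W →L[ℝ] W) (v w : W) {ε δ : α → ℝ}
    (hε : Tendsto ε F (𝓝 0)) (hδ : Tendsto δ F (𝓝 0)) {u : α → W}
    (hu : ∀ᶠ k in F, u k = ε k • (S (u k) + v) + δ k • (T (u k) + w)) :
    Tendsto u F (𝓝 0) := by
  have hε' : Tendsto (fun k => |ε k|) F (𝓝 0) := by simpa using hε.abs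
  have hδ' : Tendsto (fun k => |δ k|) F (𝓝 0) := by simpa using hδ.abs
  have hsmall : Tendsto (fun k => |ε k| * ‖S‖ + |δ k| * ‖T‖) F (𝓝 0) := by
    simpa using (hε'.mul_const ‖S‖).add (hδ'.mul_const ‖T‖)
  have hbound : Tendsto (fun k => 2 * (|ε k| * ‖v‖ + |δ k| * ‖w‖)) F (𝓝 0) := by
    simpa using ((hε'.mul_const ‖v‖).add (hδ'.mul_const ‖w‖)).const_mul 2
  refine squeeze_zero_norm' ?_ hbound
  filter_upwards [hu, hsmall.eventually_lt_const (by norm_num : (0 : ℝ) < 1 / 2)] with k hk hlt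
  have h1 : ‖u k‖ ≤ |ε k| * (‖S‖ * ‖u k‖ + ‖v‖) + |δ k| * (‖T‖ * ‖u k‖ + ‖w‖) := by
    conv_lhs => rw [hk]
    refine (norm_add_le _ _).trans (add_le_add ?_ ?_)
    · rw [norm_smul, Real.norm_eq_abs]
      gcongr
      exact (norm_add_le _ _).trans (by gcongr; exact S.le_opNorm _)
    · rw [norm_smul, Real.norm_eq_abs]
      gcongr
      exact (norm_add_le _ _).trans (by gcongr; exact T.le_opNorm _)
  have h2 := mul_le_mul_of_nonneg_right hlt.le (norm_nonneg (u k))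
  nlinarith

/-- A small perturbation of the equation `u = 0` in a finite-dimensional space has small
solutions. -/
lemma tendsto_zero_of_perturbation {W α : Type*} [AddCommGroup W] [Module ℝ W]
    [FiniteDimensional ℝ W] {F : Filter α} (S T : W →ₗ[ℝ] W) (v w : W) {ε δ : α → ℝ}
    (hε : Tendsto ε F (𝓝 0)) (hδ : Tendsto δ F (𝓝 0)) {u : α → W}
    (hu : ∀ᶠ k in F, u k = ε k • (S (u k) + v) + δ k • (T (u k) + w)) (ℓ : W →ₗ[ℝ] ℝ) :
    Tendsto (fun k => ℓ (u k)) F (𝓝 0) := by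
  -- W carries no topology: a basis provides a norm, and convergence is tested by the functional ℓ.
  let e := (Module.finBasis ℝ W).equivFun
  have h := tendsto_zero_of_perturbation_normed
    (LinearMap.toContinuousLinearMap (e.toLinearMap ∘ₗ S ∘ₗ e.symm.toLinearMap))
    (LinearMap.toContinuousLinearMap (e.toLinearMap ∘ₗ T ∘ₗ e.symm.toLinearMap))
    (e v) (e w) hε hδ (u := fun k => e (u k)) (hu.mono fun k hk => by
      have := congrArg e hk
      simpa using this)
  have h2 := ((LinearMap.toContinuousLinearMap (ℓ ∘ₗ e.symm.toLinearMap)).continuous.tendsto 0).comp h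
  rw [map_zero] at h2
  refine h2.congr fun k => ?_
  simp

/-- The polynomial `f(x_1 + s, …, x_n + s)`. -/
def translate (s : ℝ) (f : MvPolynomial (Fin n) ℝ) : MvPolynomial (Fin n) ℝ :=
  aeval (fun i => (X i + C s : MvPolynomial (Fin n) ℝ)) f

lemma eval_translate (s : ℝ) (f : MvPolynomial (Fin n) ℝ) (x : Fin n → ℝ) :
    eval x (translate s f) = eval (fun i => x i + s) f := by
  rw [translate, ← coe_aeval_eq_eval, RingHom.coe_coe, ← AlgHom.comp_apply, comp_aeval]
  simp

lemma pderiv_translate (s : ℝ) (i : Fin n) (f : MvPolynomial (Fin n) ℝ) :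
    pderiv i (translate s f) = translate s (pderiv i f) := by
  induction f using MvPolynomial.induction_on with
  | C c => simp [translate]
  | add p q hp hq =>
    simp only [translate, map_add] at *
    rw [hp, hq]
  | mul_X p j hp =>
    simp only [translate, map_mul, aeval_X, Derivation.leibniz, map_add, smul_eq_mul, hp,
      pderiv_C, add_zero] at *
    by_cases h : j = i
    · subst h; simp
    · simp [pderiv_X_of_ne h]

/-- E + sG = ∑ (x_i + s) ∂_i is Euler's operator in the translated variables. -/
lemma eulerOp_translate (s : ℝ) (f : MvPolynomial (Fin n) ℝ) :
    eulerOp n (translate s f) + s • gradOp n (translate s f) = translate s (eulerOp n f) := by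
  have h : translate s (∑ i, X i * pderiv i f) =
      ∑ i, (X i + C s) * translate s (pderiv i f) := by simp [translate]
  rw [eulerOp_apply, gradOp_apply, smul_sum, ← sum_add_distrib, eulerOp_apply, h]
  refine sum_congr rfl fun i _ => ?_
  rw [pderiv_translate, add_mul, smul_eq_C_mul]

/-- Translation does not change the coefficients of highest degree. -/
lemma coeff_translate {s : ℝ} {f : MvPolynomial (Fin n) ℝ} {d : ℕ}
    (hd : ∀ ν, coeff ν f ≠ 0 → ν.degree = d) {ν : Fin n →₀ ℕ} (hν : d ≤ ν.degree) :
    coeff ν (translate s f) = coeff ν f := by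
  have hmon : ∀ μ : Fin n →₀ ℕ, translate s (monomial μ 1) =
      ∏ i, Polynomial.aeval (X i : MvPolynomial (Fin n) ℝ)
        ((Polynomial.X + Polynomial.C s) ^ μ i) := by
    intro μ
    rw [translate, aeval_monomial, Finsupp.prod_fintype _ _ fun i => pow_zero _]
    simp [algebraMap_eq]
  have h1 := linearMap_eq_sum
    (aeval (fun i => (X i + C s : MvPolynomial (Fin n) ℝ))).toLinearMap f
  have h2 : translate s f = ∑ μ ∈ f.support, coeff μ f • translate s (monomial μ 1) := h1
  have h3 : ∀ μ ∈ f.support, coeff ν (translate s (monomial μ 1)) = if μ = ν then 1 else 0 := by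
    intro μ hμ
    have hμd := hd μ (mem_support_iff.mp hμ)
    rw [hmon, coeff_prod_aeval_X]
    split_ifs with h
    · subst h
      refine prod_eq_one fun i _ => ?_
      rw [Polynomial.coeff_X_add_C_pow]
      simp
    · by_contra hne
      have hle : ν ≤ μ := fun i => by
        have := prod_ne_zero_iff.mp hne i (mem_univ i)
        refine (Polynomial.le_natDegree_of_ne_zero this).trans ?_
        rw [Polynomial.natDegree_pow, Polynomial.natDegree_X_add_C, mul_one]
      obtain ⟨i, hi⟩ : ∃ i, ν i < μ i := by
        by_contra! hc
        exact h (le_antisymm hc hle)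
      have : ∑ i, ν i < ∑ i, μ i := sum_lt_sum (fun i _ => hle i) ⟨i, mem_univ i, hi⟩
      rw [← Finsupp.degree_eq_sum, ← Finsupp.degree_eq_sum] at this
      omega
  rw [h2, coeff_sum, sum_congr rfl fun μ hμ => by rw [coeff_smul, h3 μ hμ]]
  simp only [smul_eq_mul, mul_ite, mul_one, mul_zero, sum_ite_eq']
  split_ifs with h
  · rfl
  · exact (notMem_support_iff.mp h).symm

/-- The operator `∑ (x_i + s) ∂_i - d`. -/
def shiftedEuler (n : ℕ) (s : ℝ) (d : ℕ) : MvPolynomial (Fin n) ℝ →ₗ[ℝ] MvPolynomial (Fin n) ℝ :=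
  eulerOp n + s • gradOp n - (d : ℝ) • LinearMap.id

lemma shiftedEuler_apply (s : ℝ) (d : ℕ) (f : MvPolynomial (Fin n) ℝ) :
    shiftedEuler n s d f = eulerOp n f + s • gradOp n f - (d : ℝ) • f := rfl

lemma shiftedEuler_translate {s : ℝ} {f : MvPolynomial (Fin n) ℝ} {d : ℕ}
    (hd : ∀ ν, coeff ν f ≠ 0 → ν.degree = d) : shiftedEuler n s d (translate s f) = 0 := by
  rw [shiftedEuler_apply, eulerOp_translate, eulerOp_of_degree hd, translate, translate, map_smul,
    sub_self]

/-- On the component of highest degree m of f the operator acts as the scalar m − d, which is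
negative. -/
lemma eq_zero_of_shiftedEuler {s : ℝ} {f : MvPolynomial (Fin n) ℝ} {d : ℕ}
    (hd : ∀ ν, coeff ν f ≠ 0 → ν.degree < d) (h : shiftedEuler n s d f = 0) : f = 0 := by
  by_contra hne
  obtain ⟨ν, hν, hmax⟩ := exists_max_image f.support Finsupp.degree (support_nonempty.mpr hne)
  have hν' := mem_support_iff.mp hν
  have hgrad : coeff ν (gradOp n f) = 0 := by
    by_contra h0
    obtain ⟨ν', h1, i, j, -, h2⟩ := gradOp_degree h0
    have := hmax ν' h1
    omega
  have := congrArg (coeff ν) h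
  rw [shiftedEuler_apply, coeff_sub, coeff_add, coeff_smul, coeff_smul, hgrad, coeff_eulerOp,
    coeff_zero, smul_zero, add_zero, smul_eq_mul, ← sub_mul] at this
  have h1 := (mul_eq_zero.mp this).resolve_right hν'
  have h2 : (ν.degree : ℝ) < d := by exact_mod_cast hd ν hν'
  linarith

/-- The polynomials of degree less than `d`. -/
abbrev lowDegree (n d : ℕ) : Submodule ℝ (MvPolynomial (Fin n) ℝ) :=
  restrictSupport ℝ {ν | ν.degree < d}

lemma mem_lowDegree {d : ℕ} {f : MvPolynomial (Fin n) ℝ} :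
    f ∈ lowDegree n d ↔ ∀ ν, coeff ν f ≠ 0 → ν.degree < d := by
  rw [lowDegree, mem_restrictSupport_iff]
  simp [Set.subset_def]

lemma finiteDimensional_lowDegree (n d : ℕ) : FiniteDimensional ℝ (lowDegree n d) := by
  refine finite_restrictSupport ((Set.finite_Iic
    (Finsupp.equivFunOnFinite.symm fun _ => d : Fin n →₀ ℕ)).subset fun ν hν i => ?_)
  have h : ν.degree < d := hν
  rw [Finsupp.degree_eq_sum] at h
  exact (single_le_sum (f := fun i => ν i) (fun _ _ => Nat.zero_le _) (mem_univ i)).trans h.le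

/-- The component of highest degree of a `BC_n` eigenvector is a type `A` eigenvector. -/
lemma topOp_homogeneousComponent {k₁ k₂ k₃ : ℝ} {lam : Fin n →₀ ℕ} {f : MvPolynomial (Fin n) ℝ}
    (hf : f ∈ symmSupp (dominated lam))
    (he : bcOp n k₁ k₂ k₃ f = (topEigenvalue n k₃ lam + (k₁ + 2 * k₂) * lam.degree) • f) :
    topOp n k₃ (homogeneousComponent lam.degree f) =
      topEigenvalue n k₃ lam • homogeneousComponent lam.degree f := by
  set d := lam.degree with hd
  set h := homogeneousComponent d f with hh
  have hcoeff : ∀ ν, coeff ν h = if ν.degree = d then coeff ν f else 0 := fun ν =>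
    coeff_homogeneousComponent d f ν
  have hle : ∀ ν ∈ f.support, ν.degree ≤ d := fun ν hν => by
    have := sum_univ_le_of_mem_dominated ((mem_symmSupp.mp hf).2 ν (mem_support_iff.mp hν))
    rwa [hd, Finsupp.degree_eq_sum lam]
  ext ν
  rw [coeff_smul, smul_eq_mul, hcoeff]
  split_ifs with hν
  · have h1 : coeff ν (topOp n k₃ (f - h)) = 0 := by
      by_contra hne
      obtain ⟨ν', hν', i, j, -, hdeg⟩ := exists_move_of_coeff_topOp_ne_zero hne
      rw [mem_support_iff, coeff_sub, hcoeff, if_pos (hdeg.symm.trans hν), sub_self] at hν'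
      exact hν' rfl
    have h2 : coeff ν (lowOp n k₃ f) = 0 := by
      by_contra hne
      obtain ⟨ν', hν', i, j, -, hdeg⟩ := lowOp_degree hne
      have := hle ν' hν'
      omega
    have h3 : coeff ν (gradOp n f) = 0 := by
      by_contra hne
      obtain ⟨ν', hν', i, j, -, hdeg⟩ := gradOp_degree hne
      have := hle ν' hν'
      omega
    -- In degree d neither `lowOp` nor `gradOp` contributes, and the Euler term gives (k₁ + 2k₂)d on
    -- both sides: k₁ and k₂ drop out.
    have h4 := congrArg (coeff ν) he
    rw [bcOp_apply, coeff_add, coeff_add, coeff_add, coeff_smul, coeff_smul, h2, h3, coeff_eulerOp,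
      coeff_smul, hν] at h4
    rw [map_sub, coeff_sub] at h1
    simp only [smul_eq_mul] at h4
    linear_combination h4 - h1
  · rw [mul_zero]
    by_contra hne
    obtain ⟨ν', hν', i, j, -, hdeg⟩ := exists_move_of_coeff_topOp_ne_zero hne
    rw [mem_support_iff, hcoeff, if_neg (fun h' => hν (hdeg.trans h'))] at hν'
    exact hν' rfl

/-- The ratio of the leading coefficients of the orbit sums of `BC_n` and `A_{n-1}`. -/
def leadingRatio (lam : Fin n →₀ ℕ) : ℝ :=
  coeff lam (orbitPoly rankOnePoly lam) / coeff lam (orbitPoly (fun m => Polynomial.X ^ m) lam)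

lemma leadingRatio_ne_zero (lam : Fin n →₀ ℕ) : leadingRatio lam ≠ 0 :=
  div_ne_zero (coeff_self_orbitPoly_ne_zero rankOnePoly_natDegree rankOnePoly_coeff lam)
    (coeff_self_orbitPoly_ne_zero (fun m => Polynomial.natDegree_X_pow_le m) (by simp) lam)

/-- The Jack polynomial as a polynomial: data that determine it. -/
structure IsJackPoly (k : ℝ) (lam : Fin n →₀ ℕ) (J : MvPolynomial (Fin n) ℝ) : Prop where
  mem : J ∈ symmSupp (homDominated lam)
  coeff : coeff lam J = coeff lam (orbitPoly (fun m => Polynomial.X ^ m) lam)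
  eigen : topOp n k J = topEigenvalue n k lam • J

lemma IsJackPoly.degree {k : ℝ} {lam : Fin n →₀ ℕ} {J : MvPolynomial (Fin n) ℝ}
    (hJ : IsJackPoly k lam J) : ∀ ν, MvPolynomial.coeff ν J ≠ 0 → ν.degree = lam.degree :=
  fun ν hν => ((mem_symmSupp.mp hJ.mem).2 ν hν).2

lemma exists_isJackPoly {k : ℝ} {lam : Fin n →₀ ℕ} (hlam : Antitone lam)
    (hnd : Nondegenerate (aRoot n) (aMult n k) (proj n (toVec lam))) :
    ∃ J, IsJackPoly k lam J ∧ jacobi (aRoot n) (aMult n k) (proj n (toVec lam)) = aFun n J := by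
  obtain ⟨J, ⟨h1, h2, h3⟩, h4⟩ := (isModel_a k hlam).exists_jacobi_eq hnd
  refine ⟨J, ⟨h1, h2, ?_⟩, h4⟩
  rw [aOp_apply, sub_smul] at h3
  simpa using h3

/-- Both sides are type A eigenvectors with the same coefficient at lam, so they agree. Thus the top
component does not depend on k₁ and k₂. -/
lemma homogeneousComponent_eq_smul {k₁ k₂ k₃ : ℝ} {lam : Fin n →₀ ℕ} (hlam : Antitone lam)
    (hnd : Nondegenerate (aRoot n) (aMult n k₃) (proj n (toVec lam)))
    {J f : MvPolynomial (Fin n) ℝ} (hJ : IsJackPoly k₃ lam J) (hf : f ∈ symmSupp (dominated lam))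
    (hc : coeff lam f = coeff lam (orbitPoly rankOnePoly lam))
    (he : bcOp n k₁ k₂ k₃ f = (topEigenvalue n k₃ lam + (k₁ + 2 * k₂) * lam.degree) • f) :
    homogeneousComponent lam.degree f = leadingRatio lam • J := by
  obtain ⟨hs, hD⟩ := mem_symmSupp.mp hf
  have htop := topOp_homogeneousComponent hf he
  have hmem : homogeneousComponent lam.degree f ∈ symmSupp (homDominated lam) := by
    refine mem_symmSupp.mpr ⟨fun σ => ?_, fun ν hν => ?_⟩
    · rw [rename_homogeneousComponent, hs σ]
    · rw [coeff_homogeneousComponent] at hν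
      obtain ⟨h1, h2⟩ := ite_ne_right_iff.mp hν
      exact ⟨hD ν h2, h1⟩
  have hM := isModel_a k₃ hlam
  refine sub_eq_zero.mp (hM.triangular.eq_zero_of_eigen (hM.ev_ne hnd)
    (sub_mem hmem (Submodule.smul_mem _ _ hJ.mem)) ?_ ?_)
  · rw [coeff_sub, coeff_smul, coeff_homogeneousComponent, if_pos rfl, hc, hJ.coeff, leadingRatio,
      smul_eq_mul, div_mul_cancel₀ _ (coeff_self_orbitPoly_ne_zero
        (fun m => Polynomial.natDegree_X_pow_le m) (by simp) lam), sub_self]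
  · rw [aOp_apply, map_sub, map_smul, htop, hJ.eigen]
    module

/-- The deviation of the `BC_n` polynomial from its limit satisfies a perturbed equation. -/
lemma exists_deviation {k₁ k₂ k₃ : ℝ} {lam : Fin n →₀ ℕ} (hlam : Antitone lam)
    (hnd : Nondegenerate (aRoot n) (aMult n k₃) (proj n (toVec lam)))
    {J : MvPolynomial (Fin n) ℝ} (hJ : IsJackPoly k₃ lam J)
    (hndB : Nondegenerate (bcRoot n) (bcMult n k₁ k₂ k₃) (toVec lam)) (hK : k₁ + 2 * k₂ ≠ 0)
    (s : ℝ) :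
    ∃ u : lowDegree n lam.degree,
      jacobi (bcRoot n) (bcMult n k₁ k₂ k₃) (toVec lam) =
        bcFun n (leadingRatio lam • translate s J + u) ∧
      shiftedEuler n s lam.degree u =
        (-((k₁ + k₂) / (k₁ + 2 * k₂) - s)) • gradOp n (leadingRatio lam • translate s J + u) +
        (-(k₁ + 2 * k₂)⁻¹) • (topOp n k₃ + lowOp n k₃ - topEigenvalue n k₃ lam • LinearMap.id :
            MvPolynomial (Fin n) ℝ →ₗ[ℝ] MvPolynomial (Fin n) ℝ)
          (leadingRatio lam • translate s J + u) := by
  obtain ⟨f, ⟨hf, hc, he⟩, hjac⟩ := (isModel_bc k₁ k₂ k₃ hlam).exists_jacobi_eq hndB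
  have htop := homogeneousComponent_eq_smul hlam hnd hJ hf hc he
  have hdeg := hJ.degree
  set g := leadingRatio lam • translate s J with hg
  -- Translation leaves the top component of J unchanged, so f and g agree in all degrees ≥ |λ|.
  have hu : f - g ∈ lowDegree n lam.degree := by
    refine mem_lowDegree.mpr fun ν hν => ?_
    by_contra! hle
    have h1 : coeff ν g = leadingRatio lam * coeff ν J := by
      rw [hg, coeff_smul, coeff_translate hdeg hle, smul_eq_mul]
    have h2 := congrArg (coeff ν) htop
    rw [coeff_homogeneousComponent, coeff_smul, smul_eq_mul] at h2
    split_ifs at h2 with h3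
    · rw [coeff_sub, h1, h2, sub_self] at hν
      exact hν rfl
    · rw [coeff_sub, h1, ← h2, sub_zero] at hν
      have := sum_univ_le_of_mem_dominated ((mem_symmSupp.mp hf).2 ν hν)
      rw [← Finsupp.degree_eq_sum lam] at this
      omega
  have hfg : g + (f - g) = f := by abel
  refine ⟨⟨f - g, hu⟩, ?_, ?_⟩
  · rw [hfg]; exact hjac
  · simp only [hfg]
    have hg0 : shiftedEuler n s lam.degree g = 0 := by
      rw [hg, map_smul, shiftedEuler_translate hdeg, smul_zero]
    rw [map_sub, hg0, sub_zero]
    -- Division by k₁ + 2k₂ isolates (E − d) f; adding s G f on both sides leaves only small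
    -- coefficients on the right.
    have he' : bcOp n k₁ k₂ k₃ f = (topEigenvalue n k₃ lam + (k₁ + 2 * k₂) * lam.degree) • f := he
    ext ν
    have h1 := congrArg (coeff ν) he'
    rw [bcOp_apply] at h1
    simp only [shiftedEuler_apply, coeff_add, coeff_sub, coeff_smul, smul_eq_mul,
      LinearMap.sub_apply, LinearMap.add_apply, LinearMap.smul_apply, LinearMap.id_apply] at h1 ⊢
    linear_combination (k₁ + 2 * k₂)⁻¹ * h1 -
      (coeff ν (eulerOp n f) - lam.degree * coeff ν f) * mul_inv_cancel₀ hK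

lemma tendsto_jacobi_bc {α : Type*} {F : Filter α} {k₁ k₂ : α → ℝ} {k₃ s : ℝ} {lam : Fin n →₀ ℕ}
    (hlam : Antitone lam) (hnd : Nondegenerate (aRoot n) (aMult n k₃) (proj n (toVec lam)))
    {J : MvPolynomial (Fin n) ℝ} (hJ : IsJackPoly k₃ lam J)
    (hndB : ∀ᶠ k in F, Nondegenerate (bcRoot n) (bcMult n (k₁ k) (k₂ k) k₃) (toVec lam))
    (hK : ∀ᶠ k in F, k₁ k + 2 * k₂ k ≠ 0)
    (hK' : Tendsto (fun k => (k₁ k + 2 * k₂ k)⁻¹) F (𝓝 0))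
    (hs : Tendsto (fun k => (k₁ k + k₂ k) / (k₁ k + 2 * k₂ k)) F (𝓝 s))
    (t : EuclideanSpace ℝ (Fin n)) :
    Tendsto (fun k => jacobi (bcRoot n) (bcMult n (k₁ k) (k₂ k) k₃) (toVec lam) t) F
      (𝓝 (leadingRatio lam * eval (fun i => Real.sinh (t i / 2) ^ 2 + s) J)) := by
  have := finiteDimensional_lowDegree n lam.degree
  set g := leadingRatio lam • translate s J with hg
  set R := topOp n k₃ + lowOp n k₃ - topEigenvalue n k₃ lam • LinearMap.id with hR
  -- For parameters outside the eventual conditions u is set to 0, merely to have a function of all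
  -- parameters.
  have hex : ∀ k, ∃ u : lowDegree n lam.degree,
      Nondegenerate (bcRoot n) (bcMult n (k₁ k) (k₂ k) k₃) (toVec lam) ∧ k₁ k + 2 * k₂ k ≠ 0 →
      jacobi (bcRoot n) (bcMult n (k₁ k) (k₂ k) k₃) (toVec lam) = bcFun n (g + u) ∧
      shiftedEuler n s lam.degree u =
        (-((k₁ k + k₂ k) / (k₁ k + 2 * k₂ k) - s)) • gradOp n (g + u) +
        (-(k₁ k + 2 * k₂ k)⁻¹) • R (g + u) := by
    intro k
    by_cases h : Nondegenerate (bcRoot n) (bcMult n (k₁ k) (k₂ k) k₃) (toVec lam) ∧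
        k₁ k + 2 * k₂ k ≠ 0
    · obtain ⟨u, hu⟩ := exists_deviation hlam hnd hJ h.1 h.2 s
      exact ⟨u, fun _ => hu⟩
    · exact ⟨0, fun h' => absurd h' h⟩
  choose u hu using hex
  -- A left inverse of the shifted Euler operator, defined on all polynomials, puts the equation in
  -- the form u = ε(…) + δ(…) inside `lowDegree`; no degree bound on its right side is needed.
  obtain ⟨G, hG⟩ := LinearMap.exists_leftInverse_of_injective
    (shiftedEuler n s lam.degree ∘ₗ (lowDegree n lam.degree).subtype) (by
      rw [LinearMap.ker_eq_bot']
      rintro ⟨f, hf⟩ h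
      exact Subtype.ext (eq_zero_of_shiftedEuler (mem_lowDegree.mp hf) h))
  have hG' : ∀ v : lowDegree n lam.degree, G (shiftedEuler n s lam.degree v) = v := fun v =>
    LinearMap.congr_fun hG v
  have hε : Tendsto (fun k => -((k₁ k + k₂ k) / (k₁ k + 2 * k₂ k) - s)) F (𝓝 0) := by
    simpa using (hs.sub_const s).neg
  have hδ : Tendsto (fun k => -(k₁ k + 2 * k₂ k)⁻¹) F (𝓝 0) := by simpa using hK'.neg
  have hlim := tendsto_zero_of_perturbation
    (G ∘ₗ gradOp n ∘ₗ (lowDegree n lam.degree).subtype)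
    (G ∘ₗ R ∘ₗ (lowDegree n lam.degree).subtype) (G (gradOp n g)) (G (R g)) hε hδ (u := u)
    ((hndB.and hK).mono fun k hk => by
      have h := congrArg G (hu k hk).2
      rw [hG'] at h
      refine h.trans ?_
      simp only [map_add, map_smul, LinearMap.comp_apply, Submodule.subtype_apply]
      rw [add_comm (G (gradOp n g)), add_comm (G (R g))])
    ((aeval fun i => Real.sinh (t i / 2) ^ 2).toLinearMap ∘ₗ (lowDegree n lam.degree).subtype)
  have hval : bcFun n g t = leadingRatio lam * eval (fun i => Real.sinh (t i / 2) ^ 2 + s) J := by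
    rw [hg, map_smul, Pi.smul_apply, bcFun_apply, eval_translate, smul_eq_mul]
  rw [← hval, ← add_zero (bcFun n g t)]
  refine (hlim.const_add (bcFun n g t)).congr' ((hndB.and hK).mono fun k hk => ?_)
  beta_reduce
  rw [(hu k hk).1, map_add, Pi.add_apply, bcFun_apply (u k : MvPolynomial (Fin n) ℝ)]
  rfl

/-- If |μ| = |λ|, the difference of the eigenvalues is the one for type A. If |μ| < |λ|, equality
would make (k₁ + 2k₂)⁻¹ times a constant equal to |λ| − |μ| ≥ 1, impossible in the limit. Only
finitely many μ occur. -/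
lemma eventually_nondegenerate_bc {α : Type*} {F : Filter α} {k₁ k₂ : α → ℝ} {k₃ : ℝ}
    {lam : Fin n →₀ ℕ} (hlam : Antitone lam)
    (hnd : Nondegenerate (aRoot n) (aMult n k₃) (proj n (toVec lam)))
    (hK : ∀ᶠ k in F, k₁ k + 2 * k₂ k ≠ 0)
    (hK' : Tendsto (fun k => (k₁ k + 2 * k₂ k)⁻¹) F (𝓝 0)) :
    ∀ᶠ k in F, Nondegenerate (bcRoot n) (bcMult n (k₁ k) (k₂ k) k₃) (toVec lam) := by
  have hall : ∀ μ ∈ {μ : Fin n →₀ ℕ | μ ∈ dominated lam ∧ Antitone μ ∧ μ ≠ lam}, ∀ᶠ k in F,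
      topEigenvalue n k₃ μ + (k₁ k + 2 * k₂ k) * μ.degree ≠
        topEigenvalue n k₃ lam + (k₁ k + 2 * k₂ k) * lam.degree := by
    rintro μ ⟨hμ, hanti, hne⟩
    have hle : μ.degree ≤ lam.degree := by
      rw [Finsupp.degree_eq_sum lam]; exact sum_univ_le_of_mem_dominated hμ
    rcases hle.eq_or_lt with heq | hlt
    · have := (isModel_a k₃ hlam).ev_ne hnd μ ⟨hμ, heq⟩ hanti hne
      refine Eventually.of_forall fun k h => this ?_
      rw [heq] at h
      linarith
    · have h1 := hK'.const_mul (topEigenvalue n k₃ μ - topEigenvalue n k₃ lam)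
      rw [mul_zero] at h1
      filter_upwards [hK, h1.eventually_lt_const one_pos] with k hk hk' h
      have h2 : (topEigenvalue n k₃ μ - topEigenvalue n k₃ lam) * (k₁ k + 2 * k₂ k)⁻¹ =
          lam.degree - μ.degree := by
        field_simp
        linear_combination h
      rw [h2] at hk'
      have h3 : (μ.degree : ℝ) + 1 ≤ lam.degree := by exact_mod_cast hlt
      linarith
  have hfin : {μ : Fin n →₀ ℕ | μ ∈ dominated lam ∧ Antitone μ ∧ μ ≠ lam}.Finite :=
    (finite_dominated _).subset fun _ h => h.1
  filter_upwards [(eventually_all_finite hfin).mpr hall] with k hk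
  intro x hx
  rw [lowerWeights_bc] at hx
  obtain ⟨μ, hμ, rfl⟩ := hx
  rw [eigenvalue_bc, eigenvalue_bc]
  exact hk μ hμ

/-- Projecting τ scales every e^{τ_i} by the same factor; by homogeneity this cancels the
exponential prefactor. -/
lemma jack_eq {k : ℝ} {lam : Fin n →₀ ℕ} {J : MvPolynomial (Fin n) ℝ} (hJ : IsJackPoly k lam J)
    (hjac : jacobi (aRoot n) (aMult n k) (proj n (toVec lam)) = aFun n J)
    (τ : EuclideanSpace ℝ (Fin n)) : jack n k lam τ = eval (fun i => Real.exp (τ i)) J := by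
  have e : (fun i => Real.exp ((proj n τ : EuclideanSpace ℝ (Fin n)) i)) =
      fun i => Real.exp (-((∑ l, τ l) / n)) * Real.exp (τ i) := by
    ext i
    rw [proj_apply, ← Real.exp_add]
    ring_nf
  rw [jack, hjac, aFun_apply, e, eval_mul_of_degree hJ.degree, ← mul_assoc, ← Real.exp_nat_mul,
    ← Real.exp_add]
  have : (∑ i, τ i) * (∑ i, (lam i : ℝ)) / n + lam.degree * -((∑ l, τ l) / n) = 0 := by
    rw [Finsupp.degree_eq_sum]
    push_cast
    ring
  rw [this, Real.exp_zero, one_mul]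

end Limit

/-! ### The parameter filter -/

section Parameters

variable {a : EReal}

lemma tendsto_ratio (a : EReal) :
    Tendsto (fun k : ℝ × ℝ => ((k.1 / k.2 : ℝ) : EReal)) (limitFilter a) (𝓝 (-a)) :=
  tendsto_comap.mono_left inf_le_right

lemma eventually_snd_ne_zero (a : EReal) : ∀ᶠ k in limitFilter a, k.2 ≠ 0 :=
  (inf_le_left.trans inf_le_right : limitFilter a ≤ 𝓟 {k | k.2 ≠ 0}) (mem_principal_self _)

/-- The limit −a is at least −1. Any bound strictly between −2 and −1 would do; it keeps k₁/k₂ + 2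
away from 0. -/
lemma eventually_ratio_gt (ha : a ≤ 1) : ∀ᶠ k in limitFilter a, -(3 / 2) < k.1 / k.2 := by
  have h1 : ((-(3 / 2) : ℝ) : EReal) < -a := by
    rw [EReal.lt_neg_comm]
    refine ha.trans_lt ?_
    rw [← EReal.coe_neg, neg_neg]
    exact_mod_cast (by norm_num : (1 : ℝ) < 3 / 2)
  filter_upwards [(tendsto_ratio a).eventually_const_lt h1] with k hk
  exact_mod_cast hk

/-- Put K = k₁ + 2k₂ = k₂(k₁/k₂ + 2), whose second factor exceeds 1/2. Then |k₂| ≤ 2|K| and |k₁| ≤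
|K| + 2|k₂| ≤ 5|K|. -/
lemma norm_le_of_ratio_gt {k : ℝ × ℝ} (h2 : k.2 ≠ 0) (h : -(3 / 2) < k.1 / k.2) :
    ‖k‖ ≤ 5 * |k.1 + 2 * k.2| := by
  have hK : k.1 + 2 * k.2 = k.2 * (k.1 / k.2 + 2) := by field_simp
  have h3 : |k.2| ≤ 2 * |k.1 + 2 * k.2| := by
    rw [hK, abs_mul, abs_of_pos (by linarith : 0 < k.1 / k.2 + 2)]
    nlinarith [abs_nonneg k.2]
  have h4 : |k.1| ≤ |k.1 + 2 * k.2| + 2 * |k.2| := by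
    have : k.1 = (k.1 + 2 * k.2) - 2 * k.2 := by ring
    calc |k.1| = |(k.1 + 2 * k.2) - 2 * k.2| := by rw [← this]
      _ ≤ |k.1 + 2 * k.2| + |2 * k.2| := abs_sub _ _
      _ = _ := by rw [abs_mul, abs_two]
  rw [Prod.norm_def, Real.norm_eq_abs, Real.norm_eq_abs]
  refine max_le (by linarith) (by linarith [abs_nonneg (k.1 + 2 * k.2)])

lemma eventually_norm_le (ha : a ≤ 1) :
    ∀ᶠ k in limitFilter a, ‖k‖ ≤ 5 * |k.1 + 2 * k.2| := by
  filter_upwards [eventually_snd_ne_zero a, eventually_ratio_gt ha] with k h2 h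
  exact norm_le_of_ratio_gt h2 h

lemma tendsto_norm_limitFilter (a : EReal) :
    Tendsto (fun k : ℝ × ℝ => ‖k‖) (limitFilter a) atTop :=
  tendsto_norm_cobounded_atTop.mono_left (inf_le_left.trans inf_le_left)

lemma eventually_sum_ne_zero (ha : a ≤ 1) : ∀ᶠ k in limitFilter a, k.1 + 2 * k.2 ≠ 0 := by
  filter_upwards [eventually_norm_le ha, (tendsto_norm_limitFilter a).eventually_gt_atTop 0]
    with k h1 h2 h
  rw [h, abs_zero, mul_zero] at h1
  linarith

lemma tendsto_inv_sum (ha : a ≤ 1) :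
    Tendsto (fun k : ℝ × ℝ => (k.1 + 2 * k.2)⁻¹) (limitFilter a) (𝓝 0) := by
  have h := (tendsto_inv_atTop_zero.comp (tendsto_norm_limitFilter a)).const_mul 5
  rw [mul_zero] at h
  refine squeeze_zero_norm' ?_ h
  filter_upwards [eventually_norm_le ha, eventually_sum_ne_zero ha,
    (tendsto_norm_limitFilter a).eventually_gt_atTop 0] with k h1 h2 h3
  rw [norm_inv, Real.norm_eq_abs, Function.comp_apply]
  have h4 := abs_pos.mpr h2
  rw [← div_eq_mul_inv, inv_eq_one_div, div_le_div_iff₀ h4 h3]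
  linarith

/-- The quotient is 1 − 1/(k₁/k₂ + 2). Its limit is 1 − 1/(2 − a) = (a − 1)/(a − 2) for finite a,
and 1 when k₁/k₂ → ∞. -/
lemma tendsto_shift (ha : a ≤ 1) :
    Tendsto (fun k : ℝ × ℝ => (k.1 + k.2) / (k.1 + 2 * k.2)) (limitFilter a) (𝓝 (shift a)) := by
  have hr := tendsto_ratio a
  have hcongr : ∀ᶠ k in limitFilter a,
      1 - (k.1 / k.2 + 2)⁻¹ = (k.1 + k.2) / (k.1 + 2 * k.2) := by
    filter_upwards [eventually_snd_ne_zero a, eventually_sum_ne_zero ha] with k h2 h3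
    have : k.1 / k.2 + 2 = (k.1 + 2 * k.2) / k.2 := by field_simp
    rw [this]
    field_simp
    ring
  refine Tendsto.congr' hcongr ?_
  rw [shift]
  split_ifs with hbot
  · subst hbot
    rw [EReal.neg_bot, EReal.tendsto_coe_nhds_top_iff] at hr
    have := tendsto_inv_atTop_zero.comp (tendsto_atTop_add_const_right _ (2 : ℝ) hr)
    simpa using this.const_sub 1
  · have htop : a ≠ ⊤ := fun h => absurd (h ▸ ha) (by
      rw [top_le_iff]; exact EReal.coe_ne_top 1)
    lift a to ℝ using ⟨htop, hbot⟩
    have hb : a ≤ 1 := by exact_mod_cast ha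
    rw [← EReal.coe_neg, EReal.tendsto_coe] at hr
    rw [EReal.toReal_coe]
    have h2 : -a + 2 ≠ 0 := by linarith
    have h3 : a - 2 ≠ 0 := by linarith
    have := ((hr.add_const 2).inv₀ h2).const_sub 1
    convert this using 2
    field_simp
    ring

end Parameters

end JacobiJack

end

/-! ### Proof of the theorem. -/

open JacobiJack in
theorem theorem1 (n : ℕ) (hn : 0 < n) (lam : Fin n → ℕ) (hlam : Antitone lam) :
    ∃ C : ℝ, C ≠ 0 ∧
      ∀ k₃ : ℝ,
        (0 ≤ k₃ ∨ Nondegenerate (aRoot n) (aMult n k₃) (proj n (toVec lam))) →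
        (∃! q : sumZero n → ℝ, IsJacobi (aRoot n) (aMult n k₃) (proj n (toVec lam)) q) ∧
        ∀ a : EReal, a ≤ 1 →
          (∀ᶠ k : ℝ × ℝ in limitFilter a, ∃! p : EuclideanSpace ℝ (Fin n) → ℝ,
            IsJacobi (bcRoot n) (bcMult n k.1 k.2 k₃) (toVec lam) p) ∧
          ∀ τ t : EuclideanSpace ℝ (Fin n),
            (∀ i, Real.exp (τ i) = shift a + Real.sinh (t i / 2) ^ 2) →
            Tendsto
              (fun k : ℝ × ℝ => jacobi (bcRoot n) (bcMult n k.1 k.2 k₃) (toVec lam) t)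
              (limitFilter a) (𝓝 (C * jack n k₃ lam τ)) := by
  obtain ⟨l, rfl⟩ : ∃ l : Fin n →₀ ℕ, lam = l := ⟨Finsupp.equivFunOnFinite.symm lam, by simp⟩
  refine ⟨leadingRatio l, leadingRatio_ne_zero l, fun k₃ h => ?_⟩
  have hnd : Nondegenerate (aRoot n) (aMult n k₃) (proj n (toVec l)) :=
    h.elim (fun h => nondegenerate_of_nonneg h l) id
  obtain ⟨J, hJ, hjac⟩ := exists_isJackPoly hlam hnd
  refine ⟨(isModel_a k₃ hlam).existsUnique_isJacobi hnd, fun a ha => ?_⟩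
  have hndB := eventually_nondegenerate_bc hlam hnd (eventually_sum_ne_zero ha)
    (tendsto_inv_sum ha)
  refine ⟨hndB.mono fun k hk => (isModel_bc k.1 k.2 k₃ hlam).existsUnique_isJacobi hk,
    fun τ t hτ => ?_⟩
  have := tendsto_jacobi_bc hlam hnd hJ hndB (eventually_sum_ne_zero ha) (tendsto_inv_sum ha)
    (tendsto_shift ha) t
  rw [jack_eq hJ hjac]
  simpa only [hτ, add_comm] using this
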